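/- Let $N\ge 2$, $\rho>0$, $n\in\{0,1,2,\dots\}$, $\boldsymbol r'\in\mathbb R^N$. For $\lambda\in\mathbb C$, a Green's function of the fish-eye equation with source $\boldsymbol r'$ is a $C^2$ function $G:\mathbb R^N\setminus\{\boldsymbol r'\}\to\mathbb C$ with $$\Big[\nabla^2+\frac{4\lambda\rho^2}{(r^2+\rho^2)^2}\Big]G=0\quad(\boldsymbol r\ne\boldsymbol r'),$$ such that, as $\boldsymbol r\to\boldsymbol r'$, $G\sim\frac1{2\pi}\ln|\boldsymbol r-\boldsymbol r'|$ if $N=2$ and $G\sim-\frac{1}{(N-2)S_{N-1}|\boldsymbol r-\boldsymbol r'|^{N-2}}$ if $N\ge3$, where $S_{N-1}=2\pi^{N/2}/\Gamma(N/2)$, and such that $r^{N-2}G$ tends to a finite constant as $r\to\infty$. Write $G_\nu(\boldsymbol r,\boldsymbol r')$ for the Green's function with $\lambda=\nu(\nu+1)$. Let $\nu_0=n+N/2-1$ or $\nu_0=-n-N/2$, so that $\lambda_0:=\nu_0(\nu_0+1)=(n+\frac N2)(n+\frac N2-1)$. Then no Green's function exists for $\lambda=\lambda_0$, while for all $\lambda\ne\lambda_0$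 in a neighbourhood of $\lambda_0$ the Green's function exists and is unique. For every $\boldsymbol r\ne\boldsymbol r'$ the limits in the definition of the generalized Green's function $$\bar G_{\nu_0}(\boldsymbol r,\boldsymbol r')=\lim_{\nu(\nu+1)\to\lambda_0}\frac{\partial}{\partial[\nu(\nu+1)]}\Big\{[\nu(\nu+1)-\lambda_0]G_\nu(\boldsymbol r,\boldsymbol r')\Big\} =\frac{1}{2n+N-1}\lim_{\nu\to n+N/2-1}\frac{\partial}{\partial\nu}\Big[\big(\nu-n-\tfrac N2+1\big)\big(\nu+n+\tfrac N2\big)G_\nu(\boldsymbol r,\boldsymbol r')\Big]$$ exist (the derivatives existing near the limit point) and agree. The function $\bar G_{\nu_0}(\cdot,\boldsymbol r')$ is continuous on $\mathbb R^N\setminus\{\boldsymbol r'\}$, and with $$x=-1+\frac{2\rho^2|\boldsymbol r-\boldsymbol r'|^2}{(r^2+\rho^2)(r'^2+\rho^2)},$$ for every $\boldsymbol r\ne\boldsymbol r'$ with, if $N\ge3$, $r^2r'^2+2\rho^2\boldsymbol r\cdot\boldsymbol r'+\rho^4\ne0$ (that is, $\boldsymbol r\neq-\boldsymbol r'\rho^2/r'^2$),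 the following derivative with respect to $\nu$ exists and $$\bar G_{\nu_0}(\boldsymbol r,\boldsymbol r')=(-1)^n\frac{(n+N-2)!}{4\pi^{N/2}\,n!}\,\frac{\rho^{N/2-1}}{|\boldsymbol r-\boldsymbol r'|^{N/2-1}\big(r^2r'^2+2\rho^2\boldsymbol r\cdot\boldsymbol r'+\rho^4\big)^{N/4-1/2}}$$ $$\times\Big\{\Big[\psi(n+N-1)-\psi(n+1)+\frac1{2n+N-1}\Big]P_{n+N/2-1}^{-N/2+1}(x)+\frac{\partial P_\nu^{-N/2+1}(x)}{\partial\nu}\Big|_{\nu=n+N/2-1}\Big\}.$$ Here $\psi=\Gamma'/\Gamma$ is the digamma function and, for order $\mu\le0$, $P_\nu^{\mu}(x)=\frac{1}{\Gamma(1-\mu)}\big(\frac{1+x}{1-x}\big)^{\mu/2}{}_2F_1\big(-\nu,\nu+1;1-\mu;\frac{1-x}{2}\big)$ is the associated Legendre function on the cut, with $P_\nu^0(1)=1$. -/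

import Mathlib

open Filter Topology

noncomputable section

/-- The Legendre function of the first kind on the cut (Ferrers function) `P_ν^μ(x)`,
`-1 < x < 1`, of complex degree `ν` and real order `μ` not equal to `1, 2, 3, …`
(only orders `μ ≤ 0` are used). For `μ = 0` the value at `x = 1` is the limiting value `1`. -/
def legendreP (ν : ℂ) (μ x : ℝ) : ℂ :=
  ((((1 + x) / (1 - x)) ^ (μ / 2) : ℝ) : ℂ) / Complex.Gamma (1 - (μ : ℂ)) *
    ordinaryHypergeometric (-ν) (ν + 1) (1 - (μ : ℂ)) (((1 - x) / 2 : ℝ) : ℂ)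

/-- Surface area `S_{N-1}` of the unit sphere of `ℝ^N`. -/
def unitSphereArea (N : ℕ) : ℝ :=
  2 * Real.pi ^ ((N : ℝ) / 2) / Real.Gamma ((N : ℝ) / 2)

/-- The singular behaviour prescribed at the source point, as a function of `d = |r - r'|`. -/
def sourceSingularity (N : ℕ) (d : ℝ) : ℝ :=
  if N = 2 then Real.log d / (2 * Real.pi)
  else -(1 / (((N : ℝ) - 2) * unitSphereArea N * d ^ (N - 2)))

/-- `G` is a Green's function of the fish-eye equation
`[∇² + 4 λ ρ² / (r² + ρ²)²] G = 0`, `λ = ν (ν + 1)`, with source point `r'`: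
a solution away from `r'` with the singularity of a unit source at `r'` that behaves as
`C / r^{N-2}` at infinity. -/
structure IsFishEyeGreen (N : ℕ) (ρ : ℝ) (lam : ℂ) (r' : EuclideanSpace ℝ (Fin N))
    (G : EuclideanSpace ℝ (Fin N) → ℂ) : Prop where
  contDiffOn : ContDiffOn ℝ 2 G {r'}ᶜ
  equation : ∀ r : EuclideanSpace ℝ (Fin N), r ≠ r' →
    Laplacian.laplacian G r + 4 * lam * (ρ : ℂ) ^ 2 / (((‖r‖ ^ 2 + ρ ^ 2) ^ 2 : ℝ) : ℂ) * G r = 0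
  source : Asymptotics.IsEquivalent (𝓝[≠] r') G
    (fun r => ((sourceSingularity N ‖r - r'‖ : ℝ) : ℂ))
  infinity : ∃ C : ℂ, Tendsto (fun r : EuclideanSpace ℝ (Fin N) => ((‖r‖ ^ (N - 2) : ℝ) : ℂ) * G r)
    (Bornology.cobounded (EuclideanSpace ℝ (Fin N))) (𝓝 C)

open Classical in
/-- The fish-eye Green's function `G(r, r')` as a function of the parameter `λ = ν (ν + 1)`
(through which alone `ν` enters); `0` if there is none. -/
def fishEyeGreen (N : ℕ) (ρ : ℝ) (lam : ℂ) (r r' : EuclideanSpace ℝ (Fin N)) : ℂ :=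
  if h : ∃ G, IsFishEyeGreen N ρ lam r' G then h.choose r else 0

/-- The generalized Green's function `Ḡ_{ν₀}(r, r')` at an exceptional value `ν₀`:
the limit, as `λ → λ₀ = ν₀ (ν₀ + 1)`, of `∂/∂λ [(λ - λ₀) G]`. -/
def fishEyeGeneralizedGreen (N : ℕ) (ρ : ℝ) (ν₀ : ℂ) (r r' : EuclideanSpace ℝ (Fin N)) : ℂ :=
  limUnder (𝓝[≠] (ν₀ * (ν₀ + 1))) fun lam =>
    deriv (fun l : ℂ => (l - ν₀ * (ν₀ + 1)) * fishEyeGreen N ρ l r r') lam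

/-- `-1 + 2 ρ² |r - r'|² / ((r² + ρ²) (r'² + ρ²))`. -/
def fishEyeArg {N : ℕ} (ρ : ℝ) (r r' : EuclideanSpace ℝ (Fin N)) : ℝ :=
  -1 + 2 * ρ ^ 2 * ‖r - r'‖ ^ 2 / ((‖r‖ ^ 2 + ρ ^ 2) * (‖r'‖ ^ 2 + ρ ^ 2))

/-- `r² r'² + 2 ρ² r · r' + ρ⁴`; for `r' ≠ 0` it vanishes exactly at the image point
`r = -r' ρ² / r'²`. -/
def fishEyeImageFactor {N : ℕ} (ρ : ℝ) (r r' : EuclideanSpace ℝ (Fin N)) : ℝ :=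
  ‖r‖ ^ 2 * ‖r'‖ ^ 2 + 2 * ρ ^ 2 * inner ℝ r r' + ρ ^ 4

end

/-! Under stereographic projection the fish-eye operator becomes, once the conformal factor (r² +
ρ²)^(1 - N/2) (`fishFactor`, written m below) is split off, a multiple of the Laplacian of the
sphere plus a constant. On functions of s, the squared sine of half the spherical distance to a
fixed point (`fishSin`), it acts as a hypergeometric operator (`zonalOp`, `fishEye_operator_zonal`).
For λ = ν(ν+1) the zonal solution regular at the antipode s = 1 is F(N/2+ν, N/2-1-ν; N/2; 1-s)
(`zonalHyp`). As s → 0 it is asymptotic to a constant times 1/(Γ(N/2+ν) Γ(N/2-1-ν)) times -log s or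
s^(1-N/2) (`tendsto_hyp_zonalSing`), so multiplying it by the two Gamma factors and by m gives the
Green's function as long as neither factor is at a pole (`isFishEyeGreen_explicitGreen`).

Uniqueness and nonexistence both rest on zonal means. If u solves the equation off r' and g is a
zonal solution about p, then a weighted mean of u/(m g) over shells about p does not depend on the
radius of the shell (`exists_zonal_mean`). This is Green's identity tested against m f(s), where f =
g h is built by reduction of order so that the operator sends it to a prescribed density
(`exists_zonal_test`); the points r' and infinity are cut out by logarithmic cutoffs, whose error
vanishes when u is small compared with the fundamental singularity (`integral_zonalOp_eq_zero`). For
uniqueness, u is a difference of Green's functions and g is singular at p: the quotient tends to 0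
at p, so the constant mean is 0; but if u(p) ≠ 0 the quotient, suitably rotated, has positive real
part near p, a contradiction (`eq_zero_of_isNegligible`). For nonexistence at λ₀ the hypergeometric
series terminates, so g is a polynomial in s with g(0) = 1 and no singularity: with p = r' the
quotient G/(m g) blows up at the source while its mean stays fixed (`not_exists_isFishEyeGreen`).

Near ν₀ = n + N/2 - 1 only Γ(N/2-1-ν) has a pole, and it is simple. The factor λ - λ₀ = (ν - ν₀)(ν +
ν₀ + 1) cancels it, leaving a function analytic at ν₀ (`regGreen`, through the reflection formula),
so both limits are ordinary derivatives, related by dν/dλ = 1/(2n+N-1) at ν₀. The logarithmic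
derivative of the Gamma factors gives the digamma bracket (`hasDerivAt_regGamma`). Euler's
transformation identifies `zonalHyp` with the Legendre function up to a factor independent of ν
(`legendreP_eq`, `legendre_prefactor`). -/

noncomputable section

/-! ### The Gauss series: convergence, parameter dependence, differential equation -/

/-- A majorant of the hypergeometric coefficients with numerator parameters bounded by `M`. -/
def hypMaj (M c : ℝ) (k : ℕ) : ℝ := ∏ j ∈ Finset.range k, (M + j) ^ 2 / ((c + j) * (1 + j))

lemma hypMaj_pos {M c : ℝ} (hM : 0 < M) (hc : 0 < c) (k : ℕ) : 0 < hypMaj M c k := by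
  refine Finset.prod_pos fun j _ => ?_
  have := Nat.cast_nonneg (α := ℝ) j
  positivity

lemma summable_hypMaj {M c R : ℝ} (hM : 0 < M) (hc : 0 < c) (hR : 0 < R) (hR1 : R < 1) :
    Summable fun k => hypMaj M c k * R ^ k := by
  refine summable_of_ratio_test_tendsto_lt_one hR1
    (Eventually.of_forall fun k => (mul_pos (hypMaj_pos hM hc k) (pow_pos hR k)).ne') ?_
  have h1 : ∀ k : ℕ, ‖hypMaj M c (k + 1) * R ^ (k + 1)‖ / ‖hypMaj M c k * R ^ k‖
      = (M + k) / (c + k) * ((M + k) / (1 + k)) * R := by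
    intro k
    have hk := hypMaj_pos hM hc k
    have hk' := hypMaj_pos hM hc (k + 1)
    have := Nat.cast_nonneg (α := ℝ) k
    rw [Real.norm_of_nonneg (by positivity), Real.norm_of_nonneg (by positivity)]
    rw [show hypMaj M c (k + 1) = hypMaj M c k * ((M + k) ^ 2 / ((c + k) * (1 + k))) from
      Finset.prod_range_succ _ _]
    rw [pow_succ R k]
    field_simp
  simp_rw [h1]
  have h2 : ∀ x y : ℝ, Tendsto (fun k : ℕ => (x + k) / (y + k)) atTop (𝓝 1) := by
    intro x y
    have := tendsto_add_mul_div_add_mul_atTop_nhds x y (1 : ℝ) one_ne_zero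
    simpa using this
  simpa using ((h2 M c).mul (h2 M 1)).mul_const R

/-- The coefficients of the hypergeometric series. -/
def hypCoeff (a b c : ℂ) (k : ℕ) : ℂ := ordinaryHypergeometricCoefficient a b c k

lemma hypCoeff_zero (a b c : ℂ) : hypCoeff a b c 0 = 1 := by
  simp [hypCoeff, ordinaryHypergeometricCoefficient]

lemma ofReal_add_nat_ne_zero {c : ℝ} (hc : 0 < c) (k : ℕ) : (c : ℂ) + k ≠ 0 := by
  have : (0 : ℝ) < c + k := by positivity
  exact_mod_cast this.ne'

lemma hypCoeff_succ (a b c : ℂ) (k : ℕ) :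
    hypCoeff a b c (k + 1) = hypCoeff a b c k * ((a + k) * (b + k) / ((c + k) * (1 + k))) := by
  simp only [hypCoeff, ordinaryHypergeometricCoefficient, ascPochhammer_succ_eval,
    Nat.factorial_succ, Nat.cast_mul, Nat.cast_add, Nat.cast_one, mul_inv, div_eq_mul_inv]
  ring

/-- The bound is uniform over all parameters of norm at most M, so the Weierstrass test yields
continuity and holomorphy jointly in the parameters and the argument. -/
lemma norm_hypCoeff_le {a b : ℂ} {M c : ℝ} (hc : 0 < c) (ha : ‖a‖ ≤ M) (hb : ‖b‖ ≤ M) (k : ℕ) :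
    ‖hypCoeff a b c k‖ ≤ hypMaj M c k := by
  induction k with
  | zero => simp [hypCoeff_zero, hypMaj]
  | succ k ih =>
    rw [hypCoeff_succ, show hypMaj M c (k + 1) = hypMaj M c k * ((M + k) ^ 2 / ((c + k) * (1 + k)))
      from Finset.prod_range_succ _ _, norm_mul, norm_div, norm_mul, norm_mul]
    have e1 : ‖(c : ℂ) + k‖ = c + k := by
      rw [show (c : ℂ) + k = ((c + k : ℝ) : ℂ) by push_cast; ring, Complex.norm_real,
        Real.norm_of_nonneg (by positivity)]
    have e2 : ‖(1 : ℂ) + k‖ = 1 + k := by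
      rw [show (1 : ℂ) + k = ((1 + k : ℝ) : ℂ) by push_cast; ring, Complex.norm_real,
        Real.norm_of_nonneg (by positivity)]
    rw [e1, e2, sq]
    have e3 : ‖a + k‖ ≤ M + k := (norm_add_le _ _).trans (by simpa using ha)
    have e4 : ‖b + k‖ ≤ M + k := (norm_add_le _ _).trans (by simpa using hb)
    have hM : 0 ≤ M := (norm_nonneg _).trans ha
    gcongr
    exact (norm_nonneg _).trans ih

lemma hyp_eq_tsum (a b c z : ℂ) :
    ordinaryHypergeometric a b c z = ∑' k, hypCoeff a b c k * z ^ k := by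
  rw [ordinaryHypergeometric_eq_tsum]
  rfl

lemma norm_hyp_term_le {a b z : ℂ} {M c R : ℝ} (hc : 0 < c) (ha : ‖a‖ ≤ M) (hb : ‖b‖ ≤ M)
    (hz : ‖z‖ ≤ R) (k : ℕ) : ‖hypCoeff a b c k * z ^ k‖ ≤ hypMaj M c k * R ^ k := by
  rw [norm_mul, norm_pow]
  have := norm_hypCoeff_le hc ha hb k
  gcongr
  exact (norm_nonneg _).trans this

lemma summable_hyp {c : ℝ} (hc : 0 < c) (a b : ℂ) {z : ℂ} (hz : ‖z‖ < 1) :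
    Summable fun k => hypCoeff a b c k * z ^ k := by
  obtain ⟨R, h1, h2⟩ := exists_between hz
  have hR : 0 < R := (norm_nonneg _).trans_lt h1
  have hM : 0 < ‖a‖ + ‖b‖ + 1 := by positivity
  refine Summable.of_norm_bounded (summable_hypMaj hM hc hR h2) (norm_hyp_term_le hc ?_ ?_ h1.le)
  · linarith [norm_nonneg b]
  · linarith [norm_nonneg a]

/-- The hypergeometric function is jointly continuous in its numerator parameters and its
argument. -/
lemma continuousOn_hyp {c : ℝ} (hc : 0 < c) :
    ContinuousOn (fun p : ℂ × ℂ × ℂ => ordinaryHypergeometric p.1 p.2.1 (c : ℂ) p.2.2)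
      {p | ‖p.2.2‖ < 1} := by
  intro p hp
  obtain ⟨R, h1, h2⟩ := exists_between (show ‖p.2.2‖ < 1 from hp)
  have hR : 0 < R := (norm_nonneg _).trans_lt h1
  set M := ‖p.1‖ + ‖p.2.1‖ + 1 with hMdef
  have hM : 0 < M := by positivity
  set S : Set (ℂ × ℂ × ℂ) := {q | ‖q.1‖ < M ∧ ‖q.2.1‖ < M ∧ ‖q.2.2‖ < R} with hS
  have hSo : IsOpen S := by
    refine IsOpen.and (isOpen_lt (by fun_prop) continuous_const)
      (IsOpen.and (isOpen_lt (by fun_prop) continuous_const)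
        (isOpen_lt (by fun_prop) continuous_const))
  have hpS : p ∈ S := ⟨by linarith [norm_nonneg p.2.1], by linarith [norm_nonneg p.1], h1⟩
  have hcont : ContinuousOn (fun p : ℂ × ℂ × ℂ => ∑' k, hypCoeff p.1 p.2.1 c k * p.2.2 ^ k) S := by
    refine continuousOn_tsum (u := fun k => hypMaj M c k * R ^ k) (fun k => ?_)
      (summable_hypMaj hM hc hR h2) (fun k q hq => norm_hyp_term_le hc hq.1.le hq.2.1.le hq.2.2.le k)
    apply Continuous.continuousOn
    simp only [hypCoeff, ordinaryHypergeometricCoefficient]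
    fun_prop
  refine ContinuousAt.continuousWithinAt ?_
  have := hcont.continuousAt (hSo.mem_nhds hpS)
  simpa only [← hyp_eq_tsum] using this

lemma differentiable_hyp_param {c : ℝ} (hc : 0 < c) {a b : ℂ → ℂ} (ha : Differentiable ℂ a)
    (hb : Differentiable ℂ b) {z : ℂ} (hz : ‖z‖ < 1) :
    Differentiable ℂ fun ν => ordinaryHypergeometric (a ν) (b ν) (c : ℂ) z := by
  intro ν
  obtain ⟨R, h1, h2⟩ := exists_between hz
  have hR : 0 < R := (norm_nonneg _).trans_lt h1
  set M := ‖a ν‖ + ‖b ν‖ + 1 with hMdef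
  have hM : 0 < M := by positivity
  set S : Set ℂ := {w | ‖a w‖ < M ∧ ‖b w‖ < M} with hS
  have hSo : IsOpen S := IsOpen.and (isOpen_lt ha.continuous.norm continuous_const)
    (isOpen_lt hb.continuous.norm continuous_const)
  have hpS : ν ∈ S := ⟨by linarith [norm_nonneg (b ν)], by linarith [norm_nonneg (a ν)]⟩
  have hd : DifferentiableOn ℂ (fun w => ∑' k, hypCoeff (a w) (b w) c k * z ^ k) S := by
    refine Complex.differentiableOn_tsum_of_summable_norm (summable_hypMaj hM hc hR h2) (fun k => ?_)
      hSo (fun k w hw => norm_hyp_term_le hc hw.1.le hw.2.le h1.le k)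
    apply Differentiable.differentiableOn
    simp only [hypCoeff, ordinaryHypergeometricCoefficient]
    have h3 : ∀ f : ℂ → ℂ, Differentiable ℂ f →
        Differentiable ℂ fun w => (ascPochhammer ℂ k).eval (f w) := fun f hf =>
      (ascPochhammer ℂ k).differentiable.comp hf
    exact (((h3 a ha).const_mul _).mul (h3 b hb)).mul_const _ |>.mul_const _
  have := hd.differentiableAt (hSo.mem_nhds hpS)
  simpa only [← hyp_eq_tsum] using this

/-- The coefficient form of F' = (ab/c) F(a+1, b+1; c+1); it drives both termwise differentiation
and the differential equation. -/
lemma hypCoeff_shift {c : ℝ} (hc : 0 < c) (a b : ℂ) (k : ℕ) :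
    (k + 1) * hypCoeff a b c (k + 1) = a * b / c * hypCoeff (a + 1) (b + 1) (c + 1) k := by
  have hc0 : (c : ℂ) ≠ 0 := by exact_mod_cast hc.ne'
  induction k with
  | zero => rw [hypCoeff_succ, hypCoeff_zero, hypCoeff_zero]; simp
  | succ k ih =>
    have h1 := ofReal_add_nat_ne_zero hc (k + 1)
    have h2 : (1 : ℂ) + k ≠ 0 := by exact_mod_cast (by positivity : (0 : ℝ) < 1 + k).ne'
    have h3 : (1 : ℂ) + (k + 1 : ℕ) ≠ 0 := by
      exact_mod_cast (by positivity : (0 : ℝ) < 1 + (k + 1 : ℕ)).ne'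
    rw [hypCoeff_succ a b c (k + 1), hypCoeff_succ (a + 1), ← mul_assoc _ (hypCoeff _ _ _ k), ← ih]
    push_cast at *
    have h4 : (c : ℂ) + 1 + k ≠ 0 := by convert h1 using 1; ring
    field_simp
    ring

lemma hasDerivAt_hyp {c : ℝ} (hc : 0 < c) (a b : ℂ) {z : ℂ} (hz : ‖z‖ < 1) :
    HasDerivAt (ordinaryHypergeometric a b (c : ℂ))
      (a * b / c * ordinaryHypergeometric (a + 1) (b + 1) ((c + 1 : ℝ) : ℂ) z) z := by
  obtain ⟨R, h1, h2⟩ := exists_between hz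
  have hR : 0 < R := (norm_nonneg _).trans_lt h1
  have hM : 0 < ‖a‖ + ‖b‖ + 1 := by positivity
  have hzS : z ∈ Metric.ball (0 : ℂ) R := by simpa using h1
  have hbd : ∀ (k : ℕ) (w : ℂ), w ∈ Metric.ball (0 : ℂ) R →
      ‖hypCoeff a b c k * w ^ k‖ ≤ hypMaj (‖a‖ + ‖b‖ + 1) c k * R ^ k := fun k w hw =>
    norm_hyp_term_le hc (by linarith [norm_nonneg b]) (by linarith [norm_nonneg a])
      (by simpa using (Metric.mem_ball.1 hw).le) k
  have hdf : ∀ k : ℕ, DifferentiableOn ℂ (fun w : ℂ => hypCoeff a b c k * w ^ k)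
      (Metric.ball (0 : ℂ) R) := fun k => by fun_prop
  have hs := summable_hypMaj hM hc hR h2
  have hd := Complex.differentiableOn_tsum_of_summable_norm hs hdf Metric.isOpen_ball hbd
  have hsum := Complex.hasSum_deriv_of_summable_norm hs hdf Metric.isOpen_ball hbd hzS
  have heq : ordinaryHypergeometric a b (c : ℂ) = fun w => ∑' k, hypCoeff a b c k * w ^ k := by
    funext w; exact hyp_eq_tsum _ _ _ _
  rw [heq]
  convert! (hd.differentiableAt (Metric.isOpen_ball.mem_nhds hzS)).hasDerivAt using 1
  rw [← hsum.tsum_eq, hsum.summable.tsum_eq_zero_add, hyp_eq_tsum, ← tsum_mul_left]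
  simp only [deriv_const_mul_field', deriv_pow_field]
  simp only [Nat.cast_zero, zero_mul, mul_zero, zero_add, Nat.add_sub_cancel]
  refine tsum_congr fun k => ?_
  have := hypCoeff_shift hc a b k
  push_cast
  linear_combination (-z ^ k) * this

/-- The derivatives are written as shifted series. Multiplying the k-th coefficient by k is the
Euler operator z d/dz, so the equation becomes, coefficient by coefficient, the recurrence
(c+k)(1+k) a_{k+1} = (a+k)(b+k) a_k. -/
lemma hyp_ode {c : ℝ} (hc : 0 < c) (a b : ℂ) {z : ℂ} (hz : ‖z‖ < 1) :
    z * (1 - z) * (a * b / c * ((a + 1) * (b + 1) / (c + 1) *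
        ordinaryHypergeometric (a + 2) (b + 2) ((c + 2 : ℝ) : ℂ) z)) +
      (c - (a + b + 1) * z) *
        (a * b / c * ordinaryHypergeometric (a + 1) (b + 1) ((c + 1 : ℝ) : ℂ) z) -
      a * b * ordinaryHypergeometric a b (c : ℂ) z = 0 := by
  have hc0 : (c : ℂ) ≠ 0 := by exact_mod_cast hc.ne'
  have hc1 : (c : ℂ) + 1 ≠ 0 := by exact_mod_cast (by positivity : 0 < c + 1).ne'
  have s0 := (summable_hyp hc a b hz).hasSum
  have s1 := (summable_hyp (add_pos hc one_pos) (a + 1) (b + 1) hz).hasSum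
  have s2 := (summable_hyp (add_pos hc two_pos) (a + 2) (b + 2) hz).hasSum
  rw [← hyp_eq_tsum] at s0 s1 s2
  have d1 : HasSum (fun k : ℕ => ((k : ℂ) * hypCoeff a b c k) * z ^ k)
      (z * (a * b / c * ordinaryHypergeometric (a + 1) (b + 1) ((c + 1 : ℝ) : ℂ) z)) := by
    -- The k = 0 term vanishes because of the factor k, so the sum may be shifted by one.
    rw [← hasSum_nat_add_iff' 1]
    simp only [Finset.range_one, Finset.sum_singleton, Nat.cast_zero, zero_mul, sub_zero]
    convert! s1.mul_left (z * (a * b / c)) using 1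
    · funext k
      have := hypCoeff_shift hc a b k
      push_cast
      rw [this]; ring
    · ring
  have e1 : HasSum (fun k : ℕ => (((k : ℂ) + 1) * hypCoeff a b c (k + 1)) * z ^ k)
      (a * b / c * ordinaryHypergeometric (a + 1) (b + 1) ((c + 1 : ℝ) : ℂ) z) := by
    convert! s1.mul_left (a * b / c) using 1
    funext k
    have := hypCoeff_shift hc a b k
    push_cast
    rw [this]; ring
  have sh : ∀ k : ℕ, ((k : ℂ) + 2) * ((k : ℂ) + 1) * hypCoeff a b c (k + 2) =
      a * b / c * ((a + 1) * (b + 1) / (c + 1) * hypCoeff (a + 2) (b + 2) ((c + 2 : ℝ) : ℂ) k) := by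
    intro k
    have h1 := hypCoeff_shift hc a b (k + 1)
    have h2 := hypCoeff_shift (add_pos hc one_pos) (a + 1) (b + 1) k
    push_cast at *
    rw [show a + 1 + 1 = a + 2 by ring, show b + 1 + 1 = b + 2 by ring,
      show (c : ℂ) + 1 + 1 = c + 2 by ring] at h2
    linear_combination ((k : ℂ) + 1) * h1 + a * b / c * h2
  have e2 : HasSum (fun k : ℕ => ((k : ℂ) * (((k : ℂ) + 1) * hypCoeff a b c (k + 1))) * z ^ k)
      (z * (a * b / c * ((a + 1) * (b + 1) / (c + 1) *
        ordinaryHypergeometric (a + 2) (b + 2) ((c + 2 : ℝ) : ℂ) z))) := by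
    rw [← hasSum_nat_add_iff' 1]
    simp only [Finset.range_one, Finset.sum_singleton, Nat.cast_zero, zero_mul, sub_zero]
    convert! s2.mul_left (z * (a * b / c * ((a + 1) * (b + 1) / (c + 1)))) using 1
    · funext k
      have := sh k
      push_cast at *
      linear_combination z ^ (k + 1) * this
    · ring
  have d2 : HasSum (fun k : ℕ => ((k : ℂ) * ((k : ℂ) - 1) * hypCoeff a b c k) * z ^ k)
      (z * z * (a * b / c * ((a + 1) * (b + 1) / (c + 1) *
        ordinaryHypergeometric (a + 2) (b + 2) ((c + 2 : ℝ) : ℂ) z))) := by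
    rw [← hasSum_nat_add_iff' 1]
    simp only [Finset.range_one, Finset.sum_singleton, Nat.cast_zero, zero_mul, sub_zero]
    convert! e2.mul_left z using 1
    · funext k
      push_cast
      ring
    · ring
  have tot := ((e2.sub d2).add ((e1.mul_left (c : ℂ)).sub (d1.mul_left (a + b + 1)))).sub
    (s0.mul_left (a * b))
  have hz0 : (fun k : ℕ => ((k : ℂ) * (((k : ℂ) + 1) * hypCoeff a b c (k + 1))) * z ^ k -
      ((k : ℂ) * ((k : ℂ) - 1) * hypCoeff a b c k) * z ^ k +
      ((c : ℂ) * ((((k : ℂ) + 1) * hypCoeff a b c (k + 1)) * z ^ k) -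
        (a + b + 1) * (((k : ℂ) * hypCoeff a b c k) * z ^ k)) -
      a * b * (hypCoeff a b c k * z ^ k)) = fun _ => 0 := by
    funext k
    have h1 := ofReal_add_nat_ne_zero hc k
    have h2 : (1 : ℂ) + k ≠ 0 := by exact_mod_cast (by positivity : (0 : ℝ) < 1 + k).ne'
    have key : ((c : ℂ) + k) * (1 + k) * hypCoeff a b c (k + 1) =
        (a + k) * (b + k) * hypCoeff a b c k := by
      rw [hypCoeff_succ]; field_simp
    linear_combination z ^ k * key
  rw [hz0] at tot
  have := tot.unique hasSum_zero
  linear_combination this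

lemma differentiableOn_hyp {c : ℝ} (hc : 0 < c) (a b : ℂ) :
    DifferentiableOn ℂ (ordinaryHypergeometric a b (c : ℂ)) (Metric.ball (0 : ℂ) 1) := fun z hz =>
  (hasDerivAt_hyp hc a b (by simpa using hz)).differentiableAt.differentiableWithinAt

/-! ### Behaviour of the hypergeometric function at 1, by an Abelian argument -/

/-- If the coefficients `a` are asymptotic to `A * b` with `b ≥ 0`, and `∑ b k x ^ k` blows up
at `x = 1`, then the ratio of the power series tends to `A`. -/
lemma tendsto_powerSeries_ratio {a : ℕ → ℂ} {b : ℕ → ℝ} {A : ℂ} (hb : ∀ k, 0 ≤ b k)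
    (h : (fun k => a k - A * b k) =o[atTop] b)
    (hs : ∀ x : ℝ, 0 < x → x < 1 → Summable fun k => b k * x ^ k)
    (ha : ∀ x : ℝ, 0 < x → x < 1 → Summable fun k => a k * (x : ℂ) ^ k)
    (hB : Tendsto (fun x : ℝ => ∑' k, b k * x ^ k) (𝓝[<] 1) atTop) :
    Tendsto (fun x : ℝ => (∑' k, a k * (x : ℂ) ^ k) / ((∑' k, b k * x ^ k : ℝ) : ℂ))
      (𝓝[<] 1) (𝓝 A) := by
  rw [Metric.tendsto_nhds]
  intro η hη
  -- Beyond K the coefficients differ by at most (η/2) b k. The finitely many earlier terms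
  -- contribute at most the constant C, which is negligible because the comparison sum B tends to
  -- infinity.
  obtain ⟨K, hK⟩ := eventually_atTop.1 (h.bound (half_pos hη))
  set C := ∑ k ∈ Finset.range K, ‖a k - A * b k‖ with hC
  have hx0 : ∀ᶠ x : ℝ in 𝓝[<] 1, 0 < x ∧ x < 1 := by
    filter_upwards [self_mem_nhdsWithin, mem_nhdsWithin_of_mem_nhds (lt_mem_nhds one_pos)]
      with x hx hx' using ⟨hx', hx⟩
  filter_upwards [hx0, hB.eventually_gt_atTop (2 * C / η), hB.eventually_gt_atTop 0]
    with x hx hBx hBp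
  set B := ∑' k, b k * x ^ k with hBdef
  have e1 : (∑' k, a k * (x : ℂ) ^ k) - A * (B : ℂ) = ∑' k, (a k - A * b k) * (x : ℂ) ^ k := by
    have h1 : Summable fun k => A * ((b k : ℂ) * (x : ℂ) ^ k) := by
      have := (Complex.hasSum_ofReal.2 (hs x hx.1 hx.2).hasSum).summable.mul_left A
      simpa using this
    rw [hBdef, Complex.ofReal_tsum, ← tsum_mul_left]
    push_cast
    rw [← (ha x hx.1 hx.2).tsum_sub h1]
    exact tsum_congr fun k => by ring
  have hfin : HasSum (fun k => if k ∈ Finset.range K then ‖a k - A * b k‖ else 0) C := by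
    rw [hC, ← Finset.sum_congr rfl (fun k hk => if_pos hk)]
    exact hasSum_sum_of_ne_finset_zero fun k hk => if_neg hk
  have hmaj := hfin.add ((hs x hx.1 hx.2).hasSum.mul_left (η / 2))
  have e2 : ‖∑' k, (a k - A * b k) * (x : ℂ) ^ k‖ ≤ C + η / 2 * B := by
    refine tsum_of_norm_bounded hmaj fun k => ?_
    rw [norm_mul, norm_pow, Complex.norm_real, Real.norm_of_nonneg hx.1.le]
    have hxk : x ^ k ≤ 1 := pow_le_one₀ hx.1.le hx.2.le
    have hxk0 : 0 ≤ x ^ k := pow_nonneg hx.1.le k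
    by_cases hk : k ∈ Finset.range K
    · rw [if_pos hk]
      have : 0 ≤ η / 2 * (b k * x ^ k) := by have := hb k; positivity
      nlinarith [mul_le_of_le_one_right (norm_nonneg (a k - A * b k)) hxk]
    · rw [if_neg hk, zero_add]
      have := hK k (by simpa using hk)
      rw [Real.norm_of_nonneg (hb k)] at this
      nlinarith
  rw [dist_eq_norm]
  have hBc : (B : ℂ) ≠ 0 := by exact_mod_cast hBp.ne'
  rw [show (∑' k, a k * (x : ℂ) ^ k) / (B : ℂ) - A =
    ((∑' k, a k * (x : ℂ) ^ k) - A * (B : ℂ)) / (B : ℂ) by field_simp, e1, norm_div,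
    Complex.norm_real, Real.norm_of_nonneg hBp.le, div_lt_iff₀ hBp]
  rw [div_lt_iff₀ hη] at hBx
  nlinarith

lemma ascPochhammer_eval_eq_prod (s : ℂ) (k : ℕ) :
    (ascPochhammer ℂ k).eval s = ∏ j ∈ Finset.range k, (s + j) := by
  induction k with
  | zero => simp
  | succ k ih => rw [ascPochhammer_succ_eval, ih, Finset.prod_range_succ]

lemma ascPochhammer_eval_eq_prod_range_real (s : ℝ) (k : ℕ) :
    (ascPochhammer ℝ k).eval s = ∏ j ∈ Finset.range k, (s + j) := by
  induction k with
  | zero => simp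
  | succ k ih => rw [ascPochhammer_succ_eval, ih, Finset.prod_range_succ]

/-- `GammaSeq` s n has n + 1 factors in its denominator, so it encodes the Pochhammer symbol of
length n + 1. The asymptotics of Pochhammer symbols then follow from Euler's limit for Γ. -/
lemma hypCoeff_mul_GammaSeq {a b : ℂ} (ha : ∀ m : ℕ, a ≠ -m) (hb : ∀ m : ℕ, b ≠ -m)
    (n : ℕ) (hn : n ≠ 0) :
    (ascPochhammer ℂ (n + 1)).eval a * (ascPochhammer ℂ (n + 1)).eval b =
      (n : ℂ) ^ (a + b) * (n.factorial : ℂ) ^ 2 /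
        (Complex.GammaSeq a n * Complex.GammaSeq b n) := by
  have hn' : (n : ℂ) ≠ 0 := by exact_mod_cast hn
  have hf : (n.factorial : ℂ) ≠ 0 := by exact_mod_cast n.factorial_ne_zero
  have h1 : ∀ s : ℂ, (∀ m : ℕ, s ≠ -m) → (ascPochhammer ℂ (n + 1)).eval s ≠ 0 := by
    intro s hs
    rw [ascPochhammer_eval_eq_prod]
    exact Finset.prod_ne_zero_iff.2 fun j _ h => hs j (eq_neg_of_add_eq_zero_left h)
  have h2 := h1 a ha
  have h3 := h1 b hb
  simp only [Complex.GammaSeq, ← ascPochhammer_eval_eq_prod]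
  rw [Complex.cpow_add _ _ hn']
  have h4 : (n : ℂ) ^ a ≠ 0 := by simp [Complex.cpow_eq_zero_iff, hn']
  have h5 : (n : ℂ) ^ b ≠ 0 := by simp [Complex.cpow_eq_zero_iff, hn']
  field_simp

/-- Real coefficients of the binomial series of `(1 - x) ^ (-β)`. -/
def binomCoeff (β : ℝ) (k : ℕ) : ℝ := ordinaryHypergeometricCoefficient β 1 1 k

lemma hasSum_binomCoeff (β : ℝ) {x : ℝ} (h0 : 0 < x) (h1 : x < 1) :
    HasSum (fun k => binomCoeff β k * x ^ k) ((1 - x) ^ (-β)) := by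
  have h := Real.one_add_rpow_hasFPowerSeriesOnBall_zero (a := -β)
  have hx : -x ∈ Metric.eball (0 : ℝ) 1 := by
    simp [Real.enorm_eq_ofReal_abs, abs_of_pos h0, h1]
  have h2 := h.hasSum hx
  rw [binomialSeries_eq_ordinaryHypergeometricSeries (b := (1 : ℝ))
    (fun k hk => by have := Nat.cast_nonneg (α := ℝ) k; linarith)] at h2
  convert! h2 using 1
  · funext k
    rw [FormalMultilinearSeries.compContinuousLinearMap_apply]
    have : (⇑(-ContinuousLinearMap.id ℝ ℝ) ∘ fun _ : Fin k => -x) = fun _ => x := by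
      funext i; simp
    rw [this, ordinaryHypergeometricSeries_apply_eq, neg_neg]
    rfl
  · rw [zero_add, sub_eq_add_neg]

lemma binomCoeff_pos {β : ℝ} (hβ : 0 < β) (k : ℕ) : 0 < binomCoeff β k := by
  have h1 := ascPochhammer_pos k β hβ
  have h2 := ascPochhammer_pos k (1 : ℝ) one_pos
  have h3 : (0 : ℝ) < k.factorial := by exact_mod_cast k.factorial_pos
  simp only [binomCoeff, ordinaryHypergeometricCoefficient]
  positivity

lemma ne_neg_nat_of_pos {x : ℝ} (hx : 0 < x) (m : ℕ) : (x : ℂ) ≠ -m := by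
  intro h
  have : x = -(m : ℝ) := by exact_mod_cast h
  have := Nat.cast_nonneg (α := ℝ) m
  linarith

/-- Behaviour of `₂F₁(a, b; c; x)` at `x = 1` when `a + b > c`, in the balanced case
`a + b = 2c - 1`. -/
lemma tendsto_hyp_one {a b : ℂ} {c : ℝ} (hc : 1 < c) (hab : a + b = 2 * c - 1)
    (ha : ∀ m : ℕ, a ≠ -m) (hb : ∀ m : ℕ, b ≠ -m) :
    Tendsto (fun x : ℝ => ordinaryHypergeometric a b (c : ℂ) (x : ℂ) *
        (((1 - x) ^ (c - 1) : ℝ) : ℂ)) (𝓝[<] 1)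
      (𝓝 (Complex.Gamma c * Complex.Gamma (c - 1) / (Complex.Gamma a * Complex.Gamma b))) := by
  have hc0 : 0 < c := by linarith
  have hc1 : 0 < c - 1 := by linarith
  set A := Complex.Gamma c * Complex.Gamma (c - 1) / (Complex.Gamma a * Complex.Gamma b) with hA
  set β := c - 1 with hβ
  -- The comparison series is (1-x)^(-(c-1)). Since a + b = c + (c-1), the powers of n in the four
  -- Euler products cancel exactly, leaving a ratio that converges to the quotient of Gamma values.
  have hw : ∀ n : ℕ, n ≠ 0 → hypCoeff a b c (n + 1) =
      Complex.GammaSeq c n * Complex.GammaSeq (c - 1) n /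
        (Complex.GammaSeq a n * Complex.GammaSeq b n) * binomCoeff β (n + 1) := by
    intro n hn
    have hn' : (n : ℂ) ≠ 0 := by exact_mod_cast hn
    have h1 := hypCoeff_mul_GammaSeq ha hb n hn
    have hcc : ∀ m : ℕ, (c : ℂ) - 1 ≠ -m := by
      intro m; have := ne_neg_nat_of_pos hc1 m; rw [hβ] at this; push_cast at this; exact this
    have h2 := hypCoeff_mul_GammaSeq (ne_neg_nat_of_pos hc0) hcc n hn
    have hz : ∀ s : ℂ, (∀ m : ℕ, s ≠ -m) → (ascPochhammer ℂ (n + 1)).eval s ≠ 0 := by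
      intro s hs
      rw [ascPochhammer_eval_eq_prod]
      exact Finset.prod_ne_zero_iff.2 fun j _ h => hs j (eq_neg_of_add_eq_zero_left h)
    have hz1 := hz _ (ne_neg_nat_of_pos hc0)
    have hz2 := hz _ hcc
    have hz3 := hz 1 (fun m h => ne_neg_nat_of_pos one_pos m (by exact_mod_cast h))
    have hf : ((n + 1).factorial : ℂ) ≠ 0 := by exact_mod_cast (n + 1).factorial_ne_zero
    have hf' : (n.factorial : ℂ) ≠ 0 := by exact_mod_cast n.factorial_ne_zero
    have hbc : (binomCoeff β (n + 1) : ℂ) = ((n + 1).factorial : ℂ)⁻¹ *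
        (ascPochhammer ℂ (n + 1)).eval ((c : ℂ) - 1) := by
      have : (((ascPochhammer ℝ (n + 1)).eval β : ℝ) : ℂ) =
          (ascPochhammer ℂ (n + 1)).eval ((c : ℂ) - 1) := by
        rw [ascPochhammer_eval_eq_prod, ascPochhammer_eval_eq_prod_range_real, hβ]
        push_cast
        rfl
      rw [← this]
      have h1' : (ascPochhammer ℝ (n + 1)).eval 1 ≠ 0 := (ascPochhammer_pos _ _ one_pos).ne'
      simp only [binomCoeff, ordinaryHypergeometricCoefficient]
      rw [mul_assoc, mul_inv_cancel₀ h1', mul_one]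
      push_cast
      rfl
    have hpow : (n : ℂ) ^ (a + b) ≠ 0 := by simp [Complex.cpow_eq_zero_iff, hn']
    have hgab : Complex.GammaSeq a n * Complex.GammaSeq b n ≠ 0 := by
      intro h0
      rw [h0, div_zero] at h1
      exact mul_ne_zero (hz a ha) (hz b hb) h1
    have hgc : Complex.GammaSeq c n * Complex.GammaSeq (c - 1) n ≠ 0 := by
      intro h0
      rw [h0, div_zero] at h2
      exact mul_ne_zero hz1 hz2 h2
    rw [hbc]
    simp only [hypCoeff, ordinaryHypergeometricCoefficient]
    rw [mul_assoc _ (Polynomial.eval a _), h1]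
    rw [show (c : ℂ) + (c - 1) = a + b by rw [hab]; ring] at h2
    rw [eq_div_iff hgc] at h2
    generalize Complex.GammaSeq a n * Complex.GammaSeq b n = X at *
    field_simp
    linear_combination -h2
  have hlim : Tendsto (fun n : ℕ => Complex.GammaSeq c n * Complex.GammaSeq (c - 1) n /
        (Complex.GammaSeq a n * Complex.GammaSeq b n)) atTop (𝓝 A) :=
    ((Complex.GammaSeq_tendsto_Gamma _).mul (Complex.GammaSeq_tendsto_Gamma _)).div
      ((Complex.GammaSeq_tendsto_Gamma _).mul (Complex.GammaSeq_tendsto_Gamma _))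
      (mul_ne_zero (Complex.Gamma_ne_zero ha) (Complex.Gamma_ne_zero hb))
  have ho : (fun k => hypCoeff a b c k - A * binomCoeff β k) =o[atTop] binomCoeff β := by
    have h1 := (Asymptotics.isLittleO_one_iff ℂ).2 (by simpa using hlim.sub_const A)
    have h2 := h1.mul_isBigO (Asymptotics.isBigO_refl
      (fun n : ℕ => ((binomCoeff β (n + 1) : ℝ) : ℂ)) atTop)
    rw [← Filter.map_add_atTop_eq_nat 1, Asymptotics.isLittleO_map]
    refine (h2.congr' ?_ (EventuallyEq.refl _ _)).trans_isBigO ?_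
    · filter_upwards [eventually_ne_atTop 0] with n hn
      simp only [Function.comp]
      rw [hw n hn]; ring
    · refine Asymptotics.IsBigO.of_bound 1 (Eventually.of_forall fun n => ?_)
      simp [Function.comp]
  have hsum : ∀ᶠ x : ℝ in 𝓝[<] 1, 0 < x ∧ x < 1 := by
    filter_upwards [self_mem_nhdsWithin, mem_nhdsWithin_of_mem_nhds (lt_mem_nhds one_pos)]
      with x hx hx' using ⟨hx', hx⟩
  have hB : Tendsto (fun x : ℝ => ∑' k, binomCoeff β k * x ^ k) (𝓝[<] 1) atTop := by
    have h1 : Tendsto (fun x : ℝ => (1 - x) ^ (-β)) (𝓝[<] 1) atTop := by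
      refine (tendsto_rpow_neg_nhdsGT_zero (neg_neg_of_pos hc1)).comp ?_
      refine tendsto_nhdsWithin_iff.2 ⟨?_, ?_⟩
      · have : Tendsto (fun x : ℝ => 1 - x) (𝓝 1) (𝓝 (1 - 1)) := tendsto_const_nhds.sub tendsto_id
        simpa using this.mono_left nhdsWithin_le_nhds
      · filter_upwards [self_mem_nhdsWithin] with x hx
        simpa using hx
    refine h1.congr' ?_
    filter_upwards [hsum] with x hx using (hasSum_binomCoeff β hx.1 hx.2).tsum_eq.symm
  have key := tendsto_powerSeries_ratio (fun k => (binomCoeff_pos hc1 k).le) ho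
    (fun x h0 h1 => (hasSum_binomCoeff β h0 h1).summable)
    (fun x h0 h1 => summable_hyp hc0 a b (by
      rwa [Complex.norm_real, Real.norm_of_nonneg h0.le])) hB
  refine key.congr' ?_
  filter_upwards [hsum] with x hx
  rw [(hasSum_binomCoeff β hx.1 hx.2).tsum_eq, hyp_eq_tsum, Real.rpow_neg (by linarith [hx.2]),
    Complex.ofReal_inv, div_inv_eq_mul]

/-- Logarithmic behaviour of `₂F₁(a, b; 1; x)` at `x = 1` when `a + b = 1`. -/
lemma tendsto_hyp_one_log {a b : ℂ} (hab : a + b = 1)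
    (ha : ∀ m : ℕ, a ≠ -m) (hb : ∀ m : ℕ, b ≠ -m) :
    Tendsto (fun x : ℝ => ordinaryHypergeometric a b ((1 : ℝ) : ℂ) (x : ℂ) /
        ((-Real.log (1 - x) : ℝ) : ℂ)) (𝓝[<] 1)
      (𝓝 (1 / (Complex.Gamma a * Complex.Gamma b))) := by
  set A := 1 / (Complex.Gamma a * Complex.Gamma b) with hA
  -- Division by zero makes this coefficient 0 at k = 0, as the series of -log(1-x) requires.
  set β : ℕ → ℝ := fun k => 1 / k with hβ
  have hw : ∀ n : ℕ, n ≠ 0 → hypCoeff a b ((1 : ℝ) : ℂ) (n + 1) =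
      ((n : ℂ) / (n + 1)) * (1 / (Complex.GammaSeq a n * Complex.GammaSeq b n)) * β (n + 1) := by
    intro n hn
    have hn' : (n : ℂ) ≠ 0 := by exact_mod_cast hn
    have h1 := hypCoeff_mul_GammaSeq ha hb n hn
    have hf' : (n.factorial : ℂ) ≠ 0 := by exact_mod_cast n.factorial_ne_zero
    have hn1 : (n : ℂ) + 1 ≠ 0 := by exact_mod_cast n.succ_ne_zero
    simp only [hypCoeff, ordinaryHypergeometricCoefficient, Complex.ofReal_one,
      ascPochhammer_eval_one, hβ]
    rw [mul_assoc _ (Polynomial.eval a _), h1, hab, Complex.cpow_one, Nat.factorial_succ]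
    push_cast
    field_simp
  have hlim : Tendsto (fun n : ℕ => ((n : ℂ) / (n + 1)) *
      (1 / (Complex.GammaSeq a n * Complex.GammaSeq b n))) atTop (𝓝 A) := by
    have h1 : Tendsto (fun n : ℕ => (n : ℂ) / (n + 1)) atTop (𝓝 1) := by
      simpa using tendsto_natCast_div_add_atTop (1 : ℂ)
    have h2 := h1.mul ((tendsto_const_nhds (x := (1 : ℂ))).div
      ((Complex.GammaSeq_tendsto_Gamma a).mul (Complex.GammaSeq_tendsto_Gamma b))
        (mul_ne_zero (Complex.Gamma_ne_zero ha) (Complex.Gamma_ne_zero hb)))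
    rwa [one_mul, ← hA] at h2
  have ho : (fun k => hypCoeff a b ((1 : ℝ) : ℂ) k - A * β k) =o[atTop] β := by
    have h1 := (Asymptotics.isLittleO_one_iff ℂ).2 (by simpa using hlim.sub_const A)
    have h2 := h1.mul_isBigO (Asymptotics.isBigO_refl (fun n : ℕ => ((β (n + 1) : ℝ) : ℂ)) atTop)
    rw [← Filter.map_add_atTop_eq_nat 1, Asymptotics.isLittleO_map]
    refine (h2.congr' ?_ (EventuallyEq.refl _ _)).trans_isBigO ?_
    · filter_upwards [eventually_ne_atTop 0] with n hn
      simp only [Function.comp]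
      rw [hw n hn]; ring
    · refine Asymptotics.IsBigO.of_bound 1 (Eventually.of_forall fun n => ?_)
      simp [Function.comp]
  have hsum : ∀ᶠ x : ℝ in 𝓝[<] 1, 0 < x ∧ x < 1 := by
    filter_upwards [self_mem_nhdsWithin, mem_nhdsWithin_of_mem_nhds (lt_mem_nhds one_pos)]
      with x hx hx' using ⟨hx', hx⟩
  have hlog : ∀ x : ℝ, 0 < x → x < 1 → HasSum (fun k => β k * x ^ k) (-Real.log (1 - x)) := by
    intro x h0 h1
    rw [← hasSum_nat_add_iff' 1]
    simp only [hβ, Finset.range_one, Finset.sum_singleton, Nat.cast_zero, div_zero, zero_mul,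
      sub_zero]
    convert! Real.hasSum_pow_div_log_of_abs_lt_one (x := x) (by rwa [abs_of_pos h0]) using 1
    funext k
    push_cast
    ring
  have hB : Tendsto (fun x : ℝ => ∑' k, β k * x ^ k) (𝓝[<] 1) atTop := by
    have h1 : Tendsto (fun x : ℝ => -Real.log (1 - x)) (𝓝[<] 1) atTop := by
      refine tendsto_neg_atBot_atTop.comp (Real.tendsto_log_nhdsGT_zero.comp ?_)
      refine tendsto_nhdsWithin_iff.2 ⟨?_, ?_⟩
      · have : Tendsto (fun x : ℝ => 1 - x) (𝓝 1) (𝓝 (1 - 1)) := tendsto_const_nhds.sub tendsto_id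
        simpa using this.mono_left nhdsWithin_le_nhds
      · filter_upwards [self_mem_nhdsWithin] with x hx
        simpa using hx
    refine h1.congr' ?_
    filter_upwards [hsum] with x hx using (hlog x hx.1 hx.2).tsum_eq.symm
  have key := tendsto_powerSeries_ratio (fun k => by simp [hβ]) ho
    (fun x h0 h1 => (hlog x h0 h1).summable)
    (fun x h0 h1 => summable_hyp one_pos a b (by
      rwa [Complex.norm_real, Real.norm_of_nonneg h0.le])) hB
  refine key.congr' ?_
  filter_upwards [hsum] with x hx
  rw [(hlog x hx.1 hx.2).tsum_eq, hyp_eq_tsum]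

/-! ### Uniqueness at the origin and Euler's transformation -/

/-- A holomorphic solution of the hypergeometric equation on the unit disc that vanishes at `0`
vanishes identically. -/
lemma hyp_ode_unique {a b : ℂ} {c : ℝ} (hc : 0 < c) {y y' y'' : ℂ → ℂ}
    (h1 : ∀ z ∈ Metric.ball (0 : ℂ) 1, HasDerivAt y (y' z) z)
    (h2 : ∀ z ∈ Metric.ball (0 : ℂ) 1, HasDerivAt y' (y'' z) z)
    (hode : ∀ z ∈ Metric.ball (0 : ℂ) 1,
      z * (1 - z) * y'' z + (c - (a + b + 1) * z) * y' z - a * b * y z = 0)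
    (h0 : y 0 = 0) : ∀ z ∈ Metric.ball (0 : ℂ) 1, y z = 0 := by
  have hB : Metric.ball (0 : ℂ) 1 ∈ 𝓝 (0 : ℂ) := Metric.ball_mem_nhds _ one_pos
  have hd : DifferentiableOn ℂ y (Metric.ball (0 : ℂ) 1) := fun z hz =>
    (h1 z hz).differentiableAt.differentiableWithinAt
  have han : AnalyticOnNhd ℂ y (Metric.ball (0 : ℂ) 1) := hd.analyticOnNhd Metric.isOpen_ball
  suffices hev : ∀ᶠ z in 𝓝 (0 : ℂ), y z = 0 from
    han.eqOn_zero_of_preconnected_of_eventuallyEq_zero (convex_ball _ _).isPreconnected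
      (Metric.mem_ball_self one_pos) hev
  -- Otherwise y = z^(m+1) g with g(0) ≠ 0, and the lowest-order term of the equation is (m+1)(m+c)
  -- g(0), nonzero as c > 0: the indicial exponents are 0 and 1-c, and 1-c < 1 is never a positive
  -- integer.
  by_contra hne
  obtain ⟨n, g, hg, hg0, hyg⟩ :=
    ((han 0 (Metric.mem_ball_self one_pos)).exists_eventuallyEq_pow_smul_nonzero_iff).2 hne
  simp only [sub_zero, smul_eq_mul] at hyg
  have hn : n ≠ 0 := by
    rintro rfl
    have := hyg.self_of_nhds
    rw [h0, pow_zero, one_mul] at this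
    exact hg0 this.symm
  obtain ⟨m, rfl⟩ : ∃ m, n = m + 1 := Nat.exists_eq_succ_of_ne_zero hn
  have hgd : ∀ᶠ z in 𝓝 (0 : ℂ), HasDerivAt g (deriv g z) z :=
    hg.eventually_analyticAt.mono fun z hz => hz.differentiableAt.hasDerivAt
  have hgd2 : ∀ᶠ z in 𝓝 (0 : ℂ), HasDerivAt (deriv g) (deriv (deriv g) z) z :=
    hg.eventually_analyticAt.mono fun z hz => hz.deriv.differentiableAt.hasDerivAt
  have e1 : ∀ᶠ z in 𝓝 (0 : ℂ), y' z = (m + 1) * z ^ m * g z + z ^ (m + 1) * deriv g z := by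
    filter_upwards [hyg.eventually_nhds, hgd, hB] with z hz hgz hzB
    have h3 := (h1 z hzB).congr_of_eventuallyEq (f₁ := fun z => z ^ (m + 1) * g z)
      (hz.mono fun w hw => hw.symm)
    have h4 := h3.unique ((hasDerivAt_pow (m + 1) z).mul hgz)
    simpa using h4
  have e2 : ∀ᶠ z in 𝓝 (0 : ℂ), z * y'' z = (m + 1) * m * z ^ m * g z +
      2 * (m + 1) * z ^ (m + 1) * deriv g z + z ^ (m + 2) * deriv (deriv g) z := by
    filter_upwards [e1.eventually_nhds, hgd, hgd2, hB] with z hz hgz hgz2 hzB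
    have h3 := (h2 z hzB).congr_of_eventuallyEq
      (f₁ := fun z => (m + 1) * z ^ m * g z + z ^ (m + 1) * deriv g z) (hz.mono fun w hw => hw.symm)
    have h4 := h3.unique ((((hasDerivAt_pow m z).const_mul ((m : ℂ) + 1)).mul hgz).add
      ((hasDerivAt_pow (m + 1) z).mul hgz2))
    rw [h4]
    rcases m with _ | k
    · simp; ring
    · simp; ring
  -- The equation divided by z^m holds only off 0; its value at 0 is recovered by continuity.
  have e3 : ∀ᶠ z in 𝓝[≠] (0 : ℂ), (1 - z) * ((m + 1) * m * g z +
      2 * (m + 1) * z * deriv g z + z ^ 2 * deriv (deriv g) z) +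
      (c - (a + b + 1) * z) * ((m + 1) * g z + z * deriv g z) - a * b * (z * g z) = 0 := by
    filter_upwards [nhdsWithin_le_nhds e1, nhdsWithin_le_nhds e2, nhdsWithin_le_nhds hyg,
      nhdsWithin_le_nhds hB, self_mem_nhdsWithin] with z h3 h4 h5 h6 h7
    have hz0 : z ^ m ≠ 0 := pow_ne_zero _ h7
    have := hode z h6
    rw [h3, h5] at this
    refine (mul_eq_zero.1 (?_ : z ^ m * _ = 0)).resolve_left hz0
    linear_combination this - (1 - z) * h4
  have hcont : Tendsto (fun z : ℂ => (1 - z) * ((m + 1) * m * g z +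
      2 * (m + 1) * z * deriv g z + z ^ 2 * deriv (deriv g) z) +
      (c - (a + b + 1) * z) * ((m + 1) * g z + z * deriv g z) - a * b * (z * g z)) (𝓝[≠] 0)
      (𝓝 ((1 - 0) * ((m + 1) * m * g 0 +
      2 * (m + 1) * 0 * deriv g 0 + 0 ^ 2 * deriv (deriv g) 0) +
      (c - (a + b + 1) * 0) * ((m + 1) * g 0 + 0 * deriv g 0) - a * b * (0 * g 0))) := by
    have c1 := hg.continuousAt
    have c2 := hg.deriv.continuousAt
    have c3 := hg.deriv.deriv.continuousAt
    have : ContinuousAt (fun z : ℂ => (1 - z) * ((m + 1) * m * g z +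
      2 * (m + 1) * z * deriv g z + z ^ 2 * deriv (deriv g) z) +
      (c - (a + b + 1) * z) * ((m + 1) * g z + z * deriv g z) - a * b * (z * g z)) 0 := by
      fun_prop
    exact this.tendsto.mono_left nhdsWithin_le_nhds
  have h8 := tendsto_nhds_unique_of_eventuallyEq hcont tendsto_const_nhds e3
  have h9 : ((m : ℂ) + 1) * (m + c) * g 0 = 0 := by linear_combination h8
  have h10 := ofReal_add_nat_ne_zero hc m
  have h11 : (m : ℂ) + 1 ≠ 0 := by exact_mod_cast m.succ_ne_zero
  rcases mul_eq_zero.1 h9 with h | h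
  · rcases mul_eq_zero.1 h with h | h
    · exact h11 h
    · exact h10 (by rw [add_comm]; exact h)
  · exact hg0 h

lemma one_sub_mem_slitPlane {z : ℂ} (hz : ‖z‖ < 1) : 1 - z ∈ Complex.slitPlane := by
  refine Complex.mem_slitPlane_of_norm_lt_one (z := -z) (by simpa using hz) |> fun h => ?_
  simpa [sub_eq_add_neg] using h

/-- Euler's transformation of the hypergeometric function. -/
lemma hyp_euler {c : ℝ} (hc : 0 < c) (a b : ℂ) {z : ℂ} (hz : ‖z‖ < 1) :
    ordinaryHypergeometric a b (c : ℂ) z =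
      (1 - z) ^ ((c : ℂ) - a - b) * ordinaryHypergeometric (c - a) (c - b) (c : ℂ) z := by
  set e : ℂ := (c : ℂ) - a - b with he
  set d : ℂ → ℂ → ℂ → ℂ := fun p q z => p * q / c *
    ordinaryHypergeometric (p + 1) (q + 1) ((c + 1 : ℝ) : ℂ) z with hd
  set d2 : ℂ → ℂ → ℂ → ℂ := fun p q z => p * q / c * ((p + 1) * (q + 1) / (c + 1) *
        ordinaryHypergeometric (p + 2) (q + 2) ((c + 2 : ℝ) : ℂ) z) with hd2
  have D1 : ∀ p q w : ℂ, ‖w‖ < 1 → HasDerivAt (ordinaryHypergeometric p q (c : ℂ)) (d p q w) w :=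
    fun p q w hw => hasDerivAt_hyp hc p q hw
  have D2 : ∀ p q w : ℂ, ‖w‖ < 1 → HasDerivAt (d p q) (d2 p q w) w := by
    intro p q w hw
    have := (hasDerivAt_hyp (add_pos hc one_pos) (p + 1) (q + 1) hw).const_mul (p * q / c)
    convert! this using 1
    simp only [hd2]
    rw [show p + 1 + 1 = p + 2 by ring, show q + 1 + 1 = q + 2 by ring,
      show c + 1 + 1 = c + 2 by ring]
    push_cast
    rfl
  have P1 : ∀ w : ℂ, ‖w‖ < 1 → HasDerivAt (fun z : ℂ => (1 - z) ^ e)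
      (-(e * (1 - w) ^ e / (1 - w))) w := by
    intro w hw
    have hs := one_sub_mem_slitPlane hw
    have := ((hasDerivAt_id w).const_sub 1).cpow_const (c := e) hs
    convert! this using 1
    have h0 := Complex.slitPlane_ne_zero hs
    simp only [id]
    rw [Complex.cpow_sub e 1 h0, Complex.cpow_one]
    ring
  set f : ℂ → ℂ := ordinaryHypergeometric ((c : ℂ) - a) (c - b) (c : ℂ) with hf
  set f' := d (c - a) (c - b) with hf'
  set f'' := d2 (c - a) (c - b) with hf''
  -- Both sides solve the same equation and equal 1 at 0, so their difference vanishes. Conjugating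
  -- the equation with parameters c-a, c-b by the power of 1-z produces the one with parameters a,
  -- b.
  have key := hyp_ode_unique (a := a) (b := b) hc
    (y := fun z => ordinaryHypergeometric a b (c : ℂ) z - (1 - z) ^ e * f z)
    (y' := fun z => d a b z - (-(e * (1 - z) ^ e / (1 - z)) * f z + (1 - z) ^ e * f' z))
    (y'' := fun z => d2 a b z - (1 - z) ^ e * (f'' z - 2 * e * f' z / (1 - z) +
      (e ^ 2 - e) * f z / (1 - z) ^ 2)) ?_ ?_ ?_ ?_ z (by simpa using hz)
  · exact sub_eq_zero.1 key
  · intro w hw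
    replace hw : ‖w‖ < 1 := by simpa using hw
    exact (D1 a b w hw).sub ((P1 w hw).mul (D1 _ _ w hw))
  · intro w hw
    replace hw : ‖w‖ < 1 := by simpa using hw
    have h0 := Complex.slitPlane_ne_zero (one_sub_mem_slitPlane hw)
    have q1 := (((P1 w hw).const_mul e).div ((hasDerivAt_id w).const_sub 1) h0).neg
    have q2 := (q1.mul (D1 (c - a) (c - b) w hw)).add ((P1 w hw).mul (D2 (c - a) (c - b) w hw))
    refine ((D2 a b w hw).sub q2).congr_deriv ?_
    simp only [id, hf, hf', hf'', Pi.neg_apply, Pi.div_apply]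
    field_simp
    ring
  · intro w hw
    replace hw : ‖w‖ < 1 := by simpa using hw
    have h0 := Complex.slitPlane_ne_zero (one_sub_mem_slitPlane hw)
    have o1 := hyp_ode hc a b hw
    have o2 := hyp_ode hc ((c : ℂ) - a) (c - b) hw
    change w * (1 - w) * d2 a b w + (c - (a + b + 1) * w) * d a b w -
      a * b * ordinaryHypergeometric a b (c : ℂ) w = 0 at o1
    change w * (1 - w) * f'' w + (c - (c - a + (c - b) + 1) * w) * f' w -
      (c - a) * (c - b) * f w = 0 at o2
    have hE : e = (c : ℂ) - a - b := he
    clear_value e f f' f'' d d2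
    rw [show ∀ A B C D E F G : ℂ, w * (1 - w) * (A - B) + C * (D - E) - a * b * (F - G) =
      (w * (1 - w) * A + C * D - a * b * F) - (w * (1 - w) * B + C * E - a * b * G) from
      fun A B C D E F G => by ring, o1, zero_sub, neg_eq_zero]
    generalize (1 - w) ^ e = P
    have : w * (1 - w) * (P * (f'' w - 2 * e * f' w / (1 - w) + (e ^ 2 - e) * f w / (1 - w) ^ 2)) +
        (↑c - (a + b + 1) * w) * (-(e * P / (1 - w)) * f w + P * f' w) - a * b * (P * f w) =
        P * (w * (1 - w) * f'' w + (c - (c - a + (c - b) + 1) * w) * f' w -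
        (c - a) * (c - b) * f w) := by
      subst hE
      field_simp
      ring
    rw [this, o2, mul_zero]
  · simp [hf]

/-! ### Pointwise calculus of gradients and Laplacians -/

/-- `f` is `C²` at `x`, with partial derivatives `g` and Laplacian `L` there. -/
structure HasLaplacianData {N : ℕ} {A : Type*} [NormedAddCommGroup A] [NormedSpace ℝ A]
    (f : EuclideanSpace ℝ (Fin N) → A) (x : EuclideanSpace ℝ (Fin N)) (g : Fin N → A) (L : A) :
    Prop where
  contDiffAt : ContDiffAt ℝ 2 f x
  partial_eq : ∀ i, fderiv ℝ f x (EuclideanSpace.single i 1) = g i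
  laplacian_eq : Laplacian.laplacian f x = L

section

variable {N : ℕ} {A : Type*} [NormedAddCommGroup A] [NormedSpace ℝ A]

lemma laplacian_eq_sum_partial {f : EuclideanSpace ℝ (Fin N) → A} {x : EuclideanSpace ℝ (Fin N)}
    (hf : ContDiffAt ℝ 2 f x) :
    Laplacian.laplacian f x = ∑ i, fderiv ℝ (fun y => fderiv ℝ f y (EuclideanSpace.single i 1)) x
      (EuclideanSpace.single i 1) := by
  have h := InnerProductSpace.laplacian_eq_iteratedFDeriv_orthonormalBasis f
    (EuclideanSpace.basisFun (Fin N) ℝ)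
  rw [h]
  refine Finset.sum_congr rfl fun i _ => ?_
  have hd : DifferentiableAt ℝ (fderiv ℝ f) x :=
    (hf.fderiv_right (m := 1) (by norm_num)).differentiableAt (by norm_num)
  rw [iteratedFDeriv_two_apply, fderiv_clm_apply hd (differentiableAt_const _)]
  simp

lemma HasLaplacianData.differentiableAt {f : EuclideanSpace ℝ (Fin N) → A}
    {x : EuclideanSpace ℝ (Fin N)} {g : Fin N → A} {L : A} (h : HasLaplacianData f x g L) :
    DifferentiableAt ℝ f x := h.contDiffAt.differentiableAt (by norm_num)

lemma hasLaplacianData_const (a : A) (x : EuclideanSpace ℝ (Fin N)) :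
    HasLaplacianData (fun _ => a) x (fun _ => 0) 0 :=
  ⟨contDiffAt_const, fun i => by simp, by
    rw [laplacian_eq_sum_partial contDiffAt_const]; simp⟩

lemma HasLaplacianData.congr {f : EuclideanSpace ℝ (Fin N) → A}
    {x : EuclideanSpace ℝ (Fin N)} {g g' : Fin N → A} {L L' : A} (h : HasLaplacianData f x g L)
    (hg : ∀ i, g i = g' i) (hL : L = L') : HasLaplacianData f x g' L' :=
  ⟨h.1, fun i => (h.2 i).trans (hg i), h.3.trans hL⟩

lemma HasLaplacianData.congr_of_eventuallyEq {f f' : EuclideanSpace ℝ (Fin N) → A}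
    {x : EuclideanSpace ℝ (Fin N)} {g : Fin N → A} {L : A} (h : HasLaplacianData f x g L)
    (hf : f' =ᶠ[𝓝 x] f) : HasLaplacianData f' x g L :=
  ⟨h.1.congr_of_eventuallyEq hf, fun i => by rw [hf.fderiv_eq]; exact h.2 i, by
    rw [(InnerProductSpace.laplacian_congr_nhds hf).self_of_nhds]; exact h.3⟩

lemma HasLaplacianData.add {f f' : EuclideanSpace ℝ (Fin N) → A}
    {x : EuclideanSpace ℝ (Fin N)} {g g' : Fin N → A} {L L' : A} (h : HasLaplacianData f x g L)
    (h' : HasLaplacianData f' x g' L') :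
    HasLaplacianData (fun y => f y + f' y) x (fun i => g i + g' i) (L + L') := by
  refine ⟨h.1.add h'.1, fun i => ?_, ?_⟩
  · rw [fderiv_fun_add h.differentiableAt h'.differentiableAt, add_apply,
      h.2, h'.2]
  · rw [← h.3, ← h'.3]
    exact h.1.laplacian_add h'.1

/-- The chain rule for the Laplacian. -/
lemma HasLaplacianData.comp_real {t : EuclideanSpace ℝ (Fin N) → ℝ}
    {x : EuclideanSpace ℝ (Fin N)} {g : Fin N → ℝ} {L : ℝ} (h : HasLaplacianData t x g L)
    {φ : ℝ → A} (hφ : ContDiffAt ℝ 2 φ (t x)) :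
    HasLaplacianData (fun y => φ (t y)) x (fun i => g i • deriv φ (t x))
      ((∑ i, g i ^ 2) • deriv (deriv φ) (t x) + L • deriv φ (t x)) := by
  have hcd : ContDiffAt ℝ 2 (fun y => φ (t y)) x := hφ.comp x h.1
  have hpd : ∀ (y : EuclideanSpace ℝ (Fin N)) (v : EuclideanSpace ℝ (Fin N)),
      DifferentiableAt ℝ φ (t y) → DifferentiableAt ℝ t y →
      fderiv ℝ (fun y => φ (t y)) y v = fderiv ℝ t y v • deriv φ (t y) := by
    intro y v h1 h2
    have := h1.hasDerivAt.hasFDerivAt.comp y h2.hasFDerivAt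
    rw [HasFDerivAt.fderiv (f := fun y => φ (t y)) this]
    simp
  have hev : ∀ᶠ y in 𝓝 x, DifferentiableAt ℝ φ (t y) ∧ DifferentiableAt ℝ t y := by
    have h1 : ∀ᶠ y in 𝓝 x, ContDiffAt ℝ 2 t y := h.1.eventually (by simp)
    have h2 : ∀ᶠ s in 𝓝 (t x), ContDiffAt ℝ 2 φ s := hφ.eventually (by simp)
    filter_upwards [h1, h.1.continuousAt.eventually h2] with y h3 h4
    exact ⟨h4.differentiableAt (by norm_num), h3.differentiableAt (by norm_num)⟩
  refine ⟨hcd, fun i => ?_, ?_⟩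
  · rw [hpd x _ hev.self_of_nhds.1 hev.self_of_nhds.2, h.2]
  · rw [laplacian_eq_sum_partial hcd, ← h.3, laplacian_eq_sum_partial h.1, Finset.sum_smul,
      Finset.sum_smul, ← Finset.sum_add_distrib]
    refine Finset.sum_congr rfl fun i _ => ?_
    have h3 : (fun y => fderiv ℝ (fun y => φ (t y)) y (EuclideanSpace.single i 1)) =ᶠ[𝓝 x]
        fun y => fderiv ℝ t y (EuclideanSpace.single i 1) • deriv φ (t y) :=
      hev.mono fun y hy => hpd y _ hy.1 hy.2
    have hd1 : DifferentiableAt ℝ (fun y => fderiv ℝ t y (EuclideanSpace.single i 1)) x :=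
      ((h.1.fderiv_right (m := 1) (by norm_num)).differentiableAt (by norm_num)).clm_apply
        (differentiableAt_const _)
    have hφ' : DifferentiableAt ℝ (deriv φ) (t x) := by
      have h5 : DifferentiableAt ℝ (fun s => fderiv ℝ φ s 1) (t x) :=
        ((hφ.fderiv_right (m := 1) (by norm_num)).differentiableAt (by norm_num)).clm_apply
          (differentiableAt_const _)
      simpa only [fderiv_apply_one_eq_deriv] using h5
    have h4 : HasFDerivAt (fun y => deriv φ (t y))
        ((ContinuousLinearMap.toSpanSingleton ℝ (deriv (deriv φ) (t x))).comp (fderiv ℝ t x)) x :=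
      hφ'.hasDerivAt.hasFDerivAt.comp x h.differentiableAt.hasFDerivAt
    rw [h3.fderiv_eq, (hd1.hasFDerivAt.fun_smul h4).fderiv]
    simp [h.2, sq, mul_smul]

end

/-- The product rule for the Laplacian. -/
lemma HasLaplacianData.mul {N : ℕ} {A : Type*} [NormedCommRing A] [NormedAlgebra ℝ A]
    {f f' : EuclideanSpace ℝ (Fin N) → A} {x : EuclideanSpace ℝ (Fin N)} {g g' : Fin N → A}
    {L L' : A} (h : HasLaplacianData f x g L) (h' : HasLaplacianData f' x g' L') :
    HasLaplacianData (fun y => f y * f' y) x (fun i => f x * g' i + f' x * g i)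
      (f x * L' + f' x * L + 2 * ∑ i, g i * g' i) := by
  have hcd : ContDiffAt ℝ 2 (fun y => f y * f' y) x := h.1.mul h'.1
  have hpd : ∀ (y v : EuclideanSpace ℝ (Fin N)), DifferentiableAt ℝ f y →
      DifferentiableAt ℝ f' y → fderiv ℝ (fun y => f y * f' y) y v =
        f y * fderiv ℝ f' y v + f' y * fderiv ℝ f y v := by
    intro y v h1 h2
    rw [fderiv_fun_mul h1 h2]
    simp
  have hev : ∀ᶠ y in 𝓝 x, DifferentiableAt ℝ f y ∧ DifferentiableAt ℝ f' y := by
    have h1 : ∀ᶠ y in 𝓝 x, ContDiffAt ℝ 2 f y := h.1.eventually (by simp)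
    have h2 : ∀ᶠ y in 𝓝 x, ContDiffAt ℝ 2 f' y := h'.1.eventually (by simp)
    filter_upwards [h1, h2] with y h3 h4
    exact ⟨h3.differentiableAt (by norm_num), h4.differentiableAt (by norm_num)⟩
  refine ⟨hcd, fun i => ?_, ?_⟩
  · rw [hpd x _ hev.self_of_nhds.1 hev.self_of_nhds.2, h.2, h'.2]
  · rw [laplacian_eq_sum_partial hcd, ← h.3, laplacian_eq_sum_partial h.1, ← h'.3,
      laplacian_eq_sum_partial h'.1, Finset.mul_sum, Finset.mul_sum, Finset.mul_sum,
      ← Finset.sum_add_distrib, ← Finset.sum_add_distrib]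
    refine Finset.sum_congr rfl fun i _ => ?_
    have h3 : (fun y => fderiv ℝ (fun y => f y * f' y) y (EuclideanSpace.single i 1)) =ᶠ[𝓝 x]
        fun y => f y * fderiv ℝ f' y (EuclideanSpace.single i 1) +
          f' y * fderiv ℝ f y (EuclideanSpace.single i 1) :=
      hev.mono fun y hy => hpd y _ hy.1 hy.2
    have hd1 : DifferentiableAt ℝ (fun y => fderiv ℝ f y (EuclideanSpace.single i 1)) x :=
      ((h.1.fderiv_right (m := 1) (by norm_num)).differentiableAt (by norm_num)).clm_apply
        (differentiableAt_const _)
    have hd2 : DifferentiableAt ℝ (fun y => fderiv ℝ f' y (EuclideanSpace.single i 1)) x :=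
      ((h'.1.fderiv_right (m := 1) (by norm_num)).differentiableAt (by norm_num)).clm_apply
        (differentiableAt_const _)
    rw [h3.fderiv_eq, fderiv_fun_add (h.differentiableAt.fun_mul hd2) (h'.differentiableAt.fun_mul hd1),
      fderiv_fun_mul h.differentiableAt hd2, fderiv_fun_mul h'.differentiableAt hd1]
    simp only [add_apply, smul_apply, smul_eq_mul, h.2, h'.2]
    ring

lemma HasLaplacianData.const_mul {N : ℕ} {A : Type*} [NormedCommRing A] [NormedAlgebra ℝ A]
    {f : EuclideanSpace ℝ (Fin N) → A} {x : EuclideanSpace ℝ (Fin N)} {g : Fin N → A}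
    {L : A} (h : HasLaplacianData f x g L) (a : A) :
    HasLaplacianData (fun y => a * f y) x (fun i => a * g i) (a * L) := by
  refine ((hasLaplacianData_const a x).mul h).congr (fun i => ?_) ?_ <;> simp

lemma norm_sq_eq_sum {N : ℕ} (x : EuclideanSpace ℝ (Fin N)) : ‖x‖ ^ 2 = ∑ i, x i ^ 2 :=
  EuclideanSpace.real_norm_sq_eq x

lemma hasLaplacianData_norm_sub_sq {N : ℕ} (p x : EuclideanSpace ℝ (Fin N)) :
    HasLaplacianData (fun y => ‖y - p‖ ^ 2) x (fun i => 2 * (x i - p i)) (2 * N) := by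
  have hcd : ∀ y : EuclideanSpace ℝ (Fin N),
      ContDiffAt ℝ 2 (fun y => ‖y - p‖ ^ 2) y := fun y =>
    ((contDiff_id.sub contDiff_const).norm_sq ℝ).contDiffAt
  have hpd : ∀ (y : EuclideanSpace ℝ (Fin N)) (i : Fin N), fderiv ℝ (fun y => ‖y - p‖ ^ 2) y
      (EuclideanSpace.single i 1) = 2 * (y i - p i) := by
    intro y i
    have h1 : HasFDerivAt (fun y => ‖y - p‖ ^ 2) _ y :=
      ((hasFDerivAt_id y).sub_const p).norm_sq
    rw [h1.fderiv]
    simp [EuclideanSpace.inner_single_right]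
  refine ⟨hcd x, hpd x, ?_⟩
  rw [laplacian_eq_sum_partial (hcd x)]
  have h2 : ∀ i : Fin N, fderiv ℝ (fun y : EuclideanSpace ℝ (Fin N) => 2 * (y i - p i)) x
      (EuclideanSpace.single i 1) = 2 := by
    intro i
    have h3 : HasFDerivAt (fun y : EuclideanSpace ℝ (Fin N) => 2 * (y i - p i))
        ((2 : ℝ) • EuclideanSpace.proj i) x :=
      (((EuclideanSpace.proj (𝕜 := ℝ) i).hasFDerivAt (x := x)).sub_const (p i)).const_mul 2
    rw [h3.fderiv]
    simp
  simp only [hpd, h2]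
  simp [mul_comm]

/-! ### Spherical geometry in the flat chart and the reduction to zonal form -/

/-- The conformal denominator `r² + ρ²`. -/
def fishDen {N : ℕ} (ρ : ℝ) (x : EuclideanSpace ℝ (Fin N)) : ℝ := ‖x‖ ^ 2 + ρ ^ 2

lemma fishDen_pos {N : ℕ} {ρ : ℝ} (hρ : 0 < ρ) (x : EuclideanSpace ℝ (Fin N)) :
    0 < fishDen ρ x := by
  unfold fishDen; positivity

/-- Squared sine of half the spherical distance between `x` and `p`. -/
def fishSin {N : ℕ} (ρ : ℝ) (p x : EuclideanSpace ℝ (Fin N)) : ℝ :=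
  ρ ^ 2 * ‖x - p‖ ^ 2 / (fishDen ρ x * fishDen ρ p)

/-- Squared sine of half the spherical distance between `x` and the point at infinity. -/
def fishSinInfty {N : ℕ} (ρ : ℝ) (x : EuclideanSpace ℝ (Fin N)) : ℝ := ρ ^ 2 / fishDen ρ x

/-- `t` behaves at `x` like the squared sine of half the spherical distance to a fixed point:
its gradient `g` and Laplacian `L` satisfy the equations of that function. -/
structure IsZonalAt {N : ℕ} (ρ : ℝ) (t : EuclideanSpace ℝ (Fin N) → ℝ)
    (x : EuclideanSpace ℝ (Fin N)) (g : Fin N → ℝ) (L : ℝ) : Prop where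
  data : HasLaplacianData t x g L
  grad_sq : ∑ i, g i ^ 2 = 4 * ρ ^ 2 / fishDen ρ x ^ 2 * (t x * (1 - t x))
  -- The first-order term on the left is the one that conjugation by `fishFactor` adds to the flat
  -- Laplacian.
  laplacian : L - 2 * (N - 2) / fishDen ρ x * ∑ i, x i * g i =
    4 * ρ ^ 2 / fishDen ρ x ^ 2 * (N / 2 * (1 - 2 * t x))

lemma hasLaplacianData_fishDen {N : ℕ} (ρ : ℝ) (x : EuclideanSpace ℝ (Fin N)) :
    HasLaplacianData (fishDen ρ) x (fun i => 2 * x i) (2 * N) := by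
  have h := (hasLaplacianData_norm_sub_sq 0 x).add (hasLaplacianData_const (ρ ^ 2) x)
  simp only [sub_zero] at h
  refine (h.congr (fun i => ?_) ?_).congr_of_eventuallyEq (Eventually.of_forall fun y => rfl)
  · simp
  · simp

lemma hasLaplacianData_inv_fishDen {N : ℕ} {ρ : ℝ} (hρ : 0 < ρ) (x : EuclideanSpace ℝ (Fin N)) :
    HasLaplacianData (fun y => (fishDen ρ y)⁻¹) x (fun i => -(2 * x i) / fishDen ρ x ^ 2)
      (8 * ‖x‖ ^ 2 / fishDen ρ x ^ 3 - 2 * N / fishDen ρ x ^ 2) := by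
  have hA := fishDen_pos hρ x
  have h1 : ContDiffAt ℝ 2 (fun s : ℝ => s⁻¹) (fishDen ρ x) := contDiffAt_inv _ hA.ne'
  have hd1 : deriv (fun s : ℝ => s⁻¹) = fun s : ℝ => -(s ^ 2)⁻¹ := by
    funext s; rw [deriv_inv]
  have hd2 : deriv (fun s : ℝ => -(s ^ 2)⁻¹) (fishDen ρ x) = 2 / fishDen ρ x ^ 3 := by
    have := ((hasDerivAt_pow 2 (fishDen ρ x)).inv (pow_ne_zero 2 hA.ne')).neg
    rw [HasDerivAt.deriv (f := fun s : ℝ => -(s ^ 2)⁻¹) this]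
    field_simp
    ring
  refine ((hasLaplacianData_fishDen ρ x).comp_real h1).congr (fun i => ?_) ?_
  · rw [hd1]; simp only [smul_eq_mul]; field_simp
  · rw [hd1, hd2, norm_sq_eq_sum, smul_eq_mul, smul_eq_mul]
    simp only [mul_pow, ← Finset.mul_sum]
    field_simp
    ring

lemma sum_coord_mul {N : ℕ} (p x : EuclideanSpace ℝ (Fin N)) :
    ‖x - p‖ ^ 2 = (∑ i, x i ^ 2) - 2 * (∑ i, x i * p i) + ∑ i, p i ^ 2 := by
  rw [norm_sq_eq_sum, Finset.mul_sum, ← Finset.sum_sub_distrib, ← Finset.sum_add_distrib]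
  exact Finset.sum_congr rfl fun i _ => by simp; ring

/-- No rotation of the sphere is invoked: all quantities are rational in |x|², |p|² and x·p, and
after expanding the sums the two equations are identities of rational functions in these three
variables. -/
lemma exists_isZonalAt_fishSin {N : ℕ} {ρ : ℝ} (hρ : 0 < ρ) (p x : EuclideanSpace ℝ (Fin N)) :
    ∃ g L, IsZonalAt ρ (fishSin ρ p) x g L := by
  have hA := fishDen_pos hρ x
  have hP := fishDen_pos hρ p
  have h := ((hasLaplacianData_norm_sub_sq p x).mul (hasLaplacianData_inv_fishDen hρ x)).const_mul
    (ρ ^ 2 / fishDen ρ p)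
  have hs : fishSin ρ p = fun y => ρ ^ 2 / fishDen ρ p * (‖y - p‖ ^ 2 * (fishDen ρ y)⁻¹) := by
    funext y
    have := fishDen_pos hρ y
    unfold fishSin
    field_simp
  refine ⟨_, _, hs ▸ h, ?_, ?_⟩
  · have e1 : ∑ i, (ρ ^ 2 / fishDen ρ p * (‖x - p‖ ^ 2 * (-(2 * x i) / fishDen ρ x ^ 2) +
        (fishDen ρ x)⁻¹ * (2 * (x i - p i)))) ^ 2 = (ρ ^ 2 / fishDen ρ p) ^ 2 *
        (4 * (‖x - p‖ ^ 2) ^ 2 / fishDen ρ x ^ 4 * (∑ i, x i ^ 2) -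
          8 * ‖x - p‖ ^ 2 / fishDen ρ x ^ 3 * ((∑ i, x i ^ 2) - ∑ i, x i * p i) +
          4 / fishDen ρ x ^ 2 * ((∑ i, x i ^ 2) - 2 * (∑ i, x i * p i) + ∑ i, p i ^ 2)) := by
      simp only [Finset.mul_sum, ← Finset.sum_sub_distrib, ← Finset.sum_add_distrib]
      refine Finset.sum_congr rfl fun i _ => ?_
      field_simp
      ring
    rw [e1]
    unfold fishSin
    rw [sum_coord_mul]
    have hA' : fishDen ρ x = (∑ i, x i ^ 2) + ρ ^ 2 := by rw [← norm_sq_eq_sum]; rfl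
    have hP' : fishDen ρ p = (∑ i, p i ^ 2) + ρ ^ 2 := by rw [← norm_sq_eq_sum]; rfl
    rw [hA'] at hA ⊢
    rw [hP'] at hP ⊢
    generalize (∑ i, x i ^ 2) = X at *
    generalize (∑ i, p i ^ 2) = P at *
    generalize (∑ i, x i * p i) = Y at *
    field_simp
    ring
  · have e1 : ∑ i, (2 * (x i - p i)) * (-(2 * x i) / fishDen ρ x ^ 2) =
        -4 / fishDen ρ x ^ 2 * ((∑ i, x i ^ 2) - ∑ i, x i * p i) := by
      rw [← Finset.sum_sub_distrib, Finset.mul_sum]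
      exact Finset.sum_congr rfl fun i _ => by ring
    have e2 : ∑ i, x i * (ρ ^ 2 / fishDen ρ p * (‖x - p‖ ^ 2 * (-(2 * x i) / fishDen ρ x ^ 2) +
        (fishDen ρ x)⁻¹ * (2 * (x i - p i)))) = ρ ^ 2 / fishDen ρ p *
        (-(2 * ‖x - p‖ ^ 2) / fishDen ρ x ^ 2 * (∑ i, x i ^ 2) +
          2 / fishDen ρ x * ((∑ i, x i ^ 2) - ∑ i, x i * p i)) := by
      rw [← Finset.sum_sub_distrib, Finset.mul_sum, Finset.mul_sum, ← Finset.sum_add_distrib,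
        Finset.mul_sum]
      exact Finset.sum_congr rfl fun i _ => by ring
    rw [e1, e2]
    unfold fishSin
    rw [sum_coord_mul, norm_sq_eq_sum x]
    have hA' : fishDen ρ x = (∑ i, x i ^ 2) + ρ ^ 2 := by rw [← norm_sq_eq_sum]; rfl
    have hP' : fishDen ρ p = (∑ i, p i ^ 2) + ρ ^ 2 := by rw [← norm_sq_eq_sum]; rfl
    rw [hA'] at hA ⊢
    rw [hP'] at hP ⊢
    generalize (∑ i, x i ^ 2) = X at *
    generalize (∑ i, p i ^ 2) = P at *
    generalize (∑ i, x i * p i) = Y at *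
    field_simp
    ring

lemma exists_isZonalAt_fishSinInfty {N : ℕ} {ρ : ℝ} (hρ : 0 < ρ) (x : EuclideanSpace ℝ (Fin N)) :
    ∃ g L, IsZonalAt ρ (fishSinInfty ρ) x g L := by
  have hA := fishDen_pos hρ x
  have h := (hasLaplacianData_inv_fishDen hρ x).const_mul (ρ ^ 2)
  have hs : (fishSinInfty ρ : EuclideanSpace ℝ (Fin N) → ℝ) =
      fun y => ρ ^ 2 * (fishDen ρ y)⁻¹ := by
    funext y
    rw [fishSinInfty, div_eq_mul_inv]
  refine ⟨_, _, hs ▸ h, ?_, ?_⟩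
  · have e1 : ∑ i, (ρ ^ 2 * (-(2 * x i) / fishDen ρ x ^ 2)) ^ 2 =
        4 * ρ ^ 4 / fishDen ρ x ^ 4 * ‖x‖ ^ 2 := by
      rw [norm_sq_eq_sum, Finset.mul_sum]
      exact Finset.sum_congr rfl fun i _ => by field_simp; ring
    rw [e1, show ‖x‖ ^ 2 = fishDen ρ x - ρ ^ 2 by unfold fishDen; ring]
    unfold fishSinInfty
    field_simp
  · have e1 : ∑ i, x i * (ρ ^ 2 * (-(2 * x i) / fishDen ρ x ^ 2)) =
        -2 * ρ ^ 2 / fishDen ρ x ^ 2 * ‖x‖ ^ 2 := by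
      rw [norm_sq_eq_sum, Finset.mul_sum]
      exact Finset.sum_congr rfl fun i _ => by ring
    rw [e1, show ‖x‖ ^ 2 = fishDen ρ x - ρ ^ 2 by unfold fishDen; ring]
    unfold fishSinInfty
    field_simp
    ring

/-- The conformal factor `(r² + ρ²) ^ (1 - N / 2)`. -/
def fishFactor {N : ℕ} (ρ : ℝ) (x : EuclideanSpace ℝ (Fin N)) : ℝ :=
  fishDen ρ x ^ (1 - (N : ℝ) / 2)

lemma fishFactor_pos {N : ℕ} {ρ : ℝ} (hρ : 0 < ρ) (x : EuclideanSpace ℝ (Fin N)) :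
    0 < fishFactor ρ x := Real.rpow_pos_of_pos (fishDen_pos hρ x) _

lemma hasLaplacianData_fishFactor {N : ℕ} {ρ : ℝ} (hρ : 0 < ρ) (x : EuclideanSpace ℝ (Fin N)) :
    HasLaplacianData (fun y => (fishFactor ρ y : ℂ)) x
      (fun i => (((2 - N) * x i / fishDen ρ x * fishFactor ρ x : ℝ) : ℂ))
      ((-(N * (N - 2)) * ρ ^ 2 / fishDen ρ x ^ 2 * fishFactor ρ x : ℝ) : ℂ) := by
  have hA := fishDen_pos hρ x
  set e : ℝ := 1 - (N : ℝ) / 2 with he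
  have hd1 : ∀ s : ℝ, 0 < s → HasDerivAt (fun s : ℝ => ((s ^ e : ℝ) : ℂ))
      ((e * s ^ (e - 1) : ℝ) : ℂ) s := fun s hs =>
    (Real.hasDerivAt_rpow_const (Or.inl hs.ne')).ofReal_comp
  have hd1' : ∀ᶠ s in 𝓝 (fishDen ρ x), deriv (fun s : ℝ => ((s ^ e : ℝ) : ℂ)) s =
      ((e * s ^ (e - 1) : ℝ) : ℂ) := (lt_mem_nhds hA).mono fun s hs => (hd1 s hs).deriv
  have hd2 : deriv (deriv (fun s : ℝ => ((s ^ e : ℝ) : ℂ))) (fishDen ρ x) =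
      ((e * ((e - 1) * fishDen ρ x ^ (e - 1 - 1)) : ℝ) : ℂ) := by
    rw [EventuallyEq.deriv_eq hd1']
    exact (((Real.hasDerivAt_rpow_const (p := e - 1) (Or.inl hA.ne')).const_mul e).ofReal_comp).deriv
  have hcd : ContDiffAt ℝ 2 (fun s : ℝ => ((s ^ e : ℝ) : ℂ)) (fishDen ρ x) :=
    Complex.ofRealCLM.contDiff.contDiffAt.comp _ (Real.contDiffAt_rpow_const_of_ne hA.ne')
  refine ((hasLaplacianData_fishDen ρ x).comp_real hcd).congr (fun i => ?_) ?_
  · rw [hd1'.self_of_nhds, fishFactor, ← he, Real.rpow_sub_one hA.ne', Complex.real_smul]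
    rw [← Complex.ofReal_mul]
    congr 1
    rw [he]
    field_simp
  · rw [hd1'.self_of_nhds, hd2, fishFactor, ← he, Real.rpow_sub_one hA.ne', Real.rpow_sub_one hA.ne',
      Complex.real_smul, Complex.real_smul, ← Complex.ofReal_mul, ← Complex.ofReal_mul,
      ← Complex.ofReal_add]
    congr 1
    simp only [mul_pow, ← Finset.mul_sum]
    rw [← norm_sq_eq_sum, show ‖x‖ ^ 2 = fishDen ρ x - ρ ^ 2 by unfold fishDen; ring, he]
    field_simp
    ring

/-- The fish-eye operator applied to `fishFactor ρ * F`. -/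
lemma fishEye_operator {N : ℕ} {ρ : ℝ} (hρ : 0 < ρ) {x : EuclideanSpace ℝ (Fin N)}
    {F : EuclideanSpace ℝ (Fin N) → ℂ} {G : Fin N → ℂ} {LF : ℂ} (hF : HasLaplacianData F x G LF)
    (lam : ℂ) :
    Laplacian.laplacian (fun y => (fishFactor ρ y : ℂ) * F y) x +
      4 * lam * (ρ : ℂ) ^ 2 / ((fishDen ρ x ^ 2 : ℝ) : ℂ) * ((fishFactor ρ x : ℂ) * F x) =
    (fishFactor ρ x : ℂ) * ((LF - 2 * (N - 2) / (fishDen ρ x : ℂ) * ∑ i, (x i : ℂ) * G i) +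
      4 * (ρ : ℂ) ^ 2 / (fishDen ρ x : ℂ) ^ 2 * ((lam - N / 2 * (N / 2 - 1)) * F x)) := by
  have hA : (fishDen ρ x : ℂ) ≠ 0 := by exact_mod_cast (fishDen_pos hρ x).ne'
  -- The Laplacian of the conformal factor itself supplies the constant -(N/2)(N/2 - 1) added to λ.
  rw [((hasLaplacianData_fishFactor hρ x).mul hF).3]
  have e1 : ∑ i, (((2 - N) * x i / fishDen ρ x * fishFactor ρ x : ℝ) : ℂ) * G i =
      (2 - N) / (fishDen ρ x : ℂ) * fishFactor ρ x * ∑ i, (x i : ℂ) * G i := by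
    rw [Finset.mul_sum]
    refine Finset.sum_congr rfl fun i _ => ?_
    push_cast
    ring
  rw [e1]
  push_cast
  field_simp
  ring

lemma contDiff_fishDen {N : ℕ} (ρ : ℝ) :
    ContDiff ℝ 2 (fishDen ρ : EuclideanSpace ℝ (Fin N) → ℝ) :=
  contDiff_iff_contDiffAt.2 fun x => (hasLaplacianData_fishDen ρ x).1

/-- The hypergeometric (zonal) operator in the variable `s`. -/
def zonalOp (N : ℕ) (lam : ℂ) (f0 f1 f2 : ℂ) (s : ℝ) : ℂ :=
  s * (1 - s) * f2 + N / 2 * (1 - 2 * s) * f1 + (lam - N / 2 * (N / 2 - 1)) * f0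

/-- The fish-eye operator acts on zonal functions through the hypergeometric operator. -/
lemma fishEye_operator_zonal {N : ℕ} {ρ : ℝ} (hρ : 0 < ρ) {x : EuclideanSpace ℝ (Fin N)}
    {t : EuclideanSpace ℝ (Fin N) → ℝ} {g : Fin N → ℝ} {L : ℝ} (ht : IsZonalAt ρ t x g L)
    {f : ℝ → ℂ} (hf : ContDiffAt ℝ 2 f (t x)) (lam : ℂ) :
    Laplacian.laplacian (fun y => (fishFactor ρ y : ℂ) * f (t y)) x +
      4 * lam * (ρ : ℂ) ^ 2 / ((fishDen ρ x ^ 2 : ℝ) : ℂ) * ((fishFactor ρ x : ℂ) * f (t x)) =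
    (fishFactor ρ x : ℂ) * (4 * (ρ : ℂ) ^ 2 / (fishDen ρ x : ℂ) ^ 2 *
      zonalOp N lam (f (t x)) (deriv f (t x)) (deriv (deriv f) (t x)) (t x)) := by
  rw [fishEye_operator hρ (ht.data.comp_real hf) lam]
  congr 1
  have h1 := congrArg (fun z : ℝ => (z : ℂ)) ht.grad_sq
  have h2 := congrArg (fun z : ℝ => (z : ℂ)) ht.laplacian
  simp only [Complex.real_smul]
  have e1 : ∑ i, (x i : ℂ) * ((g i : ℂ) * deriv f (t x)) =
      ((∑ i, x i * g i : ℝ) : ℂ) * deriv f (t x) := by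
    push_cast
    rw [Finset.sum_mul]
    exact Finset.sum_congr rfl fun i _ => by ring
  rw [e1]
  unfold zonalOp
  push_cast at h1 h2 ⊢
  linear_combination (deriv (deriv f) (t x)) * h1 + deriv f (t x) * h2

/-! ### Green's identity, shell estimates and logarithmic cutoffs -/

open MeasureTheory in
/-- Green's identity against a compactly supported test function. -/
lemma integral_mul_laplacian {N : ℕ} {u w : EuclideanSpace ℝ (Fin N) → ℂ}
    {Ω : Set (EuclideanSpace ℝ (Fin N))} (hΩ : IsOpen Ω) (hu : ContDiffOn ℝ 2 u Ω)
    (hw : ContDiff ℝ 2 w) (hws : HasCompactSupport w) (hwΩ : tsupport w ⊆ Ω) :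
    Integrable (fun x => u x * Laplacian.laplacian w x) ∧
    ∫ x, u x * Laplacian.laplacian w x = ∫ x, Laplacian.laplacian u x * w x := by
  set e : Fin N → EuclideanSpace ℝ (Fin N) := fun i => EuclideanSpace.single i 1 with he
  have huat : ∀ x ∈ Ω, ContDiffAt ℝ 2 u x := fun x hx => hu.contDiffAt (hΩ.mem_nhds hx)
  have hu1 : ∀ i, ∀ x ∈ Ω, ContDiffAt ℝ 1 (fun y => fderiv ℝ u y (e i)) x := fun i x hx =>
    ((huat x hx).fderiv_right (m := 1) (by norm_num)).clm_apply contDiffAt_const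
  have hw1 : ∀ i, ContDiff ℝ 1 (fun y => fderiv ℝ w y (e i)) := fun i =>
    (hw.fderiv_right (m := 1) (by norm_num)).clm_apply contDiff_const
  have hw2 : ∀ i, Continuous (fun x => fderiv ℝ (fun y => fderiv ℝ w y (e i)) x (e i)) := fun i =>
    ((hw1 i).continuous_fderiv (by norm_num)).clm_apply continuous_const
  have hu2 : ∀ i, ∀ x ∈ Ω,
      ContinuousAt (fun x => fderiv ℝ (fun y => fderiv ℝ u y (e i)) x (e i)) x := fun i x hx =>
    ((hu1 i x hx).continuousAt_fderiv (by norm_num)).clm_apply continuousAt_const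
  have ts1 : ∀ i, tsupport (fun y => fderiv ℝ w y (e i)) ⊆ tsupport w := fun i =>
    tsupport_fderiv_apply_subset ℝ (e i)
  have ts2 : ∀ i, tsupport (fun x => fderiv ℝ (fun y => fderiv ℝ w y (e i)) x (e i)) ⊆
      tsupport w := fun i => (tsupport_fderiv_apply_subset ℝ (e i)).trans (ts1 i)
  -- The function a is controlled only on Ω, but the support of b lies inside Ω, so the product is
  -- continuous everywhere with compact support.
  have hint : ∀ a b : EuclideanSpace ℝ (Fin N) → ℂ, (∀ x ∈ Ω, ContinuousAt a x) → Continuous b →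
      tsupport b ⊆ tsupport w → Integrable (fun x => a x * b x) := by
    intro a b ha hb hbs
    have hsub : tsupport (fun x => a x * b x) ⊆ tsupport b := tsupport_mul_subset_right
    refine Continuous.integrable_of_hasCompactSupport
      (continuous_of_tsupport fun x hx => (ha x ?_).mul hb.continuousAt) ?_
    · exact hwΩ (hbs (hsub hx))
    · exact hws.mono' ((subset_tsupport _).trans (hsub.trans hbs))
  have hterm : ∀ i, ∫ x, u x * fderiv ℝ (fun y => fderiv ℝ w y (e i)) x (e i) =
      ∫ x, fderiv ℝ (fun y => fderiv ℝ u y (e i)) x (e i) * w x := by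
    intro i
    have A1 := hint u _ (fun x hx => (huat x hx).continuousAt) (hw2 i) (ts2 i)
    have A2 := hint u _ (fun x hx => (huat x hx).continuousAt) (hw1 i).continuous (ts1 i)
    have A3 := hint _ _ (fun x hx => (hu1 i x hx).continuousAt) (hw1 i).continuous (ts1 i)
    have A4 := hint _ w (fun x hx => (hu1 i x hx).continuousAt) hw.continuous subset_rfl
    have A5 := hint _ w (hu2 i) hw.continuous subset_rfl
    rw [integral_mul_fderiv_eq_neg_fderiv_mul_of_integrable A3 A1 A2
      (fun x hx => (huat x (hwΩ (ts1 i hx))).differentiableAt (by norm_num))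
      (fun x _ => (hw1 i).differentiable (by norm_num) x),
      integral_mul_fderiv_eq_neg_fderiv_mul_of_integrable A5 A3 A4
      (fun x hx => (hu1 i x (hwΩ hx)).differentiableAt (by norm_num))
      (fun x _ => hw.differentiable (by norm_num) x), neg_neg]
  have hlw : (fun x => u x * Laplacian.laplacian w x) =
      fun x => ∑ i, u x * fderiv ℝ (fun y => fderiv ℝ w y (e i)) x (e i) := by
    funext x
    rw [laplacian_eq_sum_partial hw.contDiffAt, Finset.mul_sum]
  have hlu : (fun x => Laplacian.laplacian u x * w x) =
      fun x => ∑ i, fderiv ℝ (fun y => fderiv ℝ u y (e i)) x (e i) * w x := by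
    funext x
    by_cases hx : x ∈ tsupport w
    · rw [laplacian_eq_sum_partial (huat x (hwΩ hx)), Finset.sum_mul]
    · simp [image_eq_zero_of_notMem_tsupport hx]
  have A1 := fun i => hint u _ (fun x hx => (huat x hx).continuousAt) (hw2 i) (ts2 i)
  have A5 := fun i => hint _ w (hu2 i) hw.continuous subset_rfl
  constructor
  · rw [hlw]
    exact integrable_finsetSum _ fun i _ => A1 i
  · rw [hlw, hlu, integral_finsetSum _ fun i _ => A1 i, integral_finsetSum _ fun i _ => A5 i]
    exact Finset.sum_congr rfl fun i _ => hterm i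

open MeasureTheory in
/-- The integral of `|x - q| ^ (-N)` over a spherical shell of `ℝ^N` is logarithmic. -/
lemma exists_integral_shell (N : ℕ) (hN : 2 ≤ N) : ∃ C : ℝ, 0 < C ∧
    ∀ (q : EuclideanSpace ℝ (Fin N)) (a b : ℝ), 0 < a → a ≤ b →
      Integrable (fun x => Set.indicator (Set.Icc a b) (fun y : ℝ => y ^ (-(N : ℝ))) ‖x - q‖) ∧
      ∫ x, Set.indicator (Set.Icc a b) (fun y : ℝ => y ^ (-(N : ℝ))) ‖x - q‖
        ≤ C * Real.log (b / a) := by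
  have : Nonempty (Fin N) := ⟨⟨0, by omega⟩⟩
  set V := (volume : Measure (EuclideanSpace ℝ (Fin N))).real (Metric.ball 0 1) with hV
  have hV0 : 0 ≤ V := measureReal_nonneg
  refine ⟨N * V + 1, by positivity, fun q a b ha hab => ?_⟩
  set f : ℝ → ℝ := Set.indicator (Set.Icc a b) (fun y : ℝ => y ^ (-(N : ℝ))) with hf
  have hi0 : Integrable (fun x : EuclideanSpace ℝ (Fin N) => f ‖x‖) := by
    have hK : IsCompact {x : EuclideanSpace ℝ (Fin N) | ‖x‖ ∈ Set.Icc a b} := by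
      refine Metric.isCompact_of_isClosed_isBounded
        ((isClosed_Icc).preimage continuous_norm) ?_
      refine (Metric.isBounded_closedBall (x := (0 : EuclideanSpace ℝ (Fin N))) (r := b)).subset ?_
      intro x hx
      simpa using hx.2
    have : (fun x : EuclideanSpace ℝ (Fin N) => f ‖x‖) = Set.indicator
        {x : EuclideanSpace ℝ (Fin N) | ‖x‖ ∈ Set.Icc a b} (fun x => ‖x‖ ^ (-(N : ℝ))) := by
      funext x
      by_cases hx : ‖x‖ ∈ Set.Icc a b
      · rw [hf, Set.indicator_of_mem hx]
        exact (Set.indicator_of_mem (s := {x : EuclideanSpace ℝ (Fin N) | ‖x‖ ∈ Set.Icc a b}) hx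
          (fun x => ‖x‖ ^ (-(N : ℝ)))).symm
      · rw [hf, Set.indicator_of_notMem hx]
        exact (Set.indicator_of_notMem (s := {x : EuclideanSpace ℝ (Fin N) | ‖x‖ ∈ Set.Icc a b}) hx
          (fun x => ‖x‖ ^ (-(N : ℝ)))).symm
    rw [this, integrable_indicator_iff hK.measurableSet]
    refine ContinuousOn.integrableOn_compact hK ?_
    intro x hx
    have hx0 : ‖x‖ ≠ 0 := (ha.trans_le hx.1).ne'
    exact (continuous_norm.continuousAt.rpow_const (Or.inl hx0)).continuousWithinAt
  have hi : Integrable (fun x => f ‖x - q‖) := hi0.comp_sub_right q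
  refine ⟨hi, ?_⟩
  rw [integral_sub_right_eq_self (fun x => f ‖x‖) q, integral_fun_norm_addHaar volume f]
  simp only [finrank_euclideanSpace, Fintype.card_fin, nsmul_eq_mul, smul_eq_mul]
  have e1 : ∫ y in Set.Ioi (0 : ℝ), y ^ (N - 1) * f y = ∫ y in Set.Icc a b, y⁻¹ := by
    rw [← integral_indicator measurableSet_Ioi, ← integral_indicator measurableSet_Icc]
    congr 1
    funext y
    by_cases hy : y ∈ Set.Icc a b
    · have hy0 : 0 < y := ha.trans_le hy.1
      rw [Set.indicator_of_mem (show y ∈ Set.Ioi (0 : ℝ) from hy0), Set.indicator_of_mem hy, hf,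
        Set.indicator_of_mem hy, Real.rpow_neg hy0.le, Real.rpow_natCast]
      obtain ⟨M, rfl⟩ : ∃ M, N = M + 1 := ⟨N - 1, by omega⟩
      rw [Nat.add_sub_cancel, pow_succ]
      field_simp
    · rw [Set.indicator_of_notMem hy]
      by_cases hy0 : y ∈ Set.Ioi (0 : ℝ)
      · rw [Set.indicator_of_mem hy0, hf, Set.indicator_of_notMem hy, mul_zero]
      · rw [Set.indicator_of_notMem hy0]
  rw [e1, integral_Icc_eq_integral_Ioc, ← intervalIntegral.integral_of_le hab,
    integral_inv_of_pos ha (ha.trans_le hab)]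
  have hlog : 0 ≤ Real.log (b / a) := Real.log_nonneg (by rwa [le_div_iff₀ ha, one_mul])
  nlinarith

/-- The singular comparison function on the sphere, in the zonal variable. -/
def zonalSing (N : ℕ) (t : ℝ) : ℝ := if N = 2 then -Real.log t else t ^ (1 - (N : ℝ) / 2)

lemma zonalSing_pos (N : ℕ) {t : ℝ} (h0 : 0 < t) (h1 : t < 1) : 0 < zonalSing N t := by
  unfold zonalSing
  split_ifs
  · linarith [Real.log_neg h0 h1]
  · exact Real.rpow_pos_of_pos h0 _

open MeasureTheory in
/-- The shells `ε² ≤ t ≤ ε` have logarithmic mass for the weight `t ^ (-N/2)` times the spherical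
measure. -/
def HasShellBound {N : ℕ} (ρ : ℝ) (t : EuclideanSpace ℝ (Fin N) → ℝ) : Prop :=
  ∃ C : ℝ, 0 < C ∧ ∃ ε₀ : ℝ, 0 < ε₀ ∧ ∀ ε : ℝ, 0 < ε → ε < ε₀ →
    ∃ b : EuclideanSpace ℝ (Fin N) → ℝ, Integrable b ∧ (∀ x, 0 ≤ b x) ∧
      ∫ x, b x ≤ C * Real.log (1 / ε) ∧
      ∀ x, ε ^ 2 ≤ t x → t x ≤ ε → t x ^ (-((N : ℝ) / 2)) * fishDen ρ x ^ (-(N : ℝ)) ≤ b x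

lemma sq_rpow_neg_half {d : ℝ} (hd : 0 < d) (y : ℝ) : (d ^ 2) ^ (-(y / 2)) = d ^ (-y) := by
  rw [← Real.rpow_natCast d 2, ← Real.rpow_mul hd.le]
  congr 1
  push_cast
  ring

set_option maxHeartbeats 1000000 in
lemma hasShellBound_fishSin {N : ℕ} (hN : 2 ≤ N) {ρ : ℝ} (hρ : 0 < ρ)
    (q : EuclideanSpace ℝ (Fin N)) : HasShellBound ρ (fishSin ρ q) := by
  obtain ⟨C₀, hC₀, hshell⟩ := exists_integral_shell N hN
  set D := fishDen ρ q with hD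
  have hD0 : 0 < D := fishDen_pos hρ q
  have hDρ : ρ ^ 2 ≤ D := by rw [hD, fishDen]; nlinarith [sq_nonneg ‖q‖]
  set K : ℝ := (ρ / (2 * D)) ^ (-(N : ℝ)) * (ρ ^ 2) ^ (-(N : ℝ)) with hK
  have hK0 : 0 < K := by positivity
  -- The bound ε < ρ²/(4D) forces |x-q|² ≤ D and hence r² + ρ² ≤ 4D on the shell, so t is comparable
  -- to |x-q|² there.
  refine ⟨K * C₀, by positivity, min 1 (ρ ^ 2 / (4 * D)), by positivity, fun ε hε hε' => ?_⟩
  have hε1 : ε < 1 := hε'.trans_le (min_le_left _ _)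
  have hε2 : ε * (4 * D) < ρ ^ 2 := by
    have := hε'.trans_le (min_le_right _ _)
    rwa [lt_div_iff₀ (by positivity)] at this
  set sD := Real.sqrt D
  set sε := Real.sqrt ε
  have hsD : sD ^ 2 = D := Real.sq_sqrt hD0.le
  have hsε : sε ^ 2 = ε := Real.sq_sqrt hε.le
  have hsD0 : 0 < sD := Real.sqrt_pos.2 hD0
  have hsε0 : 0 < sε := Real.sqrt_pos.2 hε
  have hsε1 : sε < 1 := by nlinarith
  have hρsD : ρ ≤ sD := by nlinarith
  have hkey : 2 * sD * sε ≤ ρ := by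
    refine le_of_sq_le_sq ?_ hρ.le
    nlinarith
  -- Euclidean radii enclosing the shell ε² ≤ t ≤ ε. By `hkey` their ratio is at most 1/ε, which
  -- gives the logarithm in the conclusion.
  set a := ε * sD with ha
  set b := 2 * D * sε / ρ with hb
  have ha0 : 0 < a := by positivity
  have hab : a ≤ b := by
    rw [ha, hb, le_div_iff₀ hρ, ← hsε, ← hsD]
    nlinarith [mul_pos hsε0 hsD0, mul_pos (mul_pos hsε0 hsD0) hsD0,
      mul_le_mul hsε1.le hρsD hρ.le zero_le_one]
  obtain ⟨hi, hle⟩ := hshell q a b ha0 hab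
  refine ⟨_, hi.const_mul K, fun x => ?_, ?_, ?_⟩
  · refine mul_nonneg hK0.le (Set.indicator_nonneg (fun y hy => ?_) _)
    exact Real.rpow_nonneg (ha0.le.trans hy.1) _
  · rw [MeasureTheory.integral_const_mul, mul_assoc K]
    refine mul_le_mul_of_nonneg_left (hle.trans ?_) hK0.le
    refine mul_le_mul_of_nonneg_left ?_ hC₀.le
    refine Real.log_le_log (div_pos (ha0.trans_le hab) ha0) ?_
    rw [ha, hb, div_div, div_le_div_iff₀ (by positivity) hε, ← hsε, ← hsD]
    nlinarith [mul_le_mul_of_nonneg_left hkey (by positivity : 0 ≤ sε ^ 2 * sD)]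
  · intro x h1 h2
    set d := ‖x - q‖ with hd
    have hA := fishDen_pos hρ x
    have hAρ : ρ ^ 2 ≤ fishDen ρ x := by rw [fishDen]; nlinarith [sq_nonneg ‖x‖]
    have ht : fishSin ρ q x * (fishDen ρ x * D) = ρ ^ 2 * d ^ 2 := by
      rw [fishSin, ← hD, ← hd]; field_simp
    have hA2 : fishDen ρ x ≤ 2 * d ^ 2 + 2 * D := by
      have h3 : ‖x‖ ≤ d + ‖q‖ := by
        have := norm_add_le (x - q) q
        rwa [sub_add_cancel] at this
      rw [hD, fishDen, fishDen]
      nlinarith [norm_nonneg x, norm_nonneg q, norm_nonneg (x - q), sq_nonneg (d - ‖q‖),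
        sq_nonneg ρ]
    have hdD : d ^ 2 ≤ D := by
      have h3 : ρ ^ 2 * d ^ 2 ≤ ε * (fishDen ρ x * D) := by
        rw [← ht]; exact mul_le_mul_of_nonneg_right h2 (by positivity)
      have h4 : ε * (fishDen ρ x * D) ≤ ρ ^ 2 / 4 * fishDen ρ x := by nlinarith
      have h5 : d ^ 2 ≤ fishDen ρ x / 4 := by
        have : ρ ^ 2 * d ^ 2 ≤ ρ ^ 2 * (fishDen ρ x / 4) := by linarith
        exact le_of_mul_le_mul_left this (by positivity)
      linarith
    have hA4 : fishDen ρ x ≤ 4 * D := by linarith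
    have hda : a ≤ d := by
      refine le_of_sq_le_sq ?_ (norm_nonneg _)
      rw [ha, mul_pow, hsD]
      have : ρ ^ 2 * (ε ^ 2 * D) ≤ ρ ^ 2 * d ^ 2 := by
        rw [← ht]
        have := mul_le_mul h1 (mul_le_mul_of_nonneg_right hAρ hD0.le) (by positivity)
          ((sq_nonneg ε).trans h1)
        linarith
      exact le_of_mul_le_mul_left this (by positivity)
    have hd0 : 0 < d := ha0.trans_le hda
    have htd : (ρ / (2 * D) * d) ^ 2 ≤ fishSin ρ q x := by
      have h3 : fishSin ρ q x = ρ ^ 2 * d ^ 2 / (fishDen ρ x * D) := rfl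
      rw [h3, mul_pow, div_pow, div_mul_eq_mul_div]
      refine div_le_div_of_nonneg_left (by positivity) (by positivity) ?_
      nlinarith
    have hdb : d ≤ b := by
      rw [hb, le_div_iff₀ hρ]
      refine le_of_sq_le_sq ?_ (by positivity)
      have h3 := htd.trans h2
      rw [mul_pow, div_pow, div_mul_eq_mul_div, div_le_iff₀ (by positivity)] at h3
      rw [mul_pow, mul_pow (2 * D), hsε]
      linarith
    rw [Set.indicator_of_mem (show ‖x - q‖ ∈ Set.Icc a b from ⟨hda, hdb⟩), hK]
    have e1 : fishSin ρ q x ^ (-((N : ℝ) / 2)) ≤ (ρ / (2 * D)) ^ (-(N : ℝ)) * d ^ (-(N : ℝ)) := by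
      rw [← Real.mul_rpow (by positivity) hd0.le, ← sq_rpow_neg_half (d := ρ / (2 * D) * d) (by positivity)]
      exact Real.rpow_le_rpow_of_nonpos (by positivity) htd (by
        have := Nat.cast_nonneg (α := ℝ) N; linarith)
    have e2 : fishDen ρ x ^ (-(N : ℝ)) ≤ (ρ ^ 2) ^ (-(N : ℝ)) :=
      Real.rpow_le_rpow_of_nonpos (by positivity) hAρ (by
        have := Nat.cast_nonneg (α := ℝ) N; linarith)
    calc _ ≤ ((ρ / (2 * D)) ^ (-(N : ℝ)) * d ^ (-(N : ℝ))) * (ρ ^ 2) ^ (-(N : ℝ)) :=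
          mul_le_mul e1 e2 (by positivity) (by positivity)
      _ = _ := by ring

lemma hasShellBound_fishSinInfty {N : ℕ} (hN : 2 ≤ N) {ρ : ℝ} (hρ : 0 < ρ) :
    HasShellBound ρ (fishSinInfty ρ : EuclideanSpace ℝ (Fin N) → ℝ) := by
  obtain ⟨C₀, hC₀, hshell⟩ := exists_integral_shell N hN
  set K : ℝ := ρ ^ (-(N : ℝ)) with hK
  have hK0 : 0 < K := by positivity
  refine ⟨K * C₀, by positivity, 1 / 2, by positivity, fun ε hε hε' => ?_⟩
  -- At infinity t = ρ²/(r² + ρ²), and the shell lies in ρ ≤ r ≤ ρ/ε, whose radii have ratio exactly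
  -- 1/ε.
  have hab : ρ ≤ ρ / ε := by
    rw [le_div_iff₀ hε]; nlinarith
  obtain ⟨hi, hle⟩ := hshell 0 ρ (ρ / ε) hρ hab
  refine ⟨_, hi.const_mul K, fun x => ?_, ?_, ?_⟩
  · refine mul_nonneg hK0.le (Set.indicator_nonneg (fun y hy => ?_) _)
    exact Real.rpow_nonneg (hρ.le.trans hy.1) _
  · rw [MeasureTheory.integral_const_mul, mul_assoc K]
    refine mul_le_mul_of_nonneg_left (hle.trans_eq ?_) hK0.le
    congr 2
    field_simp
  · intro x h1 h2
    have hA := fishDen_pos hρ x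
    have hx : ‖x‖ ^ 2 = fishDen ρ x - ρ ^ 2 := by unfold fishDen; ring
    rw [fishSinInfty, le_div_iff₀ hA] at h1
    rw [fishSinInfty, div_le_iff₀ hA] at h2
    have hd1 : ρ ≤ ‖x‖ := by
      refine le_of_sq_le_sq ?_ (norm_nonneg _)
      nlinarith
    have hd2 : ‖x‖ ≤ ρ / ε := by
      rw [le_div_iff₀ hε]
      refine le_of_sq_le_sq ?_ hρ.le
      rw [mul_pow, hx]
      nlinarith [sq_nonneg (ε * ρ)]
    have hx0 : 0 < ‖x‖ := hρ.trans_le hd1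
    rw [sub_zero, Set.indicator_of_mem (show ‖x‖ ∈ Set.Icc ρ (ρ / ε) from ⟨hd1, hd2⟩), hK,
      fishSinInfty]
    have e1 : (ρ ^ 2 / fishDen ρ x) ^ (-((N : ℝ) / 2)) * fishDen ρ x ^ (-(N : ℝ)) =
        ρ ^ (-(N : ℝ)) * fishDen ρ x ^ (-((N : ℝ) / 2)) := by
      rw [Real.div_rpow (by positivity) hA.le, sq_rpow_neg_half hρ,
        show -(N : ℝ) = -((N : ℝ) / 2) + -((N : ℝ) / 2) by ring, Real.rpow_add hA]
      have := (Real.rpow_pos_of_pos hA (-((N : ℝ) / 2))).ne'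
      field_simp
    rw [e1, ← sq_rpow_neg_half hx0]
    refine mul_le_mul_of_nonneg_left ?_ (by positivity)
    refine Real.rpow_le_rpow_of_nonpos (by positivity) ?_ (by
      have := Nat.cast_nonneg (α := ℝ) N; linarith)
    rw [hx]; nlinarith [sq_nonneg ρ]

lemma exists_bound_smoothTransition : ∃ B : ℝ, 0 < B ∧ (∀ v, |deriv Real.smoothTransition v| ≤ B) ∧
    (∀ v, |deriv (deriv Real.smoothTransition) v| ≤ B) ∧
    ∀ v, v < 0 ∨ 1 < v → deriv Real.smoothTransition v = 0 ∧
      deriv (deriv Real.smoothTransition) v = 0 := by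
  have hz : ∀ v : ℝ, v < 0 ∨ 1 < v → deriv Real.smoothTransition v = 0 := by
    intro v hv
    rcases hv with hv | hv
    · have : Real.smoothTransition =ᶠ[𝓝 v] fun _ => 0 :=
        (gt_mem_nhds hv).mono fun w hw => Real.smoothTransition.zero_of_nonpos hw.le
      rw [this.deriv_eq, deriv_const]
    · have : Real.smoothTransition =ᶠ[𝓝 v] fun _ => 1 :=
        (lt_mem_nhds hv).mono fun w hw => Real.smoothTransition.one_of_one_le hw.le
      rw [this.deriv_eq, deriv_const]
  have hz2 : ∀ v : ℝ, v < 0 ∨ 1 < v → deriv (deriv Real.smoothTransition) v = 0 := by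
    intro v hv
    have ho : IsOpen {v : ℝ | v < 0 ∨ 1 < v} := isOpen_Iio.union isOpen_Ioi
    have : deriv Real.smoothTransition =ᶠ[𝓝 v] fun _ => 0 :=
      Filter.eventually_of_mem (ho.mem_nhds hv) fun w hw => hz w hw
    rw [this.deriv_eq, deriv_const]
  have hcd : ContDiff ℝ 2 Real.smoothTransition := Real.smoothTransition.contDiff
  have c1 : ContDiff ℝ 1 (deriv Real.smoothTransition) :=
    (contDiff_succ_iff_deriv (n := 1)).1 (by simpa [one_add_one_eq_two] using hcd) |>.2.2
  have c2 : Continuous (deriv (deriv Real.smoothTransition)) :=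
    c1.continuous_deriv (by norm_num)
  obtain ⟨B1, h1⟩ := isCompact_Icc.exists_bound_of_continuousOn (s := Set.Icc (0 : ℝ) 1)
    c1.continuous.continuousOn
  obtain ⟨B2, h2⟩ := isCompact_Icc.exists_bound_of_continuousOn (s := Set.Icc (0 : ℝ) 1)
    c2.continuousOn
  refine ⟨|B1| + |B2| + 1, by positivity, fun v => ?_, fun v => ?_, fun v hv => ⟨hz v hv, hz2 v hv⟩⟩
  · by_cases hv : v ∈ Set.Icc (0 : ℝ) 1
    · have := h1 v hv
      rw [Real.norm_eq_abs] at this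
      linarith [le_abs_self B1, abs_nonneg B2]
    · rw [hz v (by by_contra h; push Not at h; exact hv ⟨h.1, h.2⟩), abs_zero]; positivity
  · by_cases hv : v ∈ Set.Icc (0 : ℝ) 1
    · have := h2 v hv
      rw [Real.norm_eq_abs] at this
      linarith [le_abs_self B2, abs_nonneg B1]
    · rw [hz2 v (by by_contra h; push Not at h; exact hv ⟨h.1, h.2⟩), abs_zero]; positivity

set_option maxHeartbeats 1000000 in
/-- Logarithmic cutoffs. -/
lemma exists_log_cutoff (N : ℕ) (hN : 2 ≤ N) : ∃ C : ℝ, 0 < C ∧ ∀ ε : ℝ, 0 < ε → ε ≤ 1 / 2 →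
    ∃ χ : ℝ → ℝ, ContDiff ℝ 2 χ ∧ (∀ t ≤ ε ^ 2, χ t = 0) ∧ (∀ t, ε ≤ t → χ t = 1) ∧
      (∀ t, t < ε ^ 2 ∨ ε < t → deriv χ t = 0 ∧ deriv (deriv χ) t = 0) ∧
      ∀ t, 0 < t → t < 1 →
        |t * (1 - t) * deriv (deriv χ) t + N / 2 * (1 - 2 * t) * deriv χ t| +
          2 * Real.sqrt t * |deriv χ t| ≤
        C * t ^ (-((N : ℝ) / 2)) / (zonalSing N t * Real.log (1 / ε)) := by
  obtain ⟨B, hB, hb1, hb2, hb0⟩ := exists_bound_smoothTransition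
  set k := Real.smoothTransition with hk
  have hkcd : ContDiff ℝ 2 k := Real.smoothTransition.contDiff
  have hk1 : ContDiff ℝ 1 (deriv k) :=
    (contDiff_succ_iff_deriv (n := 1)).1 (by simpa [one_add_one_eq_two] using hkcd) |>.2.2
  have hNr : (2 : ℝ) ≤ N := by exact_mod_cast hN
  -- The constant is generous: the three error terms add up to at most 8B when N = 2 and to at most
  -- (4 + 2N)B otherwise.
  refine ⟨B * (7 + 3 * N), by positivity, fun ε hε hε2 => ?_⟩
  set L := Real.log (1 / ε) with hL
  have hLe : Real.log ε = -L := by rw [hL, one_div, Real.log_inv, neg_neg]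
  have hLh : 1 / 2 ≤ L := by
    have h1 : Real.log 2 ≤ L := Real.log_le_log two_pos (by rw [le_div_iff₀ hε]; linarith)
    linarith [Real.log_two_gt_d9]
  have hL0 : 0 < L := by linarith
  have hεsq : ε ^ 2 < ε := by nlinarith
  -- The transition is linear in log t, running from t = ε² to t = ε. The explicit 0 branch is
  -- needed since `Real.log` is 0 at 0 and even, so the formula alone would be wrong for t ≤ 0.
  set χ : ℝ → ℝ := fun t => if t ≤ ε ^ 2 then 0 else k (2 + Real.log t / L) with hχ
  have hpos : ∀ t, 0 < t → χ t = k (2 + Real.log t / L) := by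
    intro t ht
    by_cases h : t ≤ ε ^ 2
    · have h1 : Real.log t ≤ -(2 * L) := by
        have := Real.log_le_log ht h
        rw [Real.log_pow, hLe] at this
        push_cast at this
        linarith
      have h2 : 2 + Real.log t / L ≤ 0 := by
        have : Real.log t / L ≤ -2 := by rw [div_le_iff₀ hL0]; linarith
        linarith
      rw [hχ]
      simp only [if_pos h]
      exact (Real.smoothTransition.zero_of_nonpos h2).symm
    · simp only [hχ, if_neg h]
  have hzero : ∀ t, t ≤ ε ^ 2 → χ t = 0 := fun t ht => by simp only [hχ, if_pos ht]
  have hd1 : ∀ t, 0 < t → deriv χ t = deriv k (2 + Real.log t / L) / (t * L) := by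
    intro t ht
    have h1 : χ =ᶠ[𝓝 t] fun t => k (2 + Real.log t / L) :=
      (lt_mem_nhds ht).mono fun s hs => hpos s hs
    have h2 := (hkcd.differentiable (by norm_num) (2 + Real.log t / L)).hasDerivAt.comp t
      (((Real.hasDerivAt_log ht.ne').div_const L).const_add 2)
    rw [h1.deriv_eq, HasDerivAt.deriv (f := fun t => k (2 + Real.log t / L)) h2]
    field_simp
  have hd2 : ∀ t, 0 < t → deriv (deriv χ) t =
      deriv (deriv k) (2 + Real.log t / L) / (t ^ 2 * L ^ 2) -
        deriv k (2 + Real.log t / L) / (t ^ 2 * L) := by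
    intro t ht
    have h1 : deriv χ =ᶠ[𝓝 t] fun t => deriv k (2 + Real.log t / L) / (t * L) :=
      (lt_mem_nhds ht).mono fun s hs => hd1 s hs
    have h2 := ((hk1.differentiable (by norm_num) (2 + Real.log t / L)).hasDerivAt.comp t
      (((Real.hasDerivAt_log ht.ne').div_const L).const_add 2)).div
      ((hasDerivAt_id t).mul_const L) (mul_ne_zero ht.ne' hL0.ne')
    rw [h1.deriv_eq, HasDerivAt.deriv (f := fun t => deriv k (2 + Real.log t / L) / (t * L)) h2]
    simp only [id, Function.comp]
    field_simp
  have hlogle : ∀ t, 0 < t → t ≤ ε → Real.log t ≤ -L := fun t ht h => by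
    have := Real.log_le_log ht h
    rwa [hLe] at this
  refine ⟨χ, ?_, hzero, ?_, ?_, ?_⟩
  · rw [contDiff_iff_contDiffAt]
    intro t
    by_cases ht : t < ε ^ 2
    · refine contDiffAt_const (c := (0 : ℝ)) |>.congr_of_eventuallyEq ?_
      exact (gt_mem_nhds ht).mono fun s hs => hzero s (le_of_lt hs)
    · have ht0 : 0 < t := lt_of_lt_of_le (by positivity) (not_lt.1 ht)
      have h1 : ContDiffAt ℝ 2 (fun t => k (2 + Real.log t / L)) t :=
        hkcd.contDiffAt.comp t (contDiffAt_const.add ((Real.contDiffAt_log.2 ht0.ne').div_const L))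
      exact h1.congr_of_eventuallyEq ((lt_mem_nhds ht0).mono fun s hs => hpos s hs)
  · intro t ht
    rw [hpos t (hε.trans_le ht)]
    refine Real.smoothTransition.one_of_one_le ?_
    have := Real.log_le_log hε ht
    rw [hLe] at this
    have : -1 ≤ Real.log t / L := by rw [le_div_iff₀ hL0]; linarith
    linarith
  · intro t ht
    rcases ht with ht | ht
    · have ho : ∀ s, s < ε ^ 2 → deriv χ s = 0 := by
        intro s hs
        have : χ =ᶠ[𝓝 s] fun _ => 0 := (gt_mem_nhds hs).mono fun w hw => hzero w (le_of_lt hw)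
        rw [this.deriv_eq, deriv_const]
      refine ⟨ho t ht, ?_⟩
      have : deriv χ =ᶠ[𝓝 t] fun _ => 0 := (gt_mem_nhds ht).mono fun w hw => ho w hw
      rw [this.deriv_eq, deriv_const]
    · have ht0 : 0 < t := hε.trans ht
      have h1 : 1 < 2 + Real.log t / L := by
        have := Real.log_lt_log hε ht
        rw [hLe] at this
        have : -1 < Real.log t / L := by rw [lt_div_iff₀ hL0]; linarith
        linarith
      have h2 := hb0 _ (Or.inr h1)
      rw [hd1 t ht0, hd2 t ht0, h2.1, h2.2]
      simp
  · intro t ht ht1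
    have hS := zonalSing_pos N ht ht1
    by_cases hreg : 2 + Real.log t / L < 0 ∨ 1 < 2 + Real.log t / L
    · have h2 := hb0 _ hreg
      rw [hd1 t ht, hd2 t ht, h2.1, h2.2]
      simp only [zero_div, sub_zero, mul_zero, add_zero, abs_zero]
      positivity
    · push Not at hreg
      have hl1 : -Real.log t ≤ 2 * L := by
        have : -2 ≤ Real.log t / L := by linarith [hreg.1]
        rw [le_div_iff₀ hL0] at this
        linarith
      rw [hd1 t ht, hd2 t ht]
      have hv1 := hb1 (2 + Real.log t / L)
      have hv2 := hb2 (2 + Real.log t / L)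
      set v1 := deriv k (2 + Real.log t / L)
      set v2 := deriv (deriv k) (2 + Real.log t / L)
      set s := Real.sqrt t with hs
      have hs0 : 0 < s := Real.sqrt_pos.2 ht
      have hst : s ^ 2 = t := Real.sq_sqrt ht.le
      have hs1 : s < 1 := by nlinarith
      -- The terms of order 1/(tL) carry the coefficient N/2 - 1, which vanishes for N = 2, log t
      -- being harmonic to leading order in the plane. What remains is of order 1/(tL²), and the
      -- extra 1/L absorbs the singularity -log t ≤ 2L.
      have e1 : t * (1 - t) * (v2 / (t ^ 2 * L ^ 2) - v1 / (t ^ 2 * L)) +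
          N / 2 * (1 - 2 * t) * (v1 / (t * L)) =
          (1 - t) * v2 / (t * L ^ 2) + v1 * (N / 2 - 1 + t * (1 - N)) / (t * L) := by
        field_simp
        ring
      have e2 : |v1 / (t * L)| = |v1| / (t * L) := by
        rw [abs_div, abs_of_pos (by positivity : 0 < t * L)]
      have e3 : |(1 - t) * v2 / (t * L ^ 2)| ≤ B / (t * L ^ 2) := by
        rw [abs_div, abs_of_pos (by positivity : 0 < t * L ^ 2), abs_mul,
          abs_of_pos (by linarith : 0 < 1 - t)]
        gcongr
        nlinarith [abs_nonneg v2]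
      rw [e1, e2]
      by_cases hN2 : N = 2
      · subst hN2
        have hl0 : 0 < -Real.log t := by linarith [Real.log_neg ht ht1]
        set l := -Real.log t with hl
        have hsl : s * l ≤ 2 := by
          have h3 := Real.log_le_sub_one_of_pos (inv_pos.2 hs0)
          rw [Real.log_inv, hs, Real.log_sqrt ht.le, ← hs] at h3
          have h4 : l ≤ 2 * s⁻¹ := by rw [hl]; linarith
          calc s * l ≤ s * (2 * s⁻¹) := mul_le_mul_of_nonneg_left h4 hs0.le
            _ = 2 := by field_simp
        have htl : t * l ≤ 2 := by rw [← hst]; nlinarith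
        have e4 : |v1 * ((2 : ℕ) / 2 - 1 + t * (1 - (2 : ℕ))) / (t * L)| ≤ B / L := by
          rw [show v1 * (((2 : ℕ) : ℝ) / 2 - 1 + t * (1 - ((2 : ℕ) : ℝ))) / (t * L) = -(v1 / L) by
            push_cast; field_simp; ring, abs_neg, abs_div, abs_of_pos hL0]
          gcongr
        have hz : zonalSing 2 t = l := by simp [zonalSing, hl]
        have ht' : t ^ (-(((2 : ℕ) : ℝ) / 2)) = 1 / t := by
          rw [show -(((2 : ℕ) : ℝ) / 2) = -1 by norm_num, Real.rpow_neg_one, one_div]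
        have f1 : B / (t * L ^ 2) ≤ 2 * B / (t * l * L) := by
          rw [div_le_div_iff₀ (by positivity) (by positivity)]
          nlinarith [mul_le_mul_of_nonneg_left hl1 (by positivity : 0 ≤ B * t * L)]
        have f2 : B / L ≤ 2 * B / (t * l * L) := by
          rw [div_le_div_iff₀ (by positivity) (by positivity)]
          nlinarith [mul_le_mul_of_nonneg_left htl (by positivity : 0 ≤ B * L)]
        have f3 : 2 * s * (|v1| / (t * L)) ≤ 4 * B / (t * l * L) := by
          rw [← mul_div_assoc, div_le_div_iff₀ (by positivity) (by positivity)]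
          nlinarith [mul_le_mul_of_nonneg_left hsl (by positivity : 0 ≤ |v1| * t * L),
            mul_le_mul_of_nonneg_left hv1 (by positivity : 0 ≤ t * L)]
        have f4 : B * (7 + 3 * ((2 : ℕ) : ℝ)) * t ^ (-(((2 : ℕ) : ℝ) / 2)) / (zonalSing 2 t * L) =
            13 * B / (t * l * L) := by
          rw [hz, ht']; push_cast; field_simp; ring
        rw [f4]
        have f5 : 0 ≤ B / (t * l * L) := by positivity
        have := abs_add_le ((1 - t) * v2 / (t * L ^ 2))
          (v1 * (((2 : ℕ) : ℝ) / 2 - 1 + t * (1 - ((2 : ℕ) : ℝ))) / (t * L))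
        have f6 : ∀ a : ℝ, a * B / (t * l * L) = a * (B / (t * l * L)) := fun a => by ring
        rw [f6] at f1 f2 f3 ⊢
        linarith
      · have hz : zonalSing N t = t ^ (1 - (N : ℝ) / 2) := by simp [zonalSing, hN2]
        have e4 : |v1 * ((N : ℝ) / 2 - 1 + t * (1 - N)) / (t * L)| ≤ B * (2 * N) / (t * L) := by
          rw [abs_div, abs_of_pos (by positivity : 0 < t * L), abs_mul]
          gcongr
          rw [abs_le]
          constructor <;> nlinarith
        have f1 : B / (t * L ^ 2) ≤ 2 * B / (t * L) := by
          rw [div_le_div_iff₀ (by positivity) (by positivity)]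
          nlinarith [mul_le_mul_of_nonneg_left hLh (by positivity : 0 ≤ B * t * L)]
        have f3 : 2 * s * (|v1| / (t * L)) ≤ 2 * B / (t * L) := by
          rw [← mul_div_assoc]
          gcongr
          nlinarith [abs_nonneg v1]
        have f4 : B * (7 + 3 * (N : ℝ)) * t ^ (-((N : ℝ) / 2)) / (zonalSing N t * L) =
            B * (7 + 3 * N) / (t * L) := by
          rw [hz, sub_eq_add_neg, Real.rpow_add ht, Real.rpow_one]
          have := (Real.rpow_pos_of_pos ht (-((N : ℝ) / 2))).ne'
          field_simp
        rw [f4]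
        have f5 : 0 ≤ B / (t * L) := by positivity
        have := abs_add_le ((1 - t) * v2 / (t * L ^ 2))
          (v1 * ((N : ℝ) / 2 - 1 + t * (1 - N)) / (t * L))
        have f6 : ∀ a : ℝ, a * B / (t * L) = a * (B / (t * L)) := fun a => by ring
        have f7 : ∀ a : ℝ, B * a / (t * L) = a * (B / (t * L)) := fun a => by ring
        rw [f6] at f1 f3
        rw [f7] at e4 ⊢
        have f8 : 0 ≤ (N : ℝ) * (B / (t * L)) := by positivity
        generalize B / (t * L) = Q at *
        linarith

/-! ### Elementary properties of the spherical distance -/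

lemma ContDiffAt.continuousAt_deriv_two {A : Type*} [NormedAddCommGroup A] [NormedSpace ℝ A]
    {f : ℝ → A} {s : ℝ} (hf : ContDiffAt ℝ 2 f s) :
    ContinuousAt (deriv f) s ∧ ContinuousAt (deriv (deriv f)) s := by
  have h1 : ContDiffAt ℝ 1 (deriv f) s := by
    have : ContDiffAt ℝ 1 (fun s => fderiv ℝ f s 1) s :=
      (hf.fderiv_right (m := 1) (by norm_num)).clm_apply contDiffAt_const
    simpa only [fderiv_apply_one_eq_deriv] using this
  refine ⟨h1.continuousAt, ?_⟩
  have : ContinuousAt (fun s => fderiv ℝ (deriv f) s 1) s :=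
    (h1.continuousAt_fderiv (by norm_num)).clm_apply continuousAt_const
  simpa only [fderiv_apply_one_eq_deriv] using this

lemma fishSin_nonneg {N : ℕ} {ρ : ℝ} (hρ : 0 < ρ) (p x : EuclideanSpace ℝ (Fin N)) :
    0 ≤ fishSin ρ p x := by
  have := fishDen_pos hρ x
  have := fishDen_pos hρ p
  unfold fishSin
  positivity

lemma fishSin_pos {N : ℕ} {ρ : ℝ} (hρ : 0 < ρ) {p x : EuclideanSpace ℝ (Fin N)} (h : x ≠ p) :
    0 < fishSin ρ p x := by
  have := fishDen_pos hρ x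
  have := fishDen_pos hρ p
  have : 0 < ‖x - p‖ := norm_pos_iff.2 (sub_ne_zero.2 h)
  unfold fishSin
  positivity

lemma fishSin_self {N : ℕ} (ρ : ℝ) (p : EuclideanSpace ℝ (Fin N)) : fishSin ρ p p = 0 := by
  simp [fishSin]

/-- This is the squared cosine of half the distance, so the image factor vanishes exactly where s =
1, at the antipode of p. -/
lemma one_sub_fishSin {N : ℕ} {ρ : ℝ} (hρ : 0 < ρ) (p x : EuclideanSpace ℝ (Fin N)) :
    1 - fishSin ρ p x = fishEyeImageFactor ρ x p / (fishDen ρ x * fishDen ρ p) := by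
  have h1 := (fishDen_pos hρ x).ne'
  have h2 := (fishDen_pos hρ p).ne'
  unfold fishSin
  rw [eq_div_iff (mul_ne_zero h1 h2), sub_mul, div_mul_cancel₀ _ (mul_ne_zero h1 h2),
    norm_sub_sq_real]
  unfold fishDen fishEyeImageFactor
  ring

lemma fishEyeImageFactor_nonneg {N : ℕ} (ρ : ℝ) (x p : EuclideanSpace ℝ (Fin N)) :
    0 ≤ fishEyeImageFactor ρ x p := by
  have h := abs_le.1 (abs_real_inner_le_norm x p)
  unfold fishEyeImageFactor
  nlinarith [sq_nonneg (‖x‖ * ‖p‖ - ρ ^ 2), mul_nonneg (sq_nonneg ρ) (by linarith [h.1] :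
    0 ≤ inner ℝ x p + ‖x‖ * ‖p‖)]

lemma fishSin_le_one {N : ℕ} {ρ : ℝ} (hρ : 0 < ρ) (p x : EuclideanSpace ℝ (Fin N)) :
    fishSin ρ p x ≤ 1 := by
  have h := one_sub_fishSin hρ p x
  have := fishDen_pos hρ x
  have := fishDen_pos hρ p
  have : 0 ≤ 1 - fishSin ρ p x := by
    rw [h]; exact div_nonneg (fishEyeImageFactor_nonneg _ _ _) (by positivity)
  linarith

lemma continuous_fishDen {N : ℕ} (ρ : ℝ) :
    Continuous (fishDen ρ : EuclideanSpace ℝ (Fin N) → ℝ) := (contDiff_fishDen ρ).continuous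

lemma contDiff_fishSin {N : ℕ} {ρ : ℝ} (hρ : 0 < ρ) (p : EuclideanSpace ℝ (Fin N)) :
    ContDiff ℝ 2 (fishSin ρ p) := contDiff_iff_contDiffAt.2 fun x => by
  obtain ⟨g, L, h⟩ := exists_isZonalAt_fishSin hρ p x
  exact h.data.contDiffAt

lemma contDiff_fishSinInfty {N : ℕ} {ρ : ℝ} (hρ : 0 < ρ) :
    ContDiff ℝ 2 (fishSinInfty ρ : EuclideanSpace ℝ (Fin N) → ℝ) :=
  contDiff_iff_contDiffAt.2 fun x => by
    obtain ⟨g, L, h⟩ := exists_isZonalAt_fishSinInfty hρ x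
    exact h.data.contDiffAt

lemma contDiff_fishFactor {N : ℕ} {ρ : ℝ} (hρ : 0 < ρ) :
    ContDiff ℝ 2 (fun x : EuclideanSpace ℝ (Fin N) => (fishFactor ρ x : ℂ)) :=
  contDiff_iff_contDiffAt.2 fun x => (hasLaplacianData_fishFactor hρ x).contDiffAt

lemma exists_fishSinInfty_lt {N : ℕ} {ρ : ℝ} (hρ : 0 < ρ) {ε : ℝ} (hε : 0 < ε) :
    ∃ R : ℝ, ∀ x : EuclideanSpace ℝ (Fin N), R < ‖x‖ → fishSinInfty ρ x < ε := by
  refine ⟨ρ ^ 2 / ε + 1, fun x hx => ?_⟩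
  have h1 : 0 < ρ ^ 2 / ε := by positivity
  have hA := fishDen_pos hρ x
  unfold fishSinInfty
  rw [div_lt_iff₀ hA]
  have h2 : ρ ^ 2 / ε < fishDen ρ x := by unfold fishDen; nlinarith [sq_nonneg ρ]
  rwa [div_lt_iff₀ hε, mul_comm] at h2

/-- Points close to `p` stay away from infinity on the sphere. -/
lemma exists_fishSin_lt_le_fishSinInfty {N : ℕ} {ρ : ℝ} (hρ : 0 < ρ)
    (p : EuclideanSpace ℝ (Fin N)) :
    ∃ ε : ℝ, 0 < ε ∧ ∀ x, fishSin ρ p x < ε → ε ≤ fishSinInfty ρ x := by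
  have hD := fishDen_pos hρ p
  refine ⟨ρ ^ 2 / (4 * fishDen ρ p), by positivity, fun x hx => ?_⟩
  have hA := fishDen_pos hρ x
  unfold fishSin at hx
  unfold fishSinInfty
  rw [div_lt_div_iff₀ (by positivity) (by positivity)] at hx
  have h1 : ‖x - p‖ ^ 2 * 4 < fishDen ρ x := by
    have : ρ ^ 2 * fishDen ρ p * (‖x - p‖ ^ 2 * 4) < ρ ^ 2 * fishDen ρ p * fishDen ρ x := by
      linarith
    exact lt_of_mul_lt_mul_left this (by positivity)
  have h2 : fishDen ρ x ≤ 2 * ‖x - p‖ ^ 2 + 2 * fishDen ρ p := by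
    have h3 : ‖x‖ ≤ ‖x - p‖ + ‖p‖ := by
      have := norm_add_le (x - p) p
      rwa [sub_add_cancel] at this
    unfold fishDen
    nlinarith [norm_nonneg x, norm_nonneg p, norm_nonneg (x - p), sq_nonneg (‖x - p‖ - ‖p‖),
      sq_nonneg ρ]
  gcongr
  linarith

/-! ### Orthogonality of solutions to images of zonal functions -/

/-- `u` is negligible against the singular solution where `t` is small, on the support of `F`. -/
def IsNegligible {N : ℕ} (ρ : ℝ) (F u : EuclideanSpace ℝ (Fin N) → ℂ)
    (t : EuclideanSpace ℝ (Fin N) → ℝ) : Prop :=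
  ∀ η : ℝ, 0 < η → ∃ ε₀ : ℝ, 0 < ε₀ ∧ ∀ x, 0 < t x → t x < ε₀ →
    F =ᶠ[𝓝 x] 0 ∨ ‖u x‖ ≤ η * (zonalSing N (t x) * fishFactor ρ x)

/-- The commutator term produced by a zonal cutoff. -/
def cutoffError {N : ℕ} (ρ : ℝ) (u : EuclideanSpace ℝ (Fin N) → ℂ) (f0 f1 : ℂ)
    (g g' : Fin N → ℝ) (χ : ℝ → ℝ) (τ : ℝ) (x : EuclideanSpace ℝ (Fin N)) : ℂ :=
  u x * (fishFactor ρ x * (f0 * ((4 * ρ ^ 2 / fishDen ρ x ^ 2 *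
    (τ * (1 - τ) * deriv (deriv χ) τ + N / 2 * (1 - 2 * τ) * deriv χ τ) : ℝ) : ℂ) +
    2 * (((∑ i, g' i * g i : ℝ) : ℂ) * ((deriv χ τ : ℝ) : ℂ) * f1)))

/-- The size of u and the cutoff bound contain the same `zonalSing`, which cancels. The cross
gradient is at most a multiple of √t by Cauchy–Schwarz, and the two conformal factors combine with
4ρ²/(r²+ρ²)² into the spherical density (r²+ρ²)^(-N) up to a constant; the result is the integrand
of `HasShellBound`. -/
lemma norm_cutoffError_le {N : ℕ} {ρ : ℝ} (hρ : 0 < ρ) {u : EuclideanSpace ℝ (Fin N) → ℂ}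
    {s t : EuclideanSpace ℝ (Fin N) → ℝ} {x : EuclideanSpace ℝ (Fin N)} {g g' : Fin N → ℝ}
    {L L' : ℝ} (hs : IsZonalAt ρ s x g L) (ht : IsZonalAt ρ t x g' L') {f0 f1 : ℂ} {B η C K : ℝ}
    (hB : 0 ≤ B) (hf0 : ‖f0‖ ≤ B) (hf1 : ‖f1‖ ≤ B) (ht0 : 0 < t x) (ht1 : t x < 1)
    (hs01 : s x ∈ Set.Icc (0 : ℝ) 1) {χ : ℝ → ℝ} (hK : 0 < K)
    (hχ : |t x * (1 - t x) * deriv (deriv χ) (t x) + N / 2 * (1 - 2 * t x) * deriv χ (t x)| +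
          2 * Real.sqrt (t x) * |deriv χ (t x)| ≤
        C * t x ^ (-((N : ℝ) / 2)) / (zonalSing N (t x) * K))
    (hu : ‖u x‖ ≤ η * (zonalSing N (t x) * fishFactor ρ x)) :
    ‖cutoffError ρ u f0 f1 g g' χ (t x) x‖ ≤
      4 * ρ ^ 2 * B * C * η / K * (t x ^ (-((N : ℝ) / 2)) * fishDen ρ x ^ (-(N : ℝ))) := by
  have hA := fishDen_pos hρ x
  have hm := fishFactor_pos hρ x
  have hS := zonalSing_pos N ht0 ht1
  set Q := 4 * ρ ^ 2 / fishDen ρ x ^ 2 with hQ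
  have hQ0 : 0 < Q := by positivity
  have hcs : |∑ i, g' i * g i| ≤ Q * Real.sqrt (t x) := by
    have h1 := Finset.sum_mul_sq_le_sq_mul_sq Finset.univ g' g
    rw [hs.grad_sq, ht.grad_sq, ← hQ] at h1
    refine abs_le_of_sq_le_sq (h1.trans ?_) (by positivity)
    rw [mul_pow, Real.sq_sqrt ht0.le]
    have h2 : s x * (1 - s x) ≤ 1 := by nlinarith [hs01.1, hs01.2]
    have h3 : 0 ≤ s x * (1 - s x) := mul_nonneg hs01.1 (by linarith [hs01.2])
    have h4 : t x * (1 - t x) ≤ t x := by nlinarith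
    calc Q * (t x * (1 - t x)) * (Q * (s x * (1 - s x))) =
        Q ^ 2 * (t x * (1 - t x)) * (s x * (1 - s x)) := by ring
      _ ≤ Q ^ 2 * t x * 1 := by gcongr
      _ = _ := by ring
  set X := t x * (1 - t x) * deriv (deriv χ) (t x) + N / 2 * (1 - 2 * t x) * deriv χ (t x) with hX
  set Y := deriv χ (t x) with hY
  have e1 : ‖f0 * ((Q * X : ℝ) : ℂ) + 2 * (((∑ i, g' i * g i : ℝ) : ℂ) * Y * f1)‖ ≤
      B * Q * (|X| + 2 * Real.sqrt (t x) * |Y|) := by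
    refine (norm_add_le _ _).trans ?_
    rw [norm_mul, norm_mul, norm_mul, norm_mul, Complex.norm_real, Complex.norm_real,
      Complex.norm_real, Real.norm_eq_abs, Real.norm_eq_abs, Real.norm_eq_abs, abs_mul,
      abs_of_pos hQ0, Complex.norm_two]
    have h1 : ‖f0‖ * (Q * |X|) ≤ B * (Q * |X|) := by gcongr
    have h2 : |∑ i, g' i * g i| * |Y| * ‖f1‖ ≤ Q * Real.sqrt (t x) * |Y| * B := by gcongr
    linarith
  have e2 : fishFactor ρ x * fishFactor ρ x * Q = 4 * ρ ^ 2 * fishDen ρ x ^ (-(N : ℝ)) := by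
    rw [hQ, fishFactor, ← Real.rpow_add hA, mul_div_assoc', mul_comm, mul_div_assoc]
    congr 1
    rw [← Real.rpow_natCast (fishDen ρ x) 2, ← Real.rpow_sub hA]
    congr 1
    push_cast
    ring
  unfold cutoffError
  rw [norm_mul, norm_mul, Complex.norm_real, Real.norm_of_nonneg hm.le]
  calc _ ≤ (η * (zonalSing N (t x) * fishFactor ρ x)) * (fishFactor ρ x *
        (B * Q * (C * t x ^ (-((N : ℝ) / 2)) / (zonalSing N (t x) * K)))) := by
        have h0 := (norm_nonneg _).trans hu
        gcongr
        exact e1.trans (by gcongr)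
    _ = (fishFactor ρ x * fishFactor ρ x * Q) * (η * B * C * t x ^ (-((N : ℝ) / 2)) / K) := by
        field_simp
    _ = _ := by rw [e2]; ring

lemma deriv_ofReal_comp {χ : ℝ → ℝ} (hχ : ContDiff ℝ 2 χ) :
    (deriv fun τ => (χ τ : ℂ)) = (fun τ => ((deriv χ τ : ℝ) : ℂ)) ∧
    (deriv (deriv fun τ => (χ τ : ℂ))) = (fun τ => ((deriv (deriv χ) τ : ℝ) : ℂ)) := by
  have h1 : (deriv fun τ => (χ τ : ℂ)) = (fun τ => ((deriv χ τ : ℝ) : ℂ)) := by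
    funext τ
    exact ((hχ.differentiable (by norm_num) τ).hasDerivAt.ofReal_comp).deriv
  refine ⟨h1, ?_⟩
  rw [h1]
  funext τ
  have hk1 : ContDiff ℝ 1 (deriv χ) :=
    (contDiff_succ_iff_deriv (n := 1)).1 (by simpa [one_add_one_eq_two] using hχ) |>.2.2
  exact ((hk1.differentiable (by norm_num) τ).hasDerivAt.ofReal_comp).deriv

lemma IsZonalAt.hasLaplacianData_cutoff {N : ℕ} {ρ : ℝ} {t : EuclideanSpace ℝ (Fin N) → ℝ}
    {x : EuclideanSpace ℝ (Fin N)} {g : Fin N → ℝ} {L : ℝ} (ht : IsZonalAt ρ t x g L)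
    {χ : ℝ → ℝ} (hχ : ContDiff ℝ 2 χ) :
    HasLaplacianData (fun y => (χ (t y) : ℂ)) x (fun i => ((g i * deriv χ (t x) : ℝ) : ℂ))
      (((∑ i, g i ^ 2) * deriv (deriv χ) (t x) + L * deriv χ (t x) : ℝ) : ℂ) := by
  have h := ht.data.comp_real (φ := fun τ => (χ τ : ℂ))
    (Complex.ofRealCLM.contDiff.contDiffAt.comp _ hχ.contDiffAt)
  obtain ⟨h1, h2⟩ := deriv_ofReal_comp hχ
  rw [h2, h1] at h
  refine h.congr (fun i => ?_) ?_
  · simp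
  · simp

/-- The fish-eye operator applied to a zonal function cut off near two points. -/
lemma fishEye_operator_cutoff {N : ℕ} {ρ : ℝ} (hρ : 0 < ρ) {x : EuclideanSpace ℝ (Fin N)}
    {s t t' : EuclideanSpace ℝ (Fin N) → ℝ} {g h h' : Fin N → ℝ} {L M M' : ℝ}
    (hs : IsZonalAt ρ s x g L) (ht : IsZonalAt ρ t x h M) (ht' : IsZonalAt ρ t' x h' M')
    {f : ℝ → ℂ} (hf : ContDiffAt ℝ 2 f (s x)) {χ : ℝ → ℝ} (hχ : ContDiff ℝ 2 χ) (lam : ℂ)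
    (u : EuclideanSpace ℝ (Fin N) → ℂ) :
    u x * (Laplacian.laplacian (fun y => (fishFactor ρ y : ℂ) *
        (((χ (t y) : ℂ) + ((χ (t' y) : ℂ) + -1)) * f (s y))) x +
      4 * lam * (ρ : ℂ) ^ 2 / ((fishDen ρ x ^ 2 : ℝ) : ℂ) * ((fishFactor ρ x : ℂ) *
        (((χ (t x) : ℂ) + ((χ (t' x) : ℂ) + -1)) * f (s x)))) =
    u x * (fishFactor ρ x * (4 * (ρ : ℂ) ^ 2 / (fishDen ρ x : ℂ) ^ 2 *
      (((χ (t x) : ℂ) + ((χ (t' x) : ℂ) + -1)) *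
      zonalOp N lam (f (s x)) (deriv f (s x)) (deriv (deriv f) (s x)) (s x)))) +
    (cutoffError ρ u (f (s x)) (deriv f (s x)) g h χ (t x) x +
      cutoffError ρ u (f (s x)) (deriv f (s x)) g h' χ (t' x) x) := by
  have hF := hs.data.comp_real hf
  have hX := (ht.hasLaplacianData_cutoff hχ).add ((ht'.hasLaplacianData_cutoff hχ).add
    (hasLaplacianData_const (-1 : ℂ) x))
  rw [fishEye_operator hρ (hX.mul hF) lam]
  have s1 := congrArg (fun z : ℝ => (z : ℂ)) hs.grad_sq
  have s2 := congrArg (fun z : ℝ => (z : ℂ)) hs.laplacian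
  have t1 := congrArg (fun z : ℝ => (z : ℂ)) ht.grad_sq
  have t2 := congrArg (fun z : ℝ => (z : ℂ)) ht.laplacian
  have u1 := congrArg (fun z : ℝ => (z : ℂ)) ht'.grad_sq
  have u2 := congrArg (fun z : ℝ => (z : ℂ)) ht'.laplacian
  simp only [Complex.real_smul, add_zero]
  have e1 : ∑ i, (x i : ℂ) * (((χ (t x) : ℂ) + ((χ (t' x) : ℂ) + -1)) *
        ((g i : ℂ) * deriv f (s x)) + f (s x) * (((h i * deriv χ (t x) : ℝ) : ℂ) +
        ((h' i * deriv χ (t' x) : ℝ) : ℂ))) =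
      ((χ (t x) : ℂ) + ((χ (t' x) : ℂ) + -1)) * deriv f (s x) * ((∑ i, x i * g i : ℝ) : ℂ) +
      f (s x) * (((deriv χ (t x) : ℝ) : ℂ) * ((∑ i, x i * h i : ℝ) : ℂ) +
        ((deriv χ (t' x) : ℝ) : ℂ) * ((∑ i, x i * h' i : ℝ) : ℂ)) := by
    push_cast
    simp only [Finset.mul_sum, ← Finset.sum_add_distrib]
    exact Finset.sum_congr rfl fun i _ => by ring
  have e2 : ∑ i, (((h i * deriv χ (t x) : ℝ) : ℂ) + ((h' i * deriv χ (t' x) : ℝ) : ℂ)) *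
        ((g i : ℂ) * deriv f (s x)) = ((∑ i, h i * g i : ℝ) : ℂ) * ((deriv χ (t x) : ℝ) : ℂ) * deriv f (s x) +
        ((∑ i, h' i * g i : ℝ) : ℂ) * ((deriv χ (t' x) : ℝ) : ℂ) * deriv f (s x) := by
    push_cast
    simp only [Finset.sum_mul, ← Finset.sum_add_distrib]
    exact Finset.sum_congr rfl fun i _ => by ring
  rw [e1, e2]
  unfold zonalOp cutoffError
  push_cast at s1 s2 t1 t2 u1 u2 ⊢
  generalize ∑ i, (x i : ℂ) * (g i : ℂ) = Sg at *
  generalize ∑ i, (x i : ℂ) * (h i : ℂ) = Sh at *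
  generalize ∑ i, (x i : ℂ) * (h' i : ℂ) = Sh' at *
  generalize ∑ i, (g i : ℂ) ^ 2 = Gg at *
  generalize ∑ i, (h i : ℂ) ^ 2 = Gh at *
  generalize ∑ i, (h' i : ℂ) ^ 2 = Gh' at *
  generalize ∑ i, (h i : ℂ) * (g i : ℂ) = Ghg at *
  generalize ∑ i, (h' i : ℂ) * (g i : ℂ) = Ghg' at *
  -- Besides the cut-off zonal operator only commutator terms survive. A sum of two cutoffs, rather
  -- than a product, leaves no cross term between them.
  linear_combination (u x * fishFactor ρ x) *
    (((χ (t x) : ℂ) + ((χ (t' x) : ℂ) + -1)) * (deriv (deriv f) (s x) * s1 + deriv f (s x) * s2) +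
      f (s x) * (((deriv (deriv χ) (t x) : ℝ) : ℂ) * t1 + ((deriv χ (t x) : ℝ) : ℂ) * t2 +
        ((deriv (deriv χ) (t' x) : ℝ) : ℂ) * u1 + ((deriv χ (t' x) : ℝ) : ℂ) * u2))

lemma tsupport_subset_of_eq_zero {X : Type*} [TopologicalSpace X] {f : X → ℂ} {U : Set X}
    (hU : IsOpen U) (h : ∀ x ∈ U, f x = 0) : tsupport f ⊆ Uᶜ :=
  closure_minimal (fun _ hx hxU => hx (h _ hxU)) hU.isClosed_compl

open MeasureTheory in
/-- A solution of the fish-eye equation off `r'` is orthogonal to the image under the fish-eye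
operator of zonal functions, provided the singularities are negligible. -/
lemma integral_zonalOp_eq_zero {N : ℕ} (hN : 2 ≤ N) {ρ : ℝ} (hρ : 0 < ρ) {lam : ℂ}
    {r' p : EuclideanSpace ℝ (Fin N)} {u : EuclideanSpace ℝ (Fin N) → ℂ}
    (hu : ContDiffOn ℝ 2 u {r'}ᶜ)
    (heq : ∀ r, r ≠ r' → Laplacian.laplacian u r +
      4 * lam * (ρ : ℂ) ^ 2 / ((fishDen ρ r ^ 2 : ℝ) : ℂ) * u r = 0)
    {f : ℝ → ℂ} (hf : ∀ σ ∈ Set.Icc (0 : ℝ) 1, ContDiffAt ℝ 2 f σ)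
    (hneg : IsNegligible ρ (fun x => f (fishSin ρ p x)) u (fishSin ρ r'))
    (hneg' : IsNegligible ρ (fun x => f (fishSin ρ p x)) u (fishSinInfty ρ))
    (hsupp : ∃ ε : ℝ, 0 < ε ∧ ∀ x, fishSin ρ r' x < ε ∨ fishSinInfty ρ x < ε →
      zonalOp N lam (f (fishSin ρ p x)) (deriv f (fishSin ρ p x))
        (deriv (deriv f) (fishSin ρ p x)) (fishSin ρ p x) = 0) :
    ∫ x, u x * (fishFactor ρ x * (4 * (ρ : ℂ) ^ 2 / (fishDen ρ x : ℂ) ^ 2 *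
      zonalOp N lam (f (fishSin ρ p x)) (deriv f (fishSin ρ p x))
        (deriv (deriv f) (fishSin ρ p x)) (fishSin ρ p x))) = 0 := by
  obtain ⟨ε₁, hε₁, hsupp⟩ := hsupp
  obtain ⟨ε₂, hε₂, hsep⟩ := exists_fishSin_lt_le_fishSinInfty hρ r'
  obtain ⟨C₁, hC₁, δ₁, hδ₁, hsh1⟩ := hasShellBound_fishSin hN hρ r'
  obtain ⟨C₂, hC₂, δ₂, hδ₂, hsh2⟩ :=
    hasShellBound_fishSinInfty hN hρ (N := N)
  obtain ⟨C, hC, hcut⟩ := exists_log_cutoff N hN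
  have hs01 : ∀ x, fishSin ρ p x ∈ Set.Icc (0 : ℝ) 1 := fun x =>
    ⟨fishSin_nonneg hρ p x, fishSin_le_one hρ p x⟩
  have hfs : ∀ x, ContDiffAt ℝ 2 f (fishSin ρ p x) := fun x => hf _ (hs01 x)
  have hsc : Continuous (fishSin ρ p) := (contDiff_fishSin hρ p).continuous
  have ht1c : Continuous (fishSin ρ r') := (contDiff_fishSin hρ r').continuous
  have ht2c : Continuous (fishSinInfty ρ : EuclideanSpace ℝ (Fin N) → ℝ) :=
    (contDiff_fishSinInfty hρ).continuous
  have hF0 : Continuous fun x => f (fishSin ρ p x) := continuous_iff_continuousAt.2 fun x =>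
    (hfs x).continuousAt.comp hsc.continuousAt
  have hF1 : Continuous fun x => deriv f (fishSin ρ p x) := continuous_iff_continuousAt.2 fun x =>
    ContinuousAt.comp (g := deriv f) (hfs x).continuousAt_deriv_two.1 hsc.continuousAt
  have hF2 : Continuous fun x => deriv (deriv f) (fishSin ρ p x) :=
    continuous_iff_continuousAt.2 fun x =>
      ContinuousAt.comp (g := deriv (deriv f)) (hfs x).continuousAt_deriv_two.2 hsc.continuousAt
  obtain ⟨B, hB, hB0, hB1⟩ : ∃ B : ℝ, 0 ≤ B ∧ (∀ σ ∈ Set.Icc (0 : ℝ) 1, ‖f σ‖ ≤ B) ∧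
      ∀ σ ∈ Set.Icc (0 : ℝ) 1, ‖deriv f σ‖ ≤ B := by
    obtain ⟨b0, h0⟩ := isCompact_Icc.exists_bound_of_continuousOn (s := Set.Icc (0 : ℝ) 1) (f := f)
      fun σ hσ => (hf σ hσ).continuousAt.continuousWithinAt
    obtain ⟨b1, h1⟩ := isCompact_Icc.exists_bound_of_continuousOn (s := Set.Icc (0 : ℝ) 1)
      (f := deriv f) fun σ hσ => (hf σ hσ).continuousAt_deriv_two.1.continuousWithinAt
    exact ⟨|b0| + |b1|, by positivity,
      fun σ hσ => (h0 σ hσ).trans (by linarith [le_abs_self b0, abs_nonneg b1]),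
      fun σ hσ => (h1 σ hσ).trans (by linarith [le_abs_self b1, abs_nonneg b0])⟩
  set Z : EuclideanSpace ℝ (Fin N) → ℂ := fun x => zonalOp N lam (f (fishSin ρ p x))
    (deriv f (fishSin ρ p x)) (deriv (deriv f) (fishSin ρ p x)) (fishSin ρ p x) with hZ
  have hZc : Continuous Z := by
    have hsC : Continuous fun x => ((fishSin ρ p x : ℝ) : ℂ) := Complex.continuous_ofReal.comp hsc
    exact (((hsC.mul (continuous_const.sub hsC)).mul hF2).add ((continuous_const.mul
      (continuous_const.sub (continuous_const.mul hsC))).mul hF1)).add (continuous_const.mul hF0)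
  set pot : EuclideanSpace ℝ (Fin N) → ℂ := fun x =>
    4 * lam * (ρ : ℂ) ^ 2 / ((fishDen ρ x ^ 2 : ℝ) : ℂ) with hpot
  have hdenc : Continuous fun x : EuclideanSpace ℝ (Fin N) => ((fishDen ρ x : ℝ) : ℂ) :=
    Complex.continuous_ofReal.comp (continuous_fishDen ρ)
  have hden0 : ∀ x : EuclideanSpace ℝ (Fin N), ((fishDen ρ x : ℝ) : ℂ) ≠ 0 := fun x => by
    exact_mod_cast (fishDen_pos hρ x).ne'
  have hpotc : Continuous pot := by
    simp only [hpot, Complex.ofReal_pow]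
    exact continuous_const.div (hdenc.pow 2) fun x => pow_ne_zero 2 (hden0 x)
  have hmc : Continuous fun x : EuclideanSpace ℝ (Fin N) => (fishFactor ρ x : ℂ) :=
    (contDiff_fishFactor hρ).continuous
  have huc : ∀ x, x ≠ r' → ContinuousAt u x := fun x hx =>
    (hu.continuousOn).continuousAt (isOpen_compl_singleton.mem_nhds hx)
  set a : EuclideanSpace ℝ (Fin N) → ℂ := fun x =>
    u x * (fishFactor ρ x * (4 * (ρ : ℂ) ^ 2 / (fishDen ρ x : ℂ) ^ 2 * Z x)) with ha
  have hcomp : ∀ (G : EuclideanSpace ℝ (Fin N) → ℂ) (ε : ℝ), 0 < ε →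
      (∀ x, fishSinInfty ρ x < ε → G x = 0) → HasCompactSupport G := by
    intro G ε hε hG
    obtain ⟨R, hR⟩ := exists_fishSinInfty_lt (N := N) hρ hε
    refine HasCompactSupport.intro (isCompact_closedBall 0 R) fun x hx => hG x (hR x ?_)
    simpa using hx
  have hcontu : ∀ (G : EuclideanSpace ℝ (Fin N) → ℂ) (ε : ℝ), 0 < ε → Continuous G →
      (∀ x, fishSin ρ r' x < ε ∨ fishSinInfty ρ x < ε → G x = 0) →
      Integrable (fun x => u x * G x) := by
    intro G ε hε hGc hG
    refine Continuous.integrable_of_hasCompactSupport (continuous_iff_continuousAt.2 fun x => ?_)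
      (hcomp _ ε hε fun x hx => by simp [hG x (Or.inr hx)])
    by_cases hx : x = r'
    · have h0 : ∀ᶠ y in 𝓝 x, u y * G y = 0 := by
        have : ∀ᶠ y in 𝓝 x, fishSin ρ r' y < ε :=
          ht1c.continuousAt.eventually (gt_mem_nhds (by rw [hx, fishSin_self]; exact hε))
        exact this.mono fun y hy => by simp [hG y (Or.inl hy)]
      exact (continuousAt_const (y := (0 : ℂ))).congr (h0.mono fun y hy => hy.symm)
    · exact (huc x hx).mul hGc.continuousAt
  have haint : Integrable a := by
    refine hcontu (fun x => fishFactor ρ x * (4 * (ρ : ℂ) ^ 2 / (fishDen ρ x : ℂ) ^ 2 * Z x)) ε₁ hε₁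
      ?_ fun x hx => by simp [hZ, hsupp x hx]
    exact hmc.mul ((continuous_const.div (hdenc.pow 2) fun x => pow_ne_zero 2 (hden0 x)).mul hZc)
  choose gs Ls hgs using exists_isZonalAt_fishSin hρ p
  choose g1 L1 hg1 using exists_isZonalAt_fishSin hρ r'
  choose g2 L2 hg2 using exists_isZonalAt_fishSinInfty (N := N) hρ
  -- The constant does not involve the cutoff scale ε, so letting η tend to 0 makes the integral
  -- vanish.
  have key : ∀ η : ℝ, 0 < η → ‖∫ x, a x‖ ≤ 4 * ρ ^ 2 * B * C * (C₁ + C₂) * η := by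
    intro η hη
    obtain ⟨δ₃, hδ₃, hn1⟩ := hneg η hη
    obtain ⟨δ₄, hδ₄, hn2⟩ := hneg' η hη
    obtain ⟨ε, hε, hεlt⟩ := exists_between (show (0 : ℝ) <
      min (min (min ε₁ ε₂) (min δ₁ δ₂)) (min (min δ₃ δ₄) (1 / 2)) by positivity)
    simp only [lt_min_iff] at hεlt
    obtain ⟨⟨⟨l1, l2⟩, l3, l4⟩, ⟨l5, l6⟩, l7⟩ := hεlt
    obtain ⟨χ, hχcd, hχ0, hχ1, hχd, hχb⟩ := hcut ε hε l7.le
    obtain ⟨b1, hb1i, hb1n, hb1l, hb1⟩ := hsh1 ε hε l3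
    obtain ⟨b2, hb2i, hb2n, hb2l, hb2⟩ := hsh2 ε hε l4
    set L := Real.log (1 / ε) with hL
    have hL0 : 0 < L := Real.log_pos (by rw [lt_div_iff₀ hε]; linarith)
    have hεsq : ε ^ 2 < ε := by nlinarith
    have hεsq0 : 0 < ε ^ 2 := by positivity
    -- The two cutoff regions are disjoint for small ε, so this is 0 near r' and near infinity and 1
    -- away from both.
    set X : EuclideanSpace ℝ (Fin N) → ℂ := fun x =>
      (χ (fishSin ρ r' x) : ℂ) + ((χ (fishSinInfty ρ x) : ℂ) + -1) with hX
    set W : EuclideanSpace ℝ (Fin N) → ℂ := fun x =>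
      (fishFactor ρ x : ℂ) * (X x * f (fishSin ρ p x)) with hW
    have hX0 : ∀ x, fishSin ρ r' x < ε ^ 2 ∨ fishSinInfty ρ x < ε ^ 2 → X x = 0 := by
      intro x hx
      rcases hx with hx | hx
      · have h2 : ε ≤ fishSinInfty ρ x := l2.le.trans (hsep x (by linarith))
        simp [hX, hχ0 _ hx.le, hχ1 _ h2]
      · have h2 : ε ≤ fishSin ρ r' x := by
          by_contra hcon
          push Not at hcon
          have := hsep x (hcon.trans l2)
          linarith
        simp [hX, hχ0 _ hx.le, hχ1 _ h2]
    have hXcd : ContDiff ℝ 2 X := by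
      have h1 : ∀ t : EuclideanSpace ℝ (Fin N) → ℝ, ContDiff ℝ 2 t →
          ContDiff ℝ 2 fun x => (χ (t x) : ℂ) := fun t ht =>
        Complex.ofRealCLM.contDiff.comp (hχcd.comp ht)
      exact (h1 _ (contDiff_fishSin hρ r')).add
        ((h1 _ (contDiff_fishSinInfty hρ)).add contDiff_const)
    have hWcd : ContDiff ℝ 2 W := (contDiff_fishFactor hρ).mul (hXcd.mul
      (contDiff_iff_contDiffAt.2 fun x => (hfs x).comp x (contDiff_fishSin hρ p).contDiffAt))
    have hWc : HasCompactSupport W :=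
      hcomp W (ε ^ 2) hεsq0 fun x hx => by simp [hW, hX0 x (Or.inr hx)]
    have hWs : tsupport W ⊆ {r'}ᶜ := by
      refine (tsupport_subset_of_eq_zero (U := {x | fishSin ρ r' x < ε ^ 2})
        (isOpen_lt ht1c continuous_const) fun x hx => by simp [hW, hX0 x (Or.inl hx)]).trans ?_
      refine Set.compl_subset_compl.2 (Set.singleton_subset_iff.2 ?_)
      change fishSin ρ r' r' < ε ^ 2
      rw [fishSin_self]; exact hεsq0
    obtain ⟨hi1, hgreen⟩ := integral_mul_laplacian isOpen_compl_singleton hu hWcd hWc hWs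
    have hi2 : Integrable (fun x => u x * (pot x * W x)) :=
      hcontu _ (ε ^ 2) hεsq0 (hpotc.mul hWcd.continuous) fun x hx => by simp [hW, hX0 x hx]
    have htot : ∫ x, u x * (Laplacian.laplacian W x + pot x * W x) = 0 := by
      simp only [mul_add]
      rw [integral_add hi1 hi2, hgreen]
      have : ∀ x, Laplacian.laplacian u x * W x = -(u x * (pot x * W x)) := by
        intro x
        by_cases hx : x = r'
        · have : W x = 0 := by
            simp [hW, hX0 x (Or.inl (by rw [hx, fishSin_self]; exact hεsq0))]
          simp [this]
        · linear_combination (heq x hx) * W x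
      simp only [this]
      rw [integral_neg, neg_add_cancel]
    set e : EuclideanSpace ℝ (Fin N) → ℂ := fun x =>
      cutoffError ρ u (f (fishSin ρ p x)) (deriv f (fishSin ρ p x)) (gs x) (g1 x) χ
        (fishSin ρ r' x) x +
      cutoffError ρ u (f (fishSin ρ p x)) (deriv f (fishSin ρ p x)) (gs x) (g2 x) χ
        (fishSinInfty ρ x) x with he
    have hsplit : ∀ x, u x * (Laplacian.laplacian W x + pot x * W x) = a x + e x := by
      intro x
      have h1 := fishEye_operator_cutoff hρ (hgs x) (hg1 x) (hg2 x) (hfs x) hχcd lam u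
      -- The density Z already vanishes at scale ε₁ around r' and infinity, and ε < ε₁, so the
      -- cutoff leaves it unchanged.
      have h2 : X x * Z x = Z x := by
        by_cases hx : fishSin ρ r' x < ε₁ ∨ fishSinInfty ρ x < ε₁
        · have : Z x = 0 := hsupp x hx
          rw [this, mul_zero]
        · push Not at hx
          simp [hX, hχ1 _ (l1.le.trans hx.1), hχ1 _ (l1.le.trans hx.2)]
      rw [show a x = u x * (fishFactor ρ x * (4 * (ρ : ℂ) ^ 2 / (fishDen ρ x : ℂ) ^ 2 *
        (X x * Z x))) by rw [h2]]
      exact h1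
    have hae : ∫ x, a x = -∫ x, e x := by
      have hei : Integrable e := by
        have : e = fun x => u x * (Laplacian.laplacian W x + pot x * W x) - a x := by
          funext x; rw [hsplit]; ring
        rw [this]
        refine Integrable.sub ?_ haint
        simp only [mul_add]
        exact hi1.add hi2
      have : ∫ x, (a x + e x) = 0 := by rw [← htot]; exact integral_congr_ae (by simp [hsplit])
      rw [integral_add haint hei] at this
      exact eq_neg_of_add_eq_zero_left this
    -- The 1/L here cancels the logarithmic mass of the shells, leaving a multiple of η.
    set M := 4 * ρ ^ 2 * B * C * η / L with hM
    have hM0 : 0 ≤ M := by positivity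
    have hbd : ∀ (t : EuclideanSpace ℝ (Fin N) → ℝ) (g : EuclideanSpace ℝ (Fin N) → Fin N → ℝ)
        (L' : EuclideanSpace ℝ (Fin N) → ℝ) (b : EuclideanSpace ℝ (Fin N) → ℝ) (δ : ℝ),
        (∀ x, IsZonalAt ρ t x (g x) (L' x)) → (∀ x, 0 ≤ b x) → ε < δ →
        (∀ x, 0 < t x → t x < δ → (fun x => f (fishSin ρ p x)) =ᶠ[𝓝 x] 0 ∨
          ‖u x‖ ≤ η * (zonalSing N (t x) * fishFactor ρ x)) →
        (∀ x, ε ^ 2 ≤ t x → t x ≤ ε → t x ^ (-((N : ℝ) / 2)) * fishDen ρ x ^ (-(N : ℝ)) ≤ b x) →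
        ∀ x, ‖cutoffError ρ u (f (fishSin ρ p x)) (deriv f (fishSin ρ p x)) (gs x) (g x) χ
          (t x) x‖ ≤ M * b x := by
      intro t g L' b δ hz hbn hεδ hn hb x
      by_cases hx : ε ^ 2 ≤ t x ∧ t x ≤ ε
      · have ht0 : 0 < t x := hεsq0.trans_le hx.1
        rcases hn x ht0 (hx.2.trans_lt hεδ) with h0 | h0
        -- If the test function vanishes near x, then so do its value and its gradient. The
        -- derivative f' may be nonzero where the gradient of s vanishes, but it enters only
        -- multiplied by that gradient.
        · have e0 : f (fishSin ρ p x) = 0 := h0.self_of_nhds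
          have e1 : (∑ i, g x i * gs x i : ℝ) * deriv f (fishSin ρ p x) = 0 := by
            have h3 := (hgs x).data.comp_real (hfs x)
            have h4 : ∀ i, gs x i • deriv f (fishSin ρ p x) = 0 := by
              intro i
              rw [← h3.partial_eq i, h0.fderiv_eq]
              simp [Pi.zero_def]
            push_cast
            rw [Finset.sum_mul]
            refine Finset.sum_eq_zero fun i _ => ?_
            have := h4 i
            rw [Complex.real_smul] at this
            rw [mul_assoc, this, mul_zero]
          have e2 : cutoffError ρ u (f (fishSin ρ p x)) (deriv f (fishSin ρ p x)) (gs x) (g x) χ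
              (t x) x = 0 := by
            unfold cutoffError
            rw [e0, mul_right_comm _ _ (deriv f (fishSin ρ p x)), e1]
            simp
          rw [e2, norm_zero]
          exact mul_nonneg hM0 (hbn x)
        · refine (norm_cutoffError_le hρ (hgs x) (hz x) hB (hB0 _ (hs01 x)) (hB1 _ (hs01 x)) ht0
            (by linarith [hx.2]) (hs01 x) hL0 (hχb (t x) ht0 (by linarith [hx.2])) h0).trans ?_
          exact mul_le_mul_of_nonneg_left (hb x hx.1 hx.2) hM0
      · have h2 : t x < ε ^ 2 ∨ ε < t x := by
          by_contra hcon; push Not at hcon; exact hx hcon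
        obtain ⟨d1, d2⟩ := hχd _ h2
        have e2 : cutoffError ρ u (f (fishSin ρ p x)) (deriv f (fishSin ρ p x)) (gs x) (g x) χ
            (t x) x = 0 := by
          unfold cutoffError
          rw [d1, d2]
          simp
        rw [e2, norm_zero]
        exact mul_nonneg hM0 (hbn x)
    have hE1 := hbd _ g1 L1 b1 δ₃ hg1 hb1n l5 hn1 hb1
    have hE2 := hbd _ g2 L2 b2 δ₄ hg2 hb2n l6 hn2 hb2
    rw [hae, norm_neg]
    calc ‖∫ x, e x‖ ≤ ∫ x, (M * b1 x + M * b2 x) :=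
          norm_integral_le_of_norm_le ((hb1i.const_mul M).add (hb2i.const_mul M))
            (Eventually.of_forall fun x => (norm_add_le _ _).trans (add_le_add (hE1 x) (hE2 x)))
      _ = M * (∫ x, b1 x) + M * ∫ x, b2 x := by
          rw [integral_add (hb1i.const_mul M) (hb2i.const_mul M), integral_const_mul,
            integral_const_mul]
      _ ≤ M * (C₁ * L) + M * (C₂ * L) := by gcongr
      _ = _ := by rw [hM]; field_simp
  have hK : 0 ≤ 4 * ρ ^ 2 * B * C * (C₁ + C₂) := by positivity
  have hle : ‖∫ x, a x‖ ≤ 0 := by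
    refine le_of_forall_pos_le_add fun η hη => ?_
    have h1 := key (η / (4 * ρ ^ 2 * B * C * (C₁ + C₂) + 1)) (by positivity)
    refine h1.trans ?_
    rw [zero_add, mul_div_assoc', div_le_iff₀ (by positivity)]
    nlinarith
  exact norm_le_zero_iff.1 hle

/-! ### Zonal test functions and constancy of zonal means -/

/-- A zonal test function whose image under the zonal operator is a prescribed density. -/
lemma exists_zonal_test {N : ℕ} {lam : ℂ} {g : ℝ → ℂ} (hg : ∀ σ ∈ Set.Ioc (0 : ℝ) 1, ContDiffAt ℝ 2 g σ)
    (hgo : ∀ σ ∈ Set.Ioc (0 : ℝ) 1, zonalOp N lam (g σ) (deriv g σ) (deriv (deriv g) σ) σ = 0)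
    {α δ : ℝ} (hα : 0 < α) (hδ : δ < 1) (hg0 : ∀ σ ∈ Set.Icc α δ, g σ ≠ 0) {β : ℝ → ℝ}
    (hβ : Continuous β) (hβ0 : ∀ s, s ∉ Set.Ioo α δ → β s = 0) (hβi : ∫ s in α..δ, β s = 0) :
    ∃ f : ℝ → ℂ, (∀ σ ∈ Set.Icc (0 : ℝ) 1, ContDiffAt ℝ 2 f σ) ∧ (∀ σ, σ < α → f σ = 0) ∧
      ∀ σ ∈ Set.Icc (0 : ℝ) 1, zonalOp N lam (f σ) (deriv f σ) (deriv (deriv f) σ) σ =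
        (g σ)⁻¹ * (((σ * (1 - σ)) ^ (1 - (N : ℝ) / 2) * β σ : ℝ) : ℂ) := by
  -- Reduction of order: with f = g h and q = (s(1-s))^(N/2), the operator takes f to g⁻¹
  -- (s(1-s))^(1-N/2) (q g² h')'. Hence q g² h' must be the primitive H of β. As β has integral 0, H
  -- vanishes outside [α, δ].
  set H : ℝ → ℝ := fun s => ∫ t in α..s, β t with hH
  have hHd : ∀ s, HasDerivAt H (β s) s := fun s =>
    intervalIntegral.integral_hasDerivAt_right (hβ.intervalIntegrable _ _)
      (hβ.stronglyMeasurableAtFilter _ _) hβ.continuousAt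
  have hHa : ∀ s, s ≤ α → H s = 0 := fun s hs => by
    simp only [hH]
    rw [intervalIntegral.integral_congr (g := fun _ => (0 : ℝ)), intervalIntegral.integral_zero]
    intro t ht
    rw [Set.uIcc_of_ge hs] at ht
    exact hβ0 t fun h => absurd h.1 (not_lt.2 ht.2)
  have hHb : ∀ s, δ ≤ s → H s = 0 := fun s hs => by
    simp only [hH]
    rw [← intervalIntegral.integral_add_adjacent_intervals (hβ.intervalIntegrable α δ)
      (hβ.intervalIntegrable δ s), hβi, zero_add,
      intervalIntegral.integral_congr (g := fun _ => (0 : ℝ)), intervalIntegral.integral_zero]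
    intro t ht
    rw [Set.uIcc_of_le hs] at ht
    exact hβ0 t fun h => absurd h.2 (not_lt.2 ht.1)
  have hHc : ContDiff ℝ 1 fun s => (H s : ℂ) := by
    have : ContDiff ℝ 1 H := contDiff_one_iff_deriv.2
      ⟨fun s => (hHd s).differentiableAt, by
        rw [show deriv H = β from funext fun s => (hHd s).deriv]; exact hβ⟩
    exact Complex.ofRealCLM.contDiff.comp this
  set c : ℝ := (N : ℝ) / 2 with hc
  set q : ℝ → ℝ := fun s => (s * (1 - s)) ^ c with hq
  have hpos : ∀ s : ℝ, 0 < s → s < 1 → 0 < s * (1 - s) := fun s h0 h1 => mul_pos h0 (by linarith)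
  have hqd : ∀ s : ℝ, 0 < s → s < 1 →
      HasDerivAt q ((s * (1 - s)) ^ (c - 1) * (c * (1 - 2 * s))) s := fun s h0 h1 => by
    have h2 : HasDerivAt (fun s : ℝ => s * (1 - s)) (1 - 2 * s) s := by
      have := (hasDerivAt_id s).mul ((hasDerivAt_id s).const_sub 1)
      exact this.congr_deriv (by simp; ring)
    exact (h2.rpow_const (p := c) (Or.inl (hpos s h0 h1).ne')).congr_deriv (by ring)
  have hqc : ∀ s : ℝ, 0 < s → s < 1 → ContDiffAt ℝ 1 (fun s => (q s : ℂ)) s := fun s h0 h1 => by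
    refine Complex.ofRealCLM.contDiff.contDiffAt.comp s ?_
    exact (contDiffAt_id.mul (contDiffAt_const.sub contDiffAt_id)).rpow_const_of_ne
      (hpos s h0 h1).ne'
  have hqp : ∀ s : ℝ, 0 < s → s < 1 → 0 < q s := fun s h0 h1 => Real.rpow_pos_of_pos (hpos s h0 h1) _
  set k : ℝ → ℂ := fun s => (H s : ℂ) / (g s ^ 2 * (q s : ℂ)) with hk
  have hka : ∀ s, s ≤ α → k s = 0 := fun s hs => by simp [hk, hHa s hs]
  have hkb : ∀ s, δ ≤ s → k s = 0 := fun s hs => by simp [hk, hHb s hs]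
  have hkc : ContDiff ℝ 1 k := by
    refine contDiff_iff_contDiffAt.2 fun s => ?_
    rcases lt_or_ge s α with h1 | h1
    · refine (contDiffAt_const (c := (0 : ℂ))).congr_of_eventuallyEq ?_
      filter_upwards [gt_mem_nhds h1] with t ht using hka t (le_of_lt ht)
    rcases lt_or_ge δ s with h2 | h2
    · refine (contDiffAt_const (c := (0 : ℂ))).congr_of_eventuallyEq ?_
      filter_upwards [lt_mem_nhds h2] with t ht using hkb t (le_of_lt ht)
    have p0 : 0 < s := by linarith
    have p1 : s < 1 := by linarith
    simp only [hk, div_eq_mul_inv]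
    refine hHc.contDiffAt.mul (ContDiffAt.inv ((((hg s ⟨p0, p1.le⟩).of_le (by norm_num)).pow 2).mul (hqc s p0 p1)) ?_)
    exact mul_ne_zero (pow_ne_zero 2 (hg0 s ⟨h1, h2⟩)) (by exact_mod_cast (hqp s p0 p1).ne')
  -- Hence h is 0 below α and constant above δ: f vanishes near s = 0, where g may be singular, and
  -- is a multiple of g near s = 1, where g is regular.
  set h : ℝ → ℂ := fun s => ∫ t in α..s, k t with hh
  have hhd : ∀ s, HasDerivAt h (k s) s := fun s =>
    intervalIntegral.integral_hasDerivAt_right (hkc.continuous.intervalIntegrable _ _)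
      (hkc.continuous.stronglyMeasurableAtFilter _ _) hkc.continuous.continuousAt
  have hhc : ContDiff ℝ 2 h := by
    rw [show (2 : WithTop ℕ∞) = 1 + 1 by norm_num, contDiff_succ_iff_deriv]
    refine ⟨fun s => (hhd s).differentiableAt, by simp, ?_⟩
    rw [show deriv h = k from funext fun s => (hhd s).deriv]; exact hkc
  have hha : ∀ s, s ≤ α → h s = 0 := fun s hs => by
    simp only [hh]
    rw [intervalIntegral.integral_congr (g := fun _ => (0 : ℂ)), intervalIntegral.integral_zero]
    intro t ht
    rw [Set.uIcc_of_ge hs] at ht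
    exact hka t ht.2
  refine ⟨fun s => g s * h s, fun σ hσ => ?_, fun σ hσ => by simp [hha σ hσ.le], fun σ hσ => ?_⟩
  · rcases lt_or_ge σ α with h1 | h1
    · refine (contDiffAt_const (c := (0 : ℂ))).congr_of_eventuallyEq ?_
      filter_upwards [gt_mem_nhds h1] with t ht
      simp [hha t (le_of_lt ht)]
    · exact (hg σ ⟨by linarith, hσ.2⟩).mul hhc.contDiffAt
  rcases lt_or_ge σ α with h1 | h1
  · have e0 : (fun s => g s * h s) =ᶠ[𝓝 σ] fun _ => 0 := by
      filter_upwards [gt_mem_nhds h1] with t ht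
      simp [hha t (le_of_lt ht)]
    have e1 : deriv (fun s => g s * h s) =ᶠ[𝓝 σ] fun _ => 0 := by
      filter_upwards [e0.eventuallyEq_nhds] with t ht
      rw [ht.deriv_eq]; simp
    rw [e1.self_of_nhds, e1.deriv_eq]
    beta_reduce
    rw [hha σ h1.le, hβ0 σ fun h => absurd h.1 (not_lt.2 h1.le)]
    simp [zonalOp]
  have p0 : 0 < σ := by linarith
  have hgσ := hg σ ⟨p0, hσ.2⟩
  have hg1 : ∀ᶠ t in 𝓝 σ, DifferentiableAt ℝ g t := by
    filter_upwards [hgσ.eventually (by simp)] with t ht using ht.differentiableAt (by norm_num)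
  have hf1 : deriv (fun s => g s * h s) =ᶠ[𝓝 σ] fun t => deriv g t * h t + g t * k t := by
    filter_upwards [hg1] with t ht
    exact (ht.hasDerivAt.mul (hhd t)).deriv
  have hg2 : DifferentiableAt ℝ (deriv g) σ := by
    have : ContDiffAt ℝ 1 (fun s => fderiv ℝ g s 1) σ :=
      (hgσ.fderiv_right (m := 1) (by norm_num)).clm_apply contDiffAt_const
    simp only [fderiv_apply_one_eq_deriv] at this
    exact this.differentiableAt (by norm_num)
  have hkd : HasDerivAt k (deriv k σ) σ := (hkc.differentiable (by norm_num) σ).hasDerivAt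
  have hgd := hg1.self_of_nhds.hasDerivAt
  have hf2 : deriv (deriv fun s => g s * h s) σ =
      deriv (deriv g) σ * h σ + deriv g σ * k σ + (deriv g σ * k σ + g σ * deriv k σ) := by
    rw [hf1.deriv_eq]
    exact ((hg2.hasDerivAt.mul (hhd σ)).add (hgd.mul hkd)).deriv
  have hop := hgo σ ⟨p0, hσ.2⟩
  rw [hf1.self_of_nhds, hf2]
  clear_value h k q H
  beta_reduce
  rcases lt_or_ge δ σ with h2 | h2
  · have hk0 : k =ᶠ[𝓝 σ] fun _ => 0 := by
      filter_upwards [lt_mem_nhds h2] with t ht using hkb t (le_of_lt ht)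
    rw [hk0.deriv_eq, hkb σ h2.le, hβ0 σ fun h => absurd h.2 (not_lt.2 h2.le)]
    simp only [deriv_const, mul_zero, add_zero, Complex.ofReal_zero]
    unfold zonalOp at hop ⊢
    linear_combination h σ * hop
  have p1 : σ < 1 := by linarith
  have hgn := hg0 σ ⟨h1, h2⟩
  have hid : (fun s => k s * (g s ^ 2 * (q s : ℂ))) =ᶠ[𝓝 σ] fun s => (H s : ℂ) := by
    filter_upwards [hgσ.continuousAt.eventually_ne hgn, lt_mem_nhds p0, gt_mem_nhds p1]
      with t ht ht0 ht1
    have : (q t : ℂ) ≠ 0 := by exact_mod_cast (hqp t ht0 ht1).ne'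
    simp only [hk]
    exact div_mul_cancel₀ _ (mul_ne_zero (pow_ne_zero 2 ht) this)
  have hder := (hkd.mul ((hgd.pow 2).mul (hqd σ p0 p1).ofReal_comp)).unique
    ((hHd σ).ofReal_comp.congr_of_eventuallyEq hid)
  have hP := hpos σ p0 p1
  have hw1 : (((σ * (1 - σ)) ^ (1 - c) : ℝ) : ℂ) * (q σ : ℂ) = σ * (1 - σ) := by
    rw [← Complex.ofReal_mul, hq, ← Real.rpow_add hP]
    simp
  have hw2 : (((σ * (1 - σ)) ^ (1 - c) : ℝ) : ℂ) * (((σ * (1 - σ)) ^ (c - 1) : ℝ) : ℂ) = 1 := by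
    rw [← Complex.ofReal_mul, ← Real.rpow_add hP]
    simp
  have hcc : ((c : ℝ) : ℂ) = N / 2 := by simp [hc]
  rw [Complex.ofReal_mul, ← mul_assoc, ← mul_right_inj' hgn, ← mul_assoc, ← mul_assoc,
    mul_inv_cancel₀ hgn, one_mul]
  simp only [Pi.pow_apply, Pi.mul_apply, Complex.ofReal_mul, Complex.ofReal_sub, Complex.ofReal_one,
    Complex.ofReal_ofNat, hcc] at hder
  unfold zonalOp at hop ⊢
  push_cast at hder hw1 hw2 ⊢
  -- The ingredients are the equation of g, the derivative of k g² q = H, and the fact that q is the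
  -- integrating factor: s(1-s) q' = (N/2)(1-2s) q.
  linear_combination (g σ * h σ) * hop + (((σ * (1 - σ)) ^ (1 - c) : ℝ) : ℂ) * hder
    - (deriv k σ * g σ ^ 2 + 2 * k σ * g σ * deriv g σ) * hw1
    - k σ * g σ ^ 2 * (N / 2 * (1 - 2 * σ)) * hw2

lemma tendsto_zonalSing {N : ℕ} (hN : 2 ≤ N) : Tendsto (zonalSing N) (𝓝[>] 0) atTop := by
  unfold zonalSing
  split_ifs with h
  · exact tendsto_neg_atBot_atTop.comp Real.tendsto_log_nhdsGT_zero
  · refine tendsto_rpow_neg_nhdsGT_zero ?_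
    have : (3 : ℝ) ≤ N := by exact_mod_cast (by omega : 3 ≤ N)
    linarith

/-- A function of the size of the conformal factor is negligible at infinity. -/
lemma isNegligible_fishSinInfty {N : ℕ} (hN : 2 ≤ N) {ρ : ℝ} (hρ : 0 < ρ)
    {F u : EuclideanSpace ℝ (Fin N) → ℂ} {C ε : ℝ} (hε : 0 < ε)
    (hu : ∀ x, fishSinInfty ρ x < ε → ‖u x‖ ≤ C * fishFactor ρ x) :
    IsNegligible ρ F u (fishSinInfty ρ) := fun η hη => by
  have h := (tendsto_zonalSing hN).eventually_ge_atTop (C / η)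
  rw [eventually_nhdsWithin_iff, Metric.eventually_nhds_iff] at h
  obtain ⟨ε₁, hε₁, h⟩ := h
  refine ⟨min ε ε₁, lt_min hε hε₁, fun x h0 h1 => Or.inr ?_⟩
  rw [lt_min_iff] at h1
  have h2 := h (by rw [Real.dist_0_eq_abs, abs_of_pos h0]; exact h1.2) h0
  rw [div_le_iff₀ hη] at h2
  refine (hu x h1.1).trans ?_
  rw [← mul_assoc]
  have := fishFactor_pos hρ x
  gcongr
  linarith

/-- The density against which zonal averages are taken. -/
def zonalDensity {N : ℕ} (ρ : ℝ) (g : ℝ → ℂ) (β : ℝ → ℝ) (p x : EuclideanSpace ℝ (Fin N)) : ℂ :=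
  fishFactor ρ x * (4 * (ρ : ℂ) ^ 2 / (fishDen ρ x : ℂ) ^ 2 * ((g (fishSin ρ p x))⁻¹ *
    (((fishSin ρ p x * (1 - fishSin ρ p x)) ^ (1 - (N : ℝ) / 2) * β (fishSin ρ p x) : ℝ) : ℂ)))

/-- Orthogonality applied to the function of `exists_zonal_test`. When p = r' that function vanishes
near the source, so the size of u there is irrelevant; otherwise u itself must be negligible at r'.
-/
lemma integral_zonalDensity_eq_zero {N : ℕ} (hN : 2 ≤ N) {ρ : ℝ} (hρ : 0 < ρ) {lam : ℂ}
    {r' p : EuclideanSpace ℝ (Fin N)} {u : EuclideanSpace ℝ (Fin N) → ℂ}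
    (hu : ContDiffOn ℝ 2 u {r'}ᶜ)
    (heq : ∀ r, r ≠ r' → Laplacian.laplacian u r +
      4 * lam * (ρ : ℂ) ^ 2 / ((fishDen ρ r ^ 2 : ℝ) : ℂ) * u r = 0)
    (hsrc : p = r' ∨ IsNegligible ρ 1 u (fishSin ρ r'))
    {C ε : ℝ} (hε : 0 < ε) (hinf : ∀ x, fishSinInfty ρ x < ε → ‖u x‖ ≤ C * fishFactor ρ x)
    {g : ℝ → ℂ} (hg : ∀ σ ∈ Set.Ioc (0 : ℝ) 1, ContDiffAt ℝ 2 g σ)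
    (hgo : ∀ σ ∈ Set.Ioc (0 : ℝ) 1, zonalOp N lam (g σ) (deriv g σ) (deriv (deriv g) σ) σ = 0)
    {α δ : ℝ} (hα : 0 < α) (hδ : δ < 1) (hg0 : ∀ σ ∈ Set.Icc α δ, g σ ≠ 0) {β : ℝ → ℝ}
    (hβ : Continuous β) (hβ0 : ∀ s, s ∉ Set.Ioo α δ → β s = 0)
    (hsep : ∃ ε : ℝ, 0 < ε ∧ ∀ x, fishSin ρ r' x < ε ∨ fishSinInfty ρ x < ε →
      fishSin ρ p x ∉ Set.Ioo α δ) :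
    (Continuous fun x => u x * zonalDensity ρ g β p x) ∧
    (HasCompactSupport fun x => u x * zonalDensity ρ g β p x) ∧
    ((∫ s in α..δ, β s) = 0 → ∫ x, u x * zonalDensity ρ g β p x = 0) := by
  obtain ⟨ε₁, hε₁, hsep⟩ := hsep
  have hsc : Continuous (fishSin ρ p) := (contDiff_fishSin hρ p).continuous
  have hzero : ∀ x, fishSin ρ r' x < ε₁ ∨ fishSinInfty ρ x < ε₁ → zonalDensity ρ g β p x = 0 := by
    intro x hx
    simp [zonalDensity, hβ0 _ (hsep x hx)]
  refine ⟨?_, ?_, fun hβi => ?_⟩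
  · have hγ : Continuous fun σ : ℝ =>
        (g σ)⁻¹ * (((σ * (1 - σ)) ^ (1 - (N : ℝ) / 2) * β σ : ℝ) : ℂ) := by
      refine continuous_iff_continuousAt.2 fun σ => ?_
      by_cases hσ : σ ∈ Set.Icc α δ
      · have h0 : 0 < σ := by linarith [hσ.1]
        have h1 : σ < 1 := by linarith [hσ.2]
        have h2 : ContinuousAt (fun σ : ℝ => (σ * (1 - σ)) ^ (1 - (N : ℝ) / 2)) σ :=
          (continuousAt_id.mul (continuousAt_const.sub continuousAt_id)).rpow_const
            (Or.inl (mul_pos h0 (by simpa using h1)).ne')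
        exact ((hg σ ⟨h0, h1.le⟩).continuousAt.inv₀ (hg0 σ hσ)).mul
          (Complex.continuous_ofReal.continuousAt.comp (h2.mul hβ.continuousAt))
      · have h0 : ∀ᶠ t in 𝓝 σ, t ∉ Set.Icc α δ := isClosed_Icc.isOpen_compl.mem_nhds hσ
        refine (continuousAt_const (y := (0 : ℂ))).congr ?_
        filter_upwards [h0] with t ht
        rw [hβ0 t fun h => ht ⟨h.1.le, h.2.le⟩]
        simp
    have hdenc : Continuous fun x : EuclideanSpace ℝ (Fin N) => ((fishDen ρ x : ℝ) : ℂ) :=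
      Complex.continuous_ofReal.comp (continuous_fishDen ρ)
    have hmc : Continuous fun x : EuclideanSpace ℝ (Fin N) => (fishFactor ρ x : ℂ) :=
      (contDiff_fishFactor hρ).continuous
    have hZ : Continuous (zonalDensity ρ g β p) :=
      hmc.mul ((continuous_const.div (hdenc.pow 2) fun x => pow_ne_zero 2
        (Complex.ofReal_ne_zero.2 (fishDen_pos hρ x).ne')).mul (hγ.comp hsc))
    refine continuous_iff_continuousAt.2 fun x => ?_
    by_cases hx : x = r'
    · have ht1c : Continuous (fishSin ρ r') := (contDiff_fishSin hρ r').continuous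
      have : ∀ᶠ y in 𝓝 x, fishSin ρ r' y < ε₁ :=
        ht1c.continuousAt.eventually (gt_mem_nhds (by rw [hx, fishSin_self]; exact hε₁))
      refine (continuousAt_const (y := (0 : ℂ))).congr ?_
      filter_upwards [this] with y hy
      rw [hzero y (Or.inl hy), mul_zero]
    · exact (hu.continuousOn.continuousAt (isOpen_compl_singleton.mem_nhds hx)).mul hZ.continuousAt
  · obtain ⟨R, hR⟩ := exists_fishSinInfty_lt (N := N) hρ hε₁
    refine HasCompactSupport.intro (isCompact_closedBall 0 R) fun x hx => ?_
    rw [hzero x (Or.inr (hR x (by simpa using hx))), mul_zero]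
  · obtain ⟨f, hf, hf0, hfo⟩ := exists_zonal_test hg hgo hα hδ hg0 hβ hβ0 hβi
    have hs01 : ∀ x, fishSin ρ p x ∈ Set.Icc (0 : ℝ) 1 := fun x =>
      ⟨fishSin_nonneg hρ p x, fishSin_le_one hρ p x⟩
    rw [← integral_zonalOp_eq_zero hN hρ hu heq hf (p := p) ?_
      (isNegligible_fishSinInfty hN hρ hε hinf) ⟨ε₁, hε₁, fun x hx => ?_⟩]
    · congr 1
      funext x
      rw [hfo _ (hs01 x), zonalDensity]
    · rcases hsrc with rfl | hsrc
      · refine fun η _ => ⟨α, hα, fun x _ hx => Or.inl ?_⟩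
        filter_upwards [hsc.continuousAt.eventually (gt_mem_nhds hx)] with y hy
        exact hf0 _ hy
      · intro η hη
        obtain ⟨ε₀, h0, h⟩ := hsrc η hη
        refine ⟨ε₀, h0, fun x hx hx' => Or.inr ((h x hx hx').resolve_left fun hc => ?_)⟩
        simpa using hc.self_of_nhds
    · rw [hfo _ (hs01 x), hβ0 _ (hsep x hx)]
      simp

open MeasureTheory in
lemma exists_bump_around {τ : ℝ} (hτ : 0 < τ) :
    ∃ β : ℝ → ℝ, Continuous β ∧ (∀ s, 0 ≤ β s) ∧ (∀ s, s ∉ Set.Ioo (τ / 2) (3 * τ / 2) → β s = 0) ∧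
      β τ ≠ 0 ∧ ∫ s, β s = 1 := by
  set b : ContDiffBump τ := ⟨τ / 4, τ / 2, by linarith, by linarith⟩ with hb
  have hsupp := b.support_normed_eq (μ := volume)
  refine ⟨b.normed volume, b.continuous_normed, b.nonneg_normed, fun s hs => ?_, ?_,
    b.integral_normed⟩
  · by_contra h
    have h1 : s ∈ Metric.ball τ (τ / 2) := by
      have : s ∈ Function.support (b.normed volume) := h
      rwa [hsupp] at this
    rw [Real.ball_eq_Ioo] at h1
    exact hs ⟨by linarith [h1.1], by linarith [h1.2]⟩
  · have : τ ∈ Function.support (b.normed volume) := by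
      rw [hsupp]; exact Metric.mem_ball_self (by linarith : (0 : ℝ) < τ / 2)
    exact this

lemma exists_fishSin_eq {N : ℕ} {ρ : ℝ} (hρ : 0 < ρ) {p x₁ : EuclideanSpace ℝ (Fin N)} {τ : ℝ}
    (h0 : 0 ≤ τ) (h1 : τ ≤ fishSin ρ p x₁) : ∃ x, fishSin ρ p x = τ := by
  have hsc : Continuous (fishSin ρ p) := (contDiff_fishSin hρ p).continuous
  exact mem_range_of_exists_le_of_exists_ge hsc ⟨p, by rw [fishSin_self]; exact h0⟩ ⟨x₁, h1⟩

/-- Exhibits the pairing as an average of the quotient v/(m g) against a real weight, nonnegative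
when β is. Where g vanishes both sides are 0 by division by zero. -/
lemma mul_zonalDensity {N : ℕ} {ρ : ℝ} (hρ : 0 < ρ) {g : ℝ → ℂ} {β : ℝ → ℝ}
    {p x : EuclideanSpace ℝ (Fin N)} (v : ℂ) :
    v * zonalDensity ρ g β p x = v / (fishFactor ρ x * g (fishSin ρ p x)) *
      ((fishFactor ρ x ^ 2 * (4 * ρ ^ 2 / fishDen ρ x ^ 2) *
        ((fishSin ρ p x * (1 - fishSin ρ p x)) ^ (1 - (N : ℝ) / 2) * β (fishSin ρ p x)) : ℝ) : ℂ) := by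
  have hm : (fishFactor ρ x : ℂ) ≠ 0 := Complex.ofReal_ne_zero.2 (fishFactor_pos hρ x).ne'
  unfold zonalDensity
  by_cases hg : g (fishSin ρ p x) = 0
  · simp [hg]
  · push_cast
    field_simp

open MeasureTheory in
/-- Zonal averages of a solution of the fish-eye equation, relative to a zonal solution, do not
depend on the radius. -/
lemma exists_zonal_mean {N : ℕ} (hN : 2 ≤ N) {ρ : ℝ} (hρ : 0 < ρ) {lam : ℂ}
    {r' p x₁ : EuclideanSpace ℝ (Fin N)} {u : EuclideanSpace ℝ (Fin N) → ℂ}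
    (hu : ContDiffOn ℝ 2 u {r'}ᶜ)
    (heq : ∀ r, r ≠ r' → Laplacian.laplacian u r +
      4 * lam * (ρ : ℂ) ^ 2 / ((fishDen ρ r ^ 2 : ℝ) : ℂ) * u r = 0)
    (hsrc : p = r' ∨ IsNegligible ρ 1 u (fishSin ρ r'))
    {C ε : ℝ} (hε : 0 < ε) (hinf : ∀ x, fishSinInfty ρ x < ε → ‖u x‖ ≤ C * fishFactor ρ x)
    {g : ℝ → ℂ} (hg : ∀ σ ∈ Set.Ioc (0 : ℝ) 1, ContDiffAt ℝ 2 g σ)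
    (hgo : ∀ σ ∈ Set.Ioc (0 : ℝ) 1, zonalOp N lam (g σ) (deriv g σ) (deriv (deriv g) σ) σ = 0)
    {δ : ℝ} (hδ : 0 < δ) (hδ1 : δ ≤ 1) (hg0 : ∀ σ ∈ Set.Ioo 0 δ, g σ ≠ 0)
    (hx₁ : δ ≤ fishSin ρ p x₁)
    (hsep : ∀ α : ℝ, 0 < α → ∃ ε : ℝ, 0 < ε ∧ ∀ x, fishSin ρ r' x < ε ∨ fishSinInfty ρ x < ε →
      fishSin ρ p x ≤ α ∨ δ ≤ fishSin ρ p x) :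
    ∃ J : ℂ, ∀ τ : ℝ, 0 < τ → 3 * τ / 2 < δ → ∀ (c : ℂ) (A : ℝ),
      (∀ x, fishSin ρ p x ∈ Set.Ioo (τ / 2) (3 * τ / 2) →
        A ≤ (c * (u x / (fishFactor ρ x * g (fishSin ρ p x)))).re) → A ≤ (c * J).re := by
  obtain ⟨ε₂, hε₂, hsep2⟩ := exists_fishSin_lt_le_fishSinInfty hρ p
  -- The mean is ∫ V W divided by ∫ W. Both integrals depend on β only through its total mass, so
  -- the mean is independent of the shell.
  set V : EuclideanSpace ℝ (Fin N) → ℂ := fun x => u x / (fishFactor ρ x * g (fishSin ρ p x))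
    with hV
  set W : (ℝ → ℝ) → EuclideanSpace ℝ (Fin N) → ℝ := fun β x =>
    fishFactor ρ x ^ 2 * (4 * ρ ^ 2 / fishDen ρ x ^ 2) *
        ((fishSin ρ p x * (1 - fishSin ρ p x)) ^ (1 - (N : ℝ) / 2) * β (fishSin ρ p x)) with hW
  have main : ∀ (α δ' : ℝ), 0 < α → δ' < δ → ∀ β : ℝ → ℝ, Continuous β →
      (∀ s, s ∉ Set.Ioo α δ' → β s = 0) →
      (Continuous (fun x => V x * (W β x : ℂ)) ∧ HasCompactSupport (fun x => V x * (W β x : ℂ)) ∧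
        (∫ s in α..δ', β s = 0 → ∫ x, V x * (W β x : ℂ) = 0)) ∧
      (Continuous (W β) ∧ HasCompactSupport (W β) ∧
        (∫ s in α..δ', β s = 0 → ∫ x, W β x = 0)) := by
    intro α δ' hα hδ' β hβ hβ0
    have hgI : ∀ σ ∈ Set.Icc α δ', g σ ≠ 0 := fun σ hσ =>
      hg0 σ ⟨hα.trans_le hσ.1, hσ.2.trans_lt hδ'⟩
    have hgβ : ∀ x, g (fishSin ρ p x) = 0 → β (fishSin ρ p x) = 0 := fun x hx =>
      hβ0 _ fun h => hgI _ ⟨h.1.le, h.2.le⟩ hx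
    obtain ⟨ε₁, hε₁, hs1⟩ := hsep α hα
    have hs1' : ∀ x, fishSin ρ r' x < ε₁ ∨ fishSinInfty ρ x < ε₁ →
        fishSin ρ p x ∉ Set.Ioo α δ' := fun x hx h => by
      rcases hs1 x hx with h1 | h1
      · exact absurd h.1 (not_lt.2 h1)
      · linarith [h.2]
    constructor
    · have h := integral_zonalDensity_eq_zero hN hρ hu heq hsrc hε hinf hg hgo hα
        (hδ'.trans_le hδ1) hgI hβ hβ0 ⟨ε₁, hε₁, hs1'⟩
      have e : (fun x => u x * zonalDensity ρ g β p x) = fun x => V x * (W β x : ℂ) :=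
        funext fun x => mul_zonalDensity hρ _
      have e' := fun x => congrFun e x
      beta_reduce at e'
      simp only [e'] at h
      exact h
    · have hs01 : ∀ x, x ≠ p → fishSin ρ p x ∈ Set.Ioc (0 : ℝ) 1 := fun x hx =>
        ⟨fishSin_pos hρ hx, fishSin_le_one hρ p x⟩
      have hsc : ContDiff ℝ 2 (fishSin ρ p) := contDiff_fishSin hρ p
      obtain ⟨b, hb⟩ := isCompact_Icc.exists_bound_of_continuousOn (s := Set.Icc ε₂ 1) (f := g)
        fun σ hσ => (hg σ ⟨hε₂.trans_le hσ.1, hσ.2⟩).continuousAt.continuousWithinAt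
      -- The total weight is handled by the same lemma with source p and the solution m g in place
      -- of u, for which the quotient is 1 wherever the weight is supported.
      have h := integral_zonalDensity_eq_zero hN hρ (lam := lam) (r' := p) (p := p)
        (u := fun x => fishFactor ρ x * g (fishSin ρ p x)) ?_ ?_ (Or.inl rfl) (C := b) hε₂ ?_ hg hgo
        hα (hδ'.trans_le hδ1) hgI hβ hβ0 ⟨min α (min ε₁ ε₂), by positivity, fun x hx => ?_⟩
      · have e : (fun x => (fishFactor ρ x * g (fishSin ρ p x)) * zonalDensity ρ g β p x) =
            fun x => (W β x : ℂ) := funext fun x => by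
          rw [mul_zonalDensity hρ]
          by_cases hx : g (fishSin ρ p x) = 0
          · simp [hW, hgβ x hx]
          · rw [div_self (mul_ne_zero (Complex.ofReal_ne_zero.2 (fishFactor_pos hρ x).ne') hx),
              one_mul]
        have e' := fun x => congrFun e x
        beta_reduce at e'
        simp only [e'] at h
        obtain ⟨h1, h2, h3⟩ := h
        refine ⟨?_, ?_, fun hi => ?_⟩
        · have := Complex.continuous_re.comp h1
          exact this
        · exact h2.comp_left (g := Complex.re) Complex.zero_re
        · have := h3 hi
          rw [integral_complex_ofReal] at this
          exact_mod_cast this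
      · exact fun x hx => ((contDiff_fishFactor hρ).contDiffAt.mul
          ((hg _ (hs01 x hx)).comp x hsc.contDiffAt)).contDiffWithinAt
      · intro x hx
        obtain ⟨gs, L, hz⟩ := exists_isZonalAt_fishSin hρ p x
        rw [fishEye_operator_zonal hρ hz (hg _ (hs01 x hx)) lam, hgo _ (hs01 x hx)]
        simp
      · intro x hx
        have h1 : ε₂ ≤ fishSin ρ p x := by
          by_contra hcon
          push Not at hcon
          linarith [hsep2 x hcon]
        rw [norm_mul, Complex.norm_real, Real.norm_of_nonneg (fishFactor_pos hρ x).le, mul_comm]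
        exact mul_le_mul_of_nonneg_right (hb _ ⟨h1, fishSin_le_one hρ p x⟩) (fishFactor_pos hρ x).le
      · simp only [lt_min_iff] at hx
        rcases hx with hx | hx
        · exact fun h => by linarith [h.1, hx.1]
        · exact hs1' x (Or.inr hx.2.1)
  choose! β hβc hβn hβ0 hβτ hβ1 using fun (τ : ℝ) (hτ : 0 < τ) => exists_bump_around hτ
  -- Two bumps of unit mass are compared on an interval containing both supports: their difference
  -- has integral 0.
  have hin : ∀ τ₁ τ₂ : ℝ, 0 < τ₁ → 0 < τ₂ → 3 * τ₁ / 2 < δ → 3 * τ₂ / 2 < δ →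
      (∫ x, V x * (W (β τ₁) x : ℂ) = ∫ x, V x * (W (β τ₂) x : ℂ)) ∧
      ∫ x, W (β τ₁) x = ∫ x, W (β τ₂) x := by
    intro τ₁ τ₂ h1 h2 h3 h4
    set α := min (τ₁ / 2) (τ₂ / 2) with hα
    set δ' := max (3 * τ₁ / 2) (3 * τ₂ / 2) with hδ'
    have hα0 : 0 < α := by positivity
    have hδδ : δ' < δ := max_lt h3 h4
    have hαδ : α ≤ δ' := (min_le_left _ _).trans (le_trans (by linarith) (le_max_left _ _))
    have hsub : ∀ τ, 0 < τ → α ≤ τ / 2 → 3 * τ / 2 ≤ δ' → (∀ s, s ∉ Set.Ioo α δ' → β τ s = 0) ∧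
        ∫ s in α..δ', β τ s = 1 := by
      intro τ hτ ha hd
      have h0 : ∀ s, s ∉ Set.Ioo α δ' → β τ s = 0 := fun s hs =>
        hβ0 _ hτ s fun h => hs ⟨ha.trans_lt h.1, h.2.trans_le hd⟩
      refine ⟨h0, ?_⟩
      rw [intervalIntegral.integral_eq_integral_of_support_subset, hβ1 _ hτ]
      intro s hs
      by_contra hcon
      exact hs (h0 s fun h => hcon ⟨h.1, h.2.le⟩)
    obtain ⟨a1, a2⟩ := hsub τ₁ h1 (min_le_left _ _) (le_max_left _ _)
    obtain ⟨b1, b2⟩ := hsub τ₂ h2 (min_le_right _ _) (le_max_right _ _)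
    obtain ⟨⟨c1, c2, -⟩, c4, c5, -⟩ := main α δ' hα0 hδδ _ (hβc _ h1) a1
    obtain ⟨⟨d1, d2, -⟩, d4, d5, -⟩ := main α δ' hα0 hδδ _ (hβc _ h2) b1
    obtain ⟨⟨-, -, e3⟩, -, -, e6⟩ := main α δ' hα0 hδδ (fun s => β τ₁ s - β τ₂ s)
      ((hβc _ h1).sub (hβc _ h2)) fun s hs => by rw [a1 s hs, b1 s hs, sub_zero]
    have hi : ∫ s in α..δ', (β τ₁ s - β τ₂ s) = 0 := by
      rw [intervalIntegral.integral_sub ((hβc _ h1).intervalIntegrable _ _)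
        ((hβc _ h2).intervalIntegrable _ _), a2, b2, sub_self]
    have hWs : ∀ x, W (fun s => β τ₁ s - β τ₂ s) x = W (β τ₁) x - W (β τ₂) x := fun x => by
      simp only [hW]; ring
    have e3 := e3 hi
    have e6 := e6 hi
    simp only [hWs, Complex.ofReal_sub, mul_sub] at e3 e6
    rw [integral_sub (c1.integrable_of_hasCompactSupport c2)
      (d1.integrable_of_hasCompactSupport d2), sub_eq_zero] at e3
    rw [integral_sub (c4.integrable_of_hasCompactSupport c5)
      (d4.integrable_of_hasCompactSupport d5), sub_eq_zero] at e6
    exact ⟨e3, e6⟩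
  -- Any reference radius with 3τ/2 < δ would do; δ/3 is one. The weight being nonnegative with
  -- positive total, a lower bound for the real part on the shell passes to J.
  refine ⟨(∫ x, V x * (W (β (δ / 3)) x : ℂ)) / ((∫ x, W (β (δ / 3)) x : ℝ) : ℂ),
    fun τ hτ hτδ c A hA => ?_⟩
  obtain ⟨i1, i2⟩ := hin (δ / 3) τ (by linarith) hτ (by linarith) hτδ
  rw [i1, i2]
  obtain ⟨⟨c1, c2, -⟩, c4, c5, -⟩ := main _ _ (half_pos hτ) hτδ _ (hβc _ hτ) (hβ0 _ hτ)
  have hs01 : ∀ x, fishSin ρ p x ∈ Set.Icc (0 : ℝ) 1 := fun x =>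
    ⟨fishSin_nonneg hρ p x, fishSin_le_one hρ p x⟩
  have hWn : ∀ x, 0 ≤ W (β τ) x := fun x => by
    have h1 := (hs01 x).1
    have h2 : 0 ≤ 1 - fishSin ρ p x := by linarith [(hs01 x).2]
    have h3 := hβn _ hτ (fishSin ρ p x)
    simp only [hW]
    positivity
  have hκ : 0 < ∫ x, W (β τ) x := by
    -- The shell is nonempty by the intermediate value theorem between p and x₁, so the weight is
    -- not identically zero.
    obtain ⟨x, hx⟩ := exists_fishSin_eq hρ hτ.le (show τ ≤ fishSin ρ p x₁ by linarith)
    refine c4.integral_pos_of_hasCompactSupport_nonneg_nonzero c5 hWn (x := x) ?_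
    have h1 := fishFactor_pos hρ x
    have h2 := fishDen_pos hρ x
    have h3 : 0 < 1 - fishSin ρ p x := by linarith
    have h4 : 0 < fishSin ρ p x := by linarith
    simp only [hW]
    refine mul_ne_zero (by positivity) (mul_ne_zero (by positivity) ?_)
    rw [hx]; exact hβτ _ hτ
  have hiV := c1.integrable_of_hasCompactSupport (μ := volume) c2
  have hiW := c4.integrable_of_hasCompactSupport (μ := volume) c5
  have key : A * ∫ x, W (β τ) x ≤ (c * ∫ x, V x * (W (β τ) x : ℂ)).re := by
    rw [← integral_const_mul, ← integral_const_mul]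
    have hre := integral_re (𝕜 := ℂ) (hiV.const_mul c)
    rw [show (∫ x, c * (V x * (W (β τ) x : ℂ))).re =
      RCLike.re (∫ x, c * (V x * (W (β τ) x : ℂ))) from rfl, ← hre]
    refine integral_mono (hiW.const_mul A) (hiV.const_mul c).re fun x => ?_
    change A * W (β τ) x ≤ (c * (V x * (W (β τ) x : ℂ))).re
    rw [← mul_assoc c, Complex.re_mul_ofReal]
    by_cases hx : fishSin ρ p x ∈ Set.Ioo (τ / 2) (3 * τ / 2)
    · exact mul_le_mul_of_nonneg_right (hA x hx) (hWn x)
    · have : W (β τ) x = 0 := by simp only [hW, hβ0 _ hτ _ hx, mul_zero]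
      rw [this, mul_zero, mul_zero]
  rw [mul_div_assoc', Complex.div_ofReal_re, le_div_iff₀ hκ]
  exact key

/-! ### Local behaviour at the source and at infinity -/

/-- Sublevel sets of s form a neighbourhood base at p: a small s bounds r² + ρ² from above, and then
s controls |x-p|. -/
lemma exists_fishSin_lt_of_eventually {N : ℕ} {ρ : ℝ} (hρ : 0 < ρ) {p : EuclideanSpace ℝ (Fin N)}
    {P : EuclideanSpace ℝ (Fin N) → Prop} (h : ∀ᶠ x in 𝓝 p, P x) :
    ∃ ε : ℝ, 0 < ε ∧ ∀ x, fishSin ρ p x < ε → P x := by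
  obtain ⟨ε₁, hε₁, hsep⟩ := exists_fishSin_lt_le_fishSinInfty hρ p
  obtain ⟨r, hr, h⟩ := Metric.eventually_nhds_iff.1 h
  have hP := fishDen_pos hρ p
  refine ⟨min ε₁ (ε₁ * r ^ 2 / fishDen ρ p), by positivity, fun x hx => h ?_⟩
  rw [lt_min_iff] at hx
  have h1 := hsep x hx.1
  have h2 := hx.2
  have hA := fishDen_pos hρ x
  unfold fishSin fishSinInfty at *
  rw [dist_eq_norm]
  rw [le_div_iff₀ hA] at h1
  rw [div_lt_div_iff₀ (by positivity) hP] at h2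
  have h3 : ρ ^ 2 * fishDen ρ p * ‖x - p‖ ^ 2 < ρ ^ 2 * fishDen ρ p * r ^ 2 := by
    calc ρ ^ 2 * fishDen ρ p * ‖x - p‖ ^ 2 = ρ ^ 2 * ‖x - p‖ ^ 2 * fishDen ρ p := by ring
      _ < ε₁ * r ^ 2 * (fishDen ρ x * fishDen ρ p) := h2
      _ = (ε₁ * fishDen ρ x) * (r ^ 2 * fishDen ρ p) := by ring
      _ ≤ ρ ^ 2 * (r ^ 2 * fishDen ρ p) := by gcongr
      _ = _ := by ring
  have h4 := lt_of_mul_lt_mul_left h3 (by positivity)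
  exact lt_of_pow_lt_pow_left₀ 2 hr.le h4

lemma exists_fishSin_lt_of_eventually_ne {N : ℕ} {ρ : ℝ} (hρ : 0 < ρ)
    {p : EuclideanSpace ℝ (Fin N)} {P : EuclideanSpace ℝ (Fin N) → Prop}
    (h : ∀ᶠ x in 𝓝[≠] p, P x) :
    ∃ ε : ℝ, 0 < ε ∧ ∀ x, 0 < fishSin ρ p x → fishSin ρ p x < ε → P x := by
  obtain ⟨ε, hε, h⟩ := exists_fishSin_lt_of_eventually hρ (eventually_nhdsWithin_iff.1 h)
  refine ⟨ε, hε, fun x h0 h1 => h x h1 fun hx => ?_⟩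
  rw [Set.mem_singleton_iff.1 hx, fishSin_self] at h0
  exact lt_irrefl _ h0

lemma tendsto_fishSin {N : ℕ} {ρ : ℝ} (hρ : 0 < ρ) (p : EuclideanSpace ℝ (Fin N)) :
    Tendsto (fishSin ρ p) (𝓝[≠] p) (𝓝[>] 0) := by
  refine tendsto_nhdsWithin_iff.2 ⟨?_, ?_⟩
  · have := (contDiff_fishSin hρ p).continuous.tendsto p
    rw [fishSin_self] at this
    exact this.mono_left nhdsWithin_le_nhds
  · filter_upwards [self_mem_nhdsWithin] with x hx using fishSin_pos hρ hx

lemma zonalSing_le {N : ℕ} (hN : 2 ≤ N) {s t : ℝ} (hs : 0 < s) (hst : s ≤ t) :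
    zonalSing N t ≤ zonalSing N s := by
  unfold zonalSing
  split_ifs
  · exact neg_le_neg (Real.log_le_log hs hst)
  · refine Real.rpow_le_rpow_of_nonpos hs hst ?_
    have : (2 : ℝ) ≤ N := by exact_mod_cast hN
    linarith

/-- A function with a limit in the sense of decay at infinity is of the size of the conformal
factor there. -/
lemma exists_bound_fishFactor {N : ℕ} (hN : 2 ≤ N) {ρ : ℝ} (hρ : 0 < ρ)
    {G : EuclideanSpace ℝ (Fin N) → ℂ} {C : ℂ}
    (hG : Tendsto (fun r : EuclideanSpace ℝ (Fin N) => ((‖r‖ ^ (N - 2) : ℝ) : ℂ) * G r)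
      (Bornology.cobounded (EuclideanSpace ℝ (Fin N))) (𝓝 C)) :
    ∃ C' ε : ℝ, 0 < ε ∧ ∀ x, fishSinInfty ρ x < ε → ‖G x‖ ≤ C' * fishFactor ρ x := by
  have h1 : ∀ᶠ r in Bornology.cobounded (EuclideanSpace ℝ (Fin N)),
      ‖((‖r‖ ^ (N - 2) : ℝ) : ℂ) * G r‖ < ‖C‖ + 1 :=
    hG.norm.eventually (gt_mem_nhds (lt_add_one _))
  rw [← comap_norm_atTop, eventually_comap, eventually_atTop] at h1
  obtain ⟨R, hR⟩ := h1
  -- Beyond radius ρ one has r² + ρ² ≤ 2r², so r^(2-N) and the conformal factor are comparable.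
  set M := max (max R 0) ρ with hM
  have hM0 : ρ ≤ M := le_max_right _ _
  have hM1 : R ≤ M := (le_max_left _ _).trans (le_max_left _ _)
  have hMp : 0 < M := hρ.trans_le hM0
  refine ⟨(‖C‖ + 1) * 2 ^ ((N : ℝ) / 2 - 1), ρ ^ 2 / (M ^ 2 + ρ ^ 2), by positivity,
    fun x hx => ?_⟩
  have hA := fishDen_pos hρ x
  unfold fishSinInfty at hx
  rw [div_lt_div_iff_of_pos_left (by positivity) hA (by positivity)] at hx
  unfold fishDen at hx
  have hxM : M < ‖x‖ := lt_of_pow_lt_pow_left₀ 2 (norm_nonneg _) (by linarith)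
  have hx0 : 0 < ‖x‖ := hMp.trans hxM
  have h2 := hR ‖x‖ (hM1.trans hxM.le) x rfl
  rw [norm_mul, Complex.norm_real, Real.norm_of_nonneg (by positivity)] at h2
  have hle : fishDen ρ x ≤ 2 * ‖x‖ ^ 2 := by
    unfold fishDen
    nlinarith [hM0.trans hxM.le]
  have he : (0 : ℝ) ≤ (N : ℝ) / 2 - 1 := by
    have : (2 : ℝ) ≤ N := by exact_mod_cast hN
    linarith
  have h3 : fishDen ρ x ^ ((N : ℝ) / 2 - 1) ≤ 2 ^ ((N : ℝ) / 2 - 1) * ‖x‖ ^ (N - 2) := by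
    refine (Real.rpow_le_rpow hA.le hle he).trans (le_of_eq ?_)
    rw [Real.mul_rpow (by norm_num) (by positivity), ← Real.rpow_natCast ‖x‖ 2,
      ← Real.rpow_mul hx0.le, ← Real.rpow_natCast ‖x‖ (N - 2), Nat.cast_sub hN]
    congr 2
    push_cast
    ring
  have hm : fishFactor ρ x = (fishDen ρ x ^ ((N : ℝ) / 2 - 1))⁻¹ := by
    rw [fishFactor, ← Real.rpow_neg hA.le, neg_sub]
  have hAp : 0 < fishDen ρ x ^ ((N : ℝ) / 2 - 1) := Real.rpow_pos_of_pos hA _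
  rw [hm, ← div_eq_mul_inv, le_div_iff₀ hAp]
  calc ‖G x‖ * fishDen ρ x ^ ((N : ℝ) / 2 - 1)
      ≤ ‖G x‖ * (2 ^ ((N : ℝ) / 2 - 1) * ‖x‖ ^ (N - 2)) := by gcongr
    _ = 2 ^ ((N : ℝ) / 2 - 1) * (‖x‖ ^ (N - 2) * ‖G x‖) := by ring
    _ ≤ 2 ^ ((N : ℝ) / 2 - 1) * (‖C‖ + 1) := by gcongr
    _ = _ := by ring

/-- The coefficient of the singularity of the zonal hypergeometric solution. -/
def zonalSingConst (N : ℕ) : ℝ :=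
  if N = 2 then 1 else Real.Gamma ((N : ℝ) / 2) * Real.Gamma ((N : ℝ) / 2 - 1)

lemma zonalSingConst_pos {N : ℕ} (hN : 2 ≤ N) : 0 < zonalSingConst N := by
  unfold zonalSingConst
  split_ifs with h
  · exact one_pos
  · have : (3 : ℝ) ≤ N := by exact_mod_cast (by omega : 3 ≤ N)
    exact mul_pos (Real.Gamma_pos_of_pos (by linarith)) (Real.Gamma_pos_of_pos (by linarith))

/-- The ratio of the source singularity to the zonal singularity. -/
def sourceRatio (N : ℕ) (ρ : ℝ) (p : EuclideanSpace ℝ (Fin N)) : ℝ :=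
  zonalSingConst N / (4 * Real.pi ^ ((N : ℝ) / 2) * Real.Gamma ((N : ℝ) / 2)) *
    (ρ ^ 2 / (fishDen ρ p * fishDen ρ p)) ^ ((N : ℝ) / 2 - 1)

lemma sourceRatio_pos {N : ℕ} (hN : 2 ≤ N) {ρ : ℝ} (hρ : 0 < ρ) (p : EuclideanSpace ℝ (Fin N)) :
    0 < sourceRatio N ρ p := by
  have h1 := zonalSingConst_pos hN
  have h2 := fishDen_pos hρ p
  have h3 : 0 < Real.Gamma ((N : ℝ) / 2) := Real.Gamma_pos_of_pos (by
    have : (2 : ℝ) ≤ N := by exact_mod_cast hN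
    linarith)
  unfold sourceRatio
  positivity

/-- One has s = q |x-p|² with q tending to a positive limit. For N = 2 the logarithm of q is
negligible against log |x-p|; for N ≥ 3 the ratio is a constant times a power of q. -/
lemma tendsto_source_ratio {N : ℕ} (hN : 2 ≤ N) {ρ : ℝ} (hρ : 0 < ρ)
    (p : EuclideanSpace ℝ (Fin N)) :
    Tendsto (fun x => sourceSingularity N ‖x - p‖ / zonalSing N (fishSin ρ p x)) (𝓝[≠] p)
      (𝓝 (-sourceRatio N ρ p)) := by
  have hP := fishDen_pos hρ p
  have hq : Tendsto (fun x : EuclideanSpace ℝ (Fin N) => ρ ^ 2 / (fishDen ρ x * fishDen ρ p))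
      (𝓝[≠] p) (𝓝 (ρ ^ 2 / (fishDen ρ p * fishDen ρ p))) := by
    have : ContinuousAt (fun x : EuclideanSpace ℝ (Fin N) => ρ ^ 2 / (fishDen ρ x * fishDen ρ p)) p :=
      continuousAt_const.div ((continuous_fishDen ρ).continuousAt.mul continuousAt_const)
        (mul_pos hP hP).ne'
    exact this.tendsto.mono_left nhdsWithin_le_nhds
  have hq0 : 0 < ρ ^ 2 / (fishDen ρ p * fishDen ρ p) := by positivity
  by_cases h : N = 2
  · have hd : Tendsto (fun x => ‖x - p‖) (𝓝[≠] p) (𝓝[>] 0) := by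
      refine tendsto_nhdsWithin_iff.2 ⟨?_, ?_⟩
      · have : ContinuousAt (fun x => ‖x - p‖) p := by fun_prop
        simpa [ContinuousAt] using this.tendsto.mono_left nhdsWithin_le_nhds
      · filter_upwards [self_mem_nhdsWithin] with x hx using norm_pos_iff.2 (sub_ne_zero.2 hx)
    have hl : Tendsto (fun x => Real.log ‖x - p‖) (𝓝[≠] p) atBot :=
      Real.tendsto_log_nhdsGT_zero.comp hd
    have h1 : Tendsto (fun x => Real.log (ρ ^ 2 / (fishDen ρ x * fishDen ρ p)) /
        Real.log ‖x - p‖) (𝓝[≠] p) (𝓝 0) :=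
      ((Real.continuousAt_log hq0.ne').tendsto.comp hq).div_atBot hl
    have h2 : Tendsto (fun x => (1 / (2 * Real.pi)) * (-(Real.log (ρ ^ 2 / (fishDen ρ x *
        fishDen ρ p)) / Real.log ‖x - p‖ + 2))⁻¹) (𝓝[≠] p)
        (𝓝 (1 / (2 * Real.pi) * (-(0 + 2))⁻¹)) :=
      tendsto_const_nhds.mul ((h1.add_const 2).neg.inv₀ (by norm_num))
    have h3 : -sourceRatio N ρ p = 1 / (2 * Real.pi) * (-(0 + 2))⁻¹ := by
      subst h
      have := Real.pi_ne_zero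
      simp [sourceRatio, zonalSingConst]
      ring
    rw [h3]
    refine h2.congr' ?_
    filter_upwards [self_mem_nhdsWithin, hl.eventually_lt_atBot 0] with x hx hx0
    have hA := fishDen_pos hρ x
    have hn : 0 < ‖x - p‖ := norm_pos_iff.2 (sub_ne_zero.2 hx)
    have h4 : Real.log (fishSin ρ p x) =
        Real.log (ρ ^ 2 / (fishDen ρ x * fishDen ρ p)) + 2 * Real.log ‖x - p‖ := by
      rw [fishSin, mul_div_right_comm, Real.log_mul (by positivity) (by positivity), Real.log_pow]
      norm_num
    rw [sourceSingularity, zonalSing, if_pos h, if_pos h, h4, div_add' _ _ _ hx0.ne, ← neg_div,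
      inv_div]
    ring
  · have hN3 : (3 : ℝ) ≤ N := by exact_mod_cast (by omega : 3 ≤ N)
    have h1 := (hq.rpow_const (p := (N : ℝ) / 2 - 1) (Or.inl hq0.ne')).const_mul
      (-(zonalSingConst N / (4 * Real.pi ^ ((N : ℝ) / 2) * Real.Gamma ((N : ℝ) / 2))))
    rw [neg_mul] at h1
    refine h1.congr' ?_
    filter_upwards [self_mem_nhdsWithin] with x hx
    have hA := fishDen_pos hρ x
    have hn : 0 < ‖x - p‖ := norm_pos_iff.2 (sub_ne_zero.2 hx)
    have hG : 0 < Real.Gamma ((N : ℝ) / 2) := Real.Gamma_pos_of_pos (by linarith)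
    have hG1 : 0 < Real.Gamma ((N : ℝ) / 2 - 1) := Real.Gamma_pos_of_pos (by linarith)
    have hGG : Real.Gamma ((N : ℝ) / 2) = ((N : ℝ) / 2 - 1) * Real.Gamma ((N : ℝ) / 2 - 1) := by
      have := Real.Gamma_add_one (s := (N : ℝ) / 2 - 1) (by linarith)
      rwa [sub_add_cancel] at this
    have hs : fishSin ρ p x ^ (1 - (N : ℝ) / 2) =
        ((ρ ^ 2 / (fishDen ρ x * fishDen ρ p)) ^ ((N : ℝ) / 2 - 1))⁻¹ * (‖x - p‖ ^ (N - 2))⁻¹ := by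
      rw [fishSin, mul_div_right_comm, Real.mul_rpow (by positivity) (by positivity),
        ← Real.rpow_neg (by positivity), neg_sub, ← Real.rpow_natCast ‖x - p‖ 2,
        ← Real.rpow_mul hn.le, ← Real.rpow_natCast ‖x - p‖ (N - 2), ← Real.rpow_neg hn.le,
        Nat.cast_sub hN]
      congr 2
      push_cast
      ring
    have hqp : 0 < (ρ ^ 2 / (fishDen ρ x * fishDen ρ p)) ^ ((N : ℝ) / 2 - 1) := by positivity
    have hn2 : (N : ℝ) - 2 ≠ 0 := by linarith
    rw [sourceSingularity, zonalSing, if_neg h, if_neg h, hs, zonalSingConst, if_neg h,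
      unitSphereArea, hGG]
    have hn3 : (N : ℝ) / 2 - 1 ≠ 0 := by linarith
    generalize (ρ ^ 2 / (fishDen ρ x * fishDen ρ p)) ^ ((N : ℝ) / 2 - 1) = q at *
    generalize Real.Gamma ((N : ℝ) / 2 - 1) = G1 at *
    have hpi : 0 < Real.pi ^ ((N : ℝ) / 2) := Real.rpow_pos_of_pos Real.pi_pos _
    generalize Real.pi ^ ((N : ℝ) / 2) = P at *
    have hnn : (N : ℝ) = 2 * (N / 2 - 1) + 2 := by ring
    generalize (N : ℝ) / 2 - 1 = e at *
    rw [hnn, add_sub_cancel_right]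
    field_simp
    norm_num

/-- The operator is invariant under s ↦ 1-s, the antipodal map. This turns the series at the
antipode into solutions in the distance from the source. -/
lemma zonalOp_comp_one_sub (N : ℕ) (lam : ℂ) (f : ℝ → ℂ) (s : ℝ) :
    zonalOp N lam (f (1 - s)) (deriv (fun t => f (1 - t)) s)
      (deriv (deriv fun t => f (1 - t)) s) s =
    zonalOp N lam (f (1 - s)) (deriv f (1 - s)) (deriv (deriv f) (1 - s)) (1 - s) := by
  have h1 : (deriv fun t => f (1 - t)) = fun t => -deriv f (1 - t) :=
    funext fun t => deriv_comp_const_sub (f := f) 1 t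
  have h2 : deriv (fun t => -deriv f (1 - t)) s = deriv (deriv f) (1 - s) := by
    rw [deriv.fun_neg, deriv_comp_const_sub (f := deriv f), neg_neg]
  rw [h1, h2]
  unfold zonalOp
  push_cast
  ring

lemma hyp_ofReal_derivs {c : ℝ} (hc : 0 < c) (a b : ℂ) {s : ℝ} (hs : |s| < 1) :
    deriv (fun t : ℝ => ordinaryHypergeometric a b (c : ℂ) (t : ℂ)) s =
      a * b / c * ordinaryHypergeometric (a + 1) (b + 1) ((c + 1 : ℝ) : ℂ) (s : ℂ) ∧
    deriv (deriv fun t : ℝ => ordinaryHypergeometric a b (c : ℂ) (t : ℂ)) s =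
      a * b / c * ((a + 1) * (b + 1) / (c + 1) *
        ordinaryHypergeometric (a + 2) (b + 2) ((c + 2 : ℝ) : ℂ) (s : ℂ)) := by
  have hz : ∀ t : ℝ, |t| < 1 → ‖(t : ℂ)‖ < 1 := fun t ht => by
    rwa [Complex.norm_real, Real.norm_eq_abs]
  have h1 : ∀ t : ℝ, |t| < 1 →
      deriv (fun t : ℝ => ordinaryHypergeometric a b (c : ℂ) (t : ℂ)) t =
      a * b / c * ordinaryHypergeometric (a + 1) (b + 1) ((c + 1 : ℝ) : ℂ) (t : ℂ) := fun t ht =>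
    (hasDerivAt_hyp hc a b (hz t ht)).comp_ofReal.deriv
  refine ⟨h1 s hs, ?_⟩
  have h2 : deriv (fun t : ℝ => ordinaryHypergeometric a b (c : ℂ) (t : ℂ)) =ᶠ[𝓝 s] fun t : ℝ =>
      a * b / c * ordinaryHypergeometric (a + 1) (b + 1) ((c + 1 : ℝ) : ℂ) (t : ℂ) := by
    filter_upwards [continuous_abs.continuousAt.eventually (gt_mem_nhds hs)] with t ht
    exact h1 t ht
  rw [h2.deriv_eq]
  have h3 := ((hasDerivAt_hyp (show 0 < c + 1 by linarith) (a + 1) (b + 1)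
    (hz s hs)).comp_ofReal.const_mul (a * b / c)).deriv
  rw [h3]
  have e1 : a + 1 + 1 = a + 2 := by ring
  have e2 : b + 1 + 1 = b + 2 := by ring
  have e3 : c + 1 + 1 = c + 2 := by ring
  rw [e1, e2, e3]
  push_cast
  rfl

lemma contDiffAt_hyp_ofReal {c : ℝ} (hc : 0 < c) (a b : ℂ) {s : ℝ} (hs : |s| < 1) :
    ContDiffAt ℝ 2 (fun t : ℝ => ordinaryHypergeometric a b (c : ℂ) (t : ℂ)) s := by
  have hz : (s : ℂ) ∈ Metric.ball (0 : ℂ) 1 := by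
    rwa [mem_ball_zero_iff, Complex.norm_real, Real.norm_eq_abs]
  have h := ((differentiableOn_hyp hc a b).contDiffOn (n := 2) Metric.isOpen_ball).contDiffAt
    (Metric.isOpen_ball.mem_nhds hz)
  exact (h.restrict_scalars ℝ).comp s Complex.ofRealCLM.contDiff.contDiffAt

lemma zonalOp_hyp {N : ℕ} (hN : 2 ≤ N) {a b lam : ℂ} (hab : a + b = N - 1)
    (hab' : a * b = N / 2 * (N / 2 - 1) - lam) {s : ℝ} (hs : |s| < 1) :
    zonalOp N lam (ordinaryHypergeometric a b (((N : ℝ) / 2 : ℝ) : ℂ) (s : ℂ))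
      (deriv (fun t : ℝ => ordinaryHypergeometric a b (((N : ℝ) / 2 : ℝ) : ℂ) (t : ℂ)) s)
      (deriv (deriv fun t : ℝ => ordinaryHypergeometric a b (((N : ℝ) / 2 : ℝ) : ℂ) (t : ℂ)) s)
      s = 0 := by
  have hc : (0 : ℝ) < (N : ℝ) / 2 := by
    have : (2 : ℝ) ≤ N := by exact_mod_cast hN
    linarith
  have hz : ‖(s : ℂ)‖ < 1 := by rwa [Complex.norm_real, Real.norm_eq_abs]
  obtain ⟨h1, h2⟩ := hyp_ofReal_derivs hc a b hs
  have h3 := hyp_ode hc a b hz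
  rw [h1, h2]
  unfold zonalOp
  clear h1 h2
  generalize ordinaryHypergeometric a b (((N : ℝ) / 2 : ℝ) : ℂ) (s : ℂ) = F0 at *
  generalize ordinaryHypergeometric (a + 1) (b + 1) (((N : ℝ) / 2 + 1 : ℝ) : ℂ) (s : ℂ) = F1 at *
  generalize ordinaryHypergeometric (a + 2) (b + 2) (((N : ℝ) / 2 + 2 : ℝ) : ℂ) (s : ℂ) = F2 at *
  push_cast at h3 ⊢
  linear_combination h3 + s * (a * b / (N / 2) * F1) * hab + F0 * hab'

lemma tendsto_hyp_zonalSing {N : ℕ} (hN : 2 ≤ N) {a b : ℂ} (hab : a + b = N - 1)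
    (ha : ∀ m : ℕ, a ≠ -m) (hb : ∀ m : ℕ, b ≠ -m) :
    Tendsto (fun s : ℝ => ordinaryHypergeometric a b (((N : ℝ) / 2 : ℝ) : ℂ) ((1 - s : ℝ) : ℂ) /
      (zonalSing N s : ℂ)) (𝓝[>] 0)
      (𝓝 (zonalSingConst N / (Complex.Gamma a * Complex.Gamma b))) := by
  have hl : Tendsto (fun s : ℝ => 1 - s) (𝓝[>] 0) (𝓝[<] 1) := by
    refine tendsto_nhdsWithin_iff.2 ⟨?_, ?_⟩
    · have : Tendsto (fun s : ℝ => 1 - s) (𝓝 0) (𝓝 (1 - 0)) := tendsto_const_nhds.sub tendsto_id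
      rw [sub_zero] at this
      exact this.mono_left nhdsWithin_le_nhds
    · filter_upwards [self_mem_nhdsWithin] with s hs
      have : (0 : ℝ) < s := hs
      simp only [Set.mem_Iio]
      linarith
  by_cases h : N = 2
  · subst h
    have h1 := (tendsto_hyp_one_log (by rw [hab]; norm_num) ha hb).comp hl
    rw [zonalSingConst, if_pos rfl, Complex.ofReal_one]
    refine h1.congr fun s => ?_
    simp [zonalSing]
  · have hN3 : (3 : ℝ) ≤ N := by exact_mod_cast (by omega : 3 ≤ N)
    have h1 := (tendsto_hyp_one (show 1 < (N : ℝ) / 2 by linarith)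
      (by rw [hab]; push_cast; ring) ha hb).comp hl
    have e : (zonalSingConst N : ℂ) = Complex.Gamma (((N : ℝ) / 2 : ℝ) : ℂ) *
        Complex.Gamma ((((N : ℝ) / 2 : ℝ) : ℂ) - 1) := by
      rw [zonalSingConst, if_neg h, Complex.ofReal_mul, ← Complex.Gamma_ofReal,
        ← Complex.Gamma_ofReal, Complex.ofReal_sub, Complex.ofReal_one]
    rw [e]
    refine h1.congr' ?_
    filter_upwards [self_mem_nhdsWithin] with s hs
    have hs : (0 : ℝ) < s := hs
    simp only [Function.comp_apply, sub_sub_cancel, zonalSing, if_neg h]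
    rw [show s ^ (1 - (N : ℝ) / 2) = (s ^ ((N : ℝ) / 2 - 1))⁻¹ by
      rw [← Real.rpow_neg hs.le, neg_sub], Complex.ofReal_inv, div_inv_eq_mul]

/-! ### Nonexistence at the exceptional value and uniqueness elsewhere -/

/-- Shells about p must avoid both r' and infinity. Infinity lies at positive distance from p; r' is
either p itself, inside every shell, or outside all small ones. -/
lemma exists_fishSin_separation {N : ℕ} (hN : 2 ≤ N) {ρ : ℝ} (hρ : 0 < ρ)
    (p r' : EuclideanSpace ℝ (Fin N)) :
    ∃ δ₀ : ℝ, 0 < δ₀ ∧ ∃ x₁ : EuclideanSpace ℝ (Fin N), δ₀ ≤ fishSin ρ p x₁ ∧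
      ∀ α : ℝ, 0 < α → ∃ ε : ℝ, 0 < ε ∧ ∀ x, fishSin ρ r' x < ε ∨ fishSinInfty ρ x < ε →
        fishSin ρ p x ≤ α ∨ δ₀ ≤ fishSin ρ p x := by
  obtain ⟨ε₂, hε₂, hsep⟩ := exists_fishSin_lt_le_fishSinInfty hρ p
  have hinf : ∀ x, fishSinInfty ρ x < ε₂ → ε₂ ≤ fishSin ρ p x := fun x hx => by
    by_contra hcon
    push Not at hcon
    linarith [hsep x hcon]
  have : Nonempty (Fin N) := ⟨⟨0, by omega⟩⟩
  by_cases h : p = r'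
  · obtain ⟨x₁, hx₁⟩ := exists_ne p
    have hx := fishSin_pos hρ hx₁
    refine ⟨min ε₂ (fishSin ρ p x₁), lt_min hε₂ hx, x₁, min_le_right _ _,
      fun α hα => ⟨min α ε₂, lt_min hα hε₂, fun x hx => ?_⟩⟩
    simp only [lt_min_iff] at hx
    rcases hx with hx | hx
    · exact Or.inl (h ▸ hx.1.le)
    · exact Or.inr ((min_le_left _ _).trans (hinf x hx.2))
  · have hx := fishSin_pos hρ (fun e => h e.symm : r' ≠ p)
    obtain ⟨ε₃, hε₃, h3⟩ := exists_fishSin_lt_of_eventually hρ (p := r')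
      (((contDiff_fishSin hρ p).continuous.tendsto r').eventually
        (lt_mem_nhds (half_lt_self hx)))
    refine ⟨min ε₂ (fishSin ρ p r' / 2), lt_min hε₂ (half_pos hx), r',
      (min_le_right _ _).trans (half_le_self hx.le),
      fun α hα => ⟨min ε₃ ε₂, lt_min hε₃ hε₂, fun x hx => Or.inr ?_⟩⟩
    simp only [lt_min_iff] at hx
    rcases hx with hx | hx
    · exact (min_le_right _ _).trans (h3 x hx.1).le
    · exact (min_le_left _ _).trans (hinf x hx.2)

/-- Zonal polynomial solutions at the exceptional values. -/
lemma exists_zonal_polynomial {N : ℕ} (hN : 2 ≤ N) (n : ℕ) {lam : ℂ}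
    (hlam : lam = (n + N / 2) * (n + N / 2 - 1)) :
    ∃ g : ℝ → ℂ, ContDiff ℝ 2 g ∧ g 0 = 1 ∧ ∀ σ ∈ Set.Ioc (0 : ℝ) 1,
      zonalOp N lam (g σ) (deriv g σ) (deriv (deriv g) σ) σ = 0 := by
  set a : ℂ := n + N - 1 with ha
  set b : ℂ := -n with hb
  -- The parameter b = -n annihilates the recurrence at k = n, so the series terminates; a and b
  -- solve a + b = N-1, ab = (N/2)(N/2-1) - λ₀.
  have hco : ∀ k, n < k → hypCoeff a b (((N : ℝ) / 2 : ℝ) : ℂ) k = 0 := by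
    intro k hk
    induction k, hk using Nat.le_induction with
    | base => rw [hypCoeff_succ, hb]; simp
    | succ k _ ih => rw [hypCoeff_succ, ih, zero_mul]
  set g : ℝ → ℂ := fun s => ∑ k ∈ Finset.range (n + 1),
    hypCoeff a b (((N : ℝ) / 2 : ℝ) : ℂ) k * (s : ℂ) ^ k with hg
  have hgF : g = fun s : ℝ => ordinaryHypergeometric a b (((N : ℝ) / 2 : ℝ) : ℂ) (s : ℂ) := by
    funext s
    rw [hyp_eq_tsum, tsum_eq_sum (s := Finset.range (n + 1))]
    intro k hk
    rw [hco k (by simpa using hk), zero_mul]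
  have hgc : ContDiff ℝ 2 g := by
    refine ContDiff.sum fun k _ => contDiff_const.mul (Complex.ofRealCLM.contDiff.pow k)
  refine ⟨g, hgc, by simp [hg, Finset.sum_range_succ', hypCoeff_zero], ?_⟩
  have hlt : ∀ σ : ℝ, |σ| < 1 → zonalOp N lam (g σ) (deriv g σ) (deriv (deriv g) σ) σ = 0 := by
    intro σ hσ
    rw [hgF]
    refine zonalOp_hyp hN (by rw [ha, hb]; ring) (by rw [ha, hb, hlam]; ring) hσ
  intro σ hσ
  rcases lt_or_eq_of_le hσ.2 with h | h
  · exact hlt σ (abs_lt.2 ⟨by linarith [hσ.1], h⟩)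
  · subst h
    -- The series argument needs |σ| < 1; the equation at the antipode σ = 1 follows by continuity,
    -- g being a polynomial.
    have hcont : ContinuousAt
        (fun σ => zonalOp N lam (g σ) (deriv g σ) (deriv (deriv g) σ) σ) 1 := by
      have h0 := hgc.continuous.continuousAt (x := (1 : ℝ))
      have h1 := (hgc.contDiffAt (x := (1 : ℝ))).continuousAt_deriv_two
      have h2 : ContinuousAt (fun σ : ℝ => (σ : ℂ)) 1 := Complex.continuous_ofReal.continuousAt
      exact (((h2.mul (continuousAt_const.sub h2)).mul h1.2).add ((continuousAt_const.mul
        (continuousAt_const.sub (continuousAt_const.mul h2))).mul h1.1)).add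
        (continuousAt_const.mul h0)
    have hl : Tendsto (fun σ => zonalOp N lam (g σ) (deriv g σ) (deriv (deriv g) σ) σ)
        (𝓝[<] 1) (𝓝 0) := by
      refine (tendsto_const_nhds (x := (0 : ℂ))).congr' ?_
      filter_upwards [Ioo_mem_nhdsLT (show (0 : ℝ) < 1 by norm_num)] with t ht
      exact (hlt t (abs_lt.2 ⟨by linarith [ht.1], ht.2⟩)).symm
    exact tendsto_nhds_unique (hcont.tendsto.mono_left nhdsWithin_le_nhds) hl

/-- With the polynomial solution g, nonzero at the source, the real part of -G/(m g) exceeds (d/2)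
`zonalSing` on small shells about r', while its mean over every small shell is one fixed number. -/
lemma not_exists_isFishEyeGreen {N : ℕ} (hN : 2 ≤ N) {ρ : ℝ} (hρ : 0 < ρ) (n : ℕ) {lam : ℂ}
    (hlam : lam = (n + N / 2) * (n + N / 2 - 1)) (r' : EuclideanSpace ℝ (Fin N)) :
    ¬ ∃ G, IsFishEyeGreen N ρ lam r' G := by
  rintro ⟨G, hG, heq, hsrc, C, hinf⟩
  obtain ⟨C', ε, hε, hbd⟩ := exists_bound_fishFactor hN hρ hinf
  obtain ⟨g, hgc, hg0, hgo⟩ := exists_zonal_polynomial hN n hlam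
  obtain ⟨δ₀, hδ₀, x₁, hx₁, hsep⟩ := exists_fishSin_separation hN hρ r' r'
  obtain ⟨δ₁, hδ₁, hgne⟩ := Metric.eventually_nhds_iff.1
    (hgc.continuous.continuousAt.eventually_ne (show g 0 ≠ 0 by rw [hg0]; exact one_ne_zero))
  set δ := min (min δ₀ δ₁) 1 with hδ
  have hδ0 : 0 < δ := by positivity
  have hδδ₀ : δ ≤ δ₀ := (min_le_left _ _).trans (min_le_left _ _)
  have hδδ₁ : δ ≤ δ₁ := (min_le_left _ _).trans (min_le_right _ _)
  obtain ⟨J, hJ⟩ := exists_zonal_mean hN hρ hG heq (Or.inl rfl) hε hbd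
    (fun σ _ => hgc.contDiffAt) hgo hδ0 (min_le_right _ _)
    (fun σ hσ => hgne (by
      rw [Real.dist_0_eq_abs, abs_of_pos hσ.1]; exact hσ.2.trans_le hδδ₁))
    (hδδ₀.trans hx₁) fun α hα => by
      obtain ⟨e, he, h⟩ := hsep α hα
      exact ⟨e, he, fun x hx => (h x hx).imp id fun h => hδδ₀.trans h⟩
  obtain ⟨φ, hφ, hGφ⟩ := hsrc.exists_eq_mul
  have hm := fishFactor_pos hρ r'
  have hκ := sourceRatio_pos hN hρ r'
  -- The limit of -G/(m g) divided by the singularity at the source; only its positivity matters.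
  set d := sourceRatio N ρ r' / fishFactor ρ r' with hd
  have hd0 : 0 < d := by positivity
  have hlim : Tendsto (fun x => (-1 * (G x / (fishFactor ρ x * g (fishSin ρ r' x)))).re /
      zonalSing N (fishSin ρ r' x)) (𝓝[≠] r') (𝓝 d) := by
    have h1 : Tendsto (fun x => (fishFactor ρ x : ℂ) * g (fishSin ρ r' x)) (𝓝[≠] r')
        (𝓝 (fishFactor ρ r' * 1)) := by
      have : ContinuousAt (fun x => (fishFactor ρ x : ℂ) * g (fishSin ρ r' x)) r' :=
        (contDiff_fishFactor hρ).continuous.continuousAt.mul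
          (hgc.continuous.comp (contDiff_fishSin hρ r').continuous).continuousAt
      have h2 := this.tendsto.mono_left (nhdsWithin_le_nhds (s := {r'}ᶜ))
      rwa [fishSin_self, hg0] at h2
    have h2 := ((hφ.mul ((Complex.continuous_ofReal.tendsto _).comp
      (tendsto_source_ratio hN hρ r'))).neg.div h1
      (by rw [mul_one]; exact Complex.ofReal_ne_zero.2 hm.ne'))
    have h3 := (Complex.continuous_re.tendsto _).comp h2
    have e : (-(1 * ((-sourceRatio N ρ r' : ℝ) : ℂ)) / ((fishFactor ρ r' : ℂ) * 1)).re = d := by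
      rw [one_mul, mul_one, ← Complex.ofReal_neg, ← Complex.ofReal_div, Complex.ofReal_re, neg_neg]
    rw [e] at h3
    refine h3.congr' ?_
    filter_upwards [hGφ] with x hx
    simp only [Function.comp_apply]
    rw [hx, ← Complex.div_ofReal_re]
    congr 1
    simp only [Pi.mul_apply, Pi.div_apply]
    push_cast
    ring
  obtain ⟨ε₄, hε₄, h4⟩ := exists_fishSin_lt_of_eventually_ne hρ
    (hlim.eventually (lt_mem_nhds (half_lt_self hd0)))
  have h5 : ∀ τ : ℝ, 0 < τ → 3 * τ / 2 < min ε₄ δ →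
      d / 2 * zonalSing N (3 * τ / 2) ≤ (-1 * J).re := by
    intro τ hτ hτ'
    rw [lt_min_iff] at hτ'
    refine hJ τ hτ hτ'.2 _ _ fun x hx => ?_
    have hx0 : 0 < fishSin ρ r' x := by linarith [hx.1]
    have hx1 : fishSin ρ r' x < 1 := hx.2.trans (hτ'.2.trans_le (min_le_right _ _))
    have h6 := h4 x hx0 (hx.2.trans hτ'.1)
    rw [lt_div_iff₀ (zonalSing_pos N hx0 hx1)] at h6
    refine le_trans ?_ h6.le
    exact mul_le_mul_of_nonneg_left (zonalSing_le hN hx0 hx.2.le) (by positivity)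
  have h6 := (tendsto_zonalSing hN).eventually_gt_atTop ((-1 * J).re / (d / 2))
  have h7 : ∀ᶠ t : ℝ in 𝓝[>] 0, t < min ε₄ δ :=
    nhdsWithin_le_nhds (gt_mem_nhds (by positivity))
  obtain ⟨t, ⟨ht1, ht2⟩, ht3⟩ := ((h6.and h7).and self_mem_nhdsWithin).exists
  have ht3 : (0 : ℝ) < t := ht3
  have h8 := h5 (2 * t / 3) (by positivity) (by rw [show 3 * (2 * t / 3) / 2 = t by ring]; exact ht2)
  rw [show 3 * (2 * t / 3) / 2 = t by ring] at h8
  rw [div_lt_iff₀ (by positivity)] at ht1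
  linarith

/-- The difference of two Green's functions is negligible at the source. -/
lemma isNegligible_of_isLittleO_source {N : ℕ} (hN : 2 ≤ N) {ρ : ℝ} (hρ : 0 < ρ)
    {r' : EuclideanSpace ℝ (Fin N)} {u : EuclideanSpace ℝ (Fin N) → ℂ}
    (hu : u =o[𝓝[≠] r'] fun r => ((sourceSingularity N ‖r - r'‖ : ℝ) : ℂ)) :
    IsNegligible ρ 1 u (fishSin ρ r') := by
  intro η hη
  have hκ := sourceRatio_pos hN hρ r'
  have hm := fishFactor_pos hρ r'
  have h1 : ∀ᶠ x in 𝓝[≠] r', |sourceSingularity N ‖x - r'‖ / zonalSing N (fishSin ρ r' x)| <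
      2 * sourceRatio N ρ r' := by
    have := (tendsto_source_ratio hN hρ r').abs
    rw [abs_neg, abs_of_pos hκ] at this
    exact this.eventually (gt_mem_nhds (by linarith))
  have h2 : ∀ᶠ x : EuclideanSpace ℝ (Fin N) in 𝓝[≠] r', fishFactor ρ r' / 2 < fishFactor ρ x := by
    have h3 : Continuous fun x : EuclideanSpace ℝ (Fin N) => (fishFactor ρ x : ℂ) :=
      (contDiff_fishFactor hρ).continuous
    exact ((Complex.continuous_re.comp h3).tendsto r').mono_left nhdsWithin_le_nhds |>.eventually
      (lt_mem_nhds (half_lt_self hm))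
  have h3 := hu.def (c := η * (fishFactor ρ r' / 2) / (2 * sourceRatio N ρ r')) (by positivity)
  obtain ⟨ε, hε, h⟩ := exists_fishSin_lt_of_eventually_ne hρ (h1.and (h2.and h3))
  refine ⟨min ε 1, by positivity, fun x hx0 hx1 => Or.inr ?_⟩
  rw [lt_min_iff] at hx1
  obtain ⟨a1, a2, a3⟩ := h x hx0 hx1.1
  have hZ := zonalSing_pos N hx0 hx1.2
  rw [abs_div, abs_of_pos hZ, div_lt_iff₀ hZ] at a1
  rw [Complex.norm_real, Real.norm_eq_abs] at a3
  calc ‖u x‖ ≤ η * (fishFactor ρ r' / 2) / (2 * sourceRatio N ρ r') *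
        |sourceSingularity N ‖x - r'‖| := a3
    _ ≤ η * (fishFactor ρ r' / 2) / (2 * sourceRatio N ρ r') *
        (2 * sourceRatio N ρ r' * zonalSing N (fishSin ρ r' x)) := by gcongr
    _ = η * (zonalSing N (fishSin ρ r' x) * (fishFactor ρ r' / 2)) := by field_simp
    _ ≤ _ := by gcongr

/-- Away from the exceptional values a solution with negligible singularity vanishes. -/
lemma eq_zero_of_isNegligible {N : ℕ} (hN : 2 ≤ N) {ρ : ℝ} (hρ : 0 < ρ) {a b lam : ℂ}
    (hab : a + b = N - 1) (hab' : a * b = N / 2 * (N / 2 - 1) - lam)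
    (ha : ∀ m : ℕ, a ≠ -m) (hb : ∀ m : ℕ, b ≠ -m)
    {r' p : EuclideanSpace ℝ (Fin N)} (hp : p ≠ r') {u : EuclideanSpace ℝ (Fin N) → ℂ}
    (hu : ContDiffOn ℝ 2 u {r'}ᶜ)
    (heq : ∀ r, r ≠ r' → Laplacian.laplacian u r +
      4 * lam * (ρ : ℂ) ^ 2 / ((fishDen ρ r ^ 2 : ℝ) : ℂ) * u r = 0)
    (hsrc : IsNegligible ρ 1 u (fishSin ρ r'))
    {C ε : ℝ} (hε : 0 < ε) (hinf : ∀ x, fishSinInfty ρ x < ε → ‖u x‖ ≤ C * fishFactor ρ x) :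
    u p = 0 := by
  by_contra hup
  have hc : (0 : ℝ) < (N : ℝ) / 2 := by
    have : (2 : ℝ) ≤ N := by exact_mod_cast hN
    linarith
  set g : ℝ → ℂ := fun s => ordinaryHypergeometric a b (((N : ℝ) / 2 : ℝ) : ℂ) ((1 - s : ℝ) : ℂ)
    with hg
  have habs : ∀ σ ∈ Set.Ioc (0 : ℝ) 1, |1 - σ| < 1 := fun σ hσ =>
    abs_lt.2 ⟨by linarith [hσ.2], by linarith [hσ.1]⟩
  have hgc : ∀ σ ∈ Set.Ioc (0 : ℝ) 1, ContDiffAt ℝ 2 g σ := fun σ hσ =>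
    ContDiffAt.comp (g := fun t : ℝ => ordinaryHypergeometric a b (((N : ℝ) / 2 : ℝ) : ℂ) (t : ℂ))
      σ (contDiffAt_hyp_ofReal hc a b (habs σ hσ)) (contDiffAt_const.sub contDiffAt_id)
  have hgo : ∀ σ ∈ Set.Ioc (0 : ℝ) 1,
      zonalOp N lam (g σ) (deriv g σ) (deriv (deriv g) σ) σ = 0 := fun σ hσ => by
    have h1 := zonalOp_comp_one_sub N lam
      (fun t : ℝ => ordinaryHypergeometric a b (((N : ℝ) / 2 : ℝ) : ℂ) (t : ℂ)) σ
    exact h1.trans (zonalOp_hyp hN hab hab' (habs σ hσ))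
  set K : ℂ := zonalSingConst N / (Complex.Gamma a * Complex.Gamma b) with hK
  have hK0 : K ≠ 0 := div_ne_zero (Complex.ofReal_ne_zero.2 (zonalSingConst_pos hN).ne')
    (mul_ne_zero (Complex.Gamma_ne_zero ha) (Complex.Gamma_ne_zero hb))
  have hgK : Tendsto (fun s => g s / (zonalSing N s : ℂ)) (𝓝[>] 0) (𝓝 K) :=
    tendsto_hyp_zonalSing hN hab ha hb
  obtain ⟨δ₁, hδ₁, hgne⟩ : ∃ δ₁ : ℝ, 0 < δ₁ ∧ ∀ σ ∈ Set.Ioo 0 δ₁, g σ ≠ 0 := by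
    have h1 := hgK.eventually_ne hK0
    rw [eventually_nhdsWithin_iff, Metric.eventually_nhds_iff] at h1
    obtain ⟨e, he, h1⟩ := h1
    refine ⟨e, he, fun σ hσ h0 => ?_⟩
    exact h1 (by rw [Real.dist_0_eq_abs, abs_of_pos hσ.1]; exact hσ.2) hσ.1 (by rw [h0, zero_div])
  obtain ⟨δ₀, hδ₀, x₁, hx₁, hsep⟩ := exists_fishSin_separation hN hρ p r'
  set δ := min (min δ₀ δ₁) 1 with hδ
  have hδ0 : 0 < δ := by positivity
  have hδδ₀ : δ ≤ δ₀ := (min_le_left _ _).trans (min_le_left _ _)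
  have hδδ₁ : δ ≤ δ₁ := (min_le_left _ _).trans (min_le_right _ _)
  obtain ⟨J, hJ⟩ := exists_zonal_mean hN hρ hu heq (Or.inr hsrc) hε hinf hgc hgo hδ0
    (min_le_right _ _) (fun σ hσ => hgne σ ⟨hσ.1, hσ.2.trans_le hδδ₁⟩)
    (hδδ₀.trans hx₁) fun α hα => by
      obtain ⟨e, he, h⟩ := hsep α hα
      exact ⟨e, he, fun x hx => (h x hx).imp id fun h => hδδ₀.trans h⟩
  have hm := fishFactor_pos hρ p
  set d := ‖u p‖ ^ 2 / fishFactor ρ p with hd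
  have hd0 : 0 < d := by
    have : 0 < ‖u p‖ := norm_pos_iff.2 hup
    positivity
  -- This rotates the quotient: c u/(m g) is asymptotic to the positive quantity (|u(p)|²/m(p)) /
  -- `zonalSing` at p.
  set c : ℂ := (starRingEnd ℂ) (u p) * K with hcdef
  have hlim : Tendsto (fun x => (c * (u x / (fishFactor ρ x * g (fishSin ρ p x)))).re *
      zonalSing N (fishSin ρ p x)) (𝓝[≠] p) (𝓝 d) := by
    have h1 : Tendsto (fun x => u x / (fishFactor ρ x : ℂ)) (𝓝[≠] p)
        (𝓝 (u p / fishFactor ρ p)) := by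
      have : ContinuousAt (fun x => u x / (fishFactor ρ x : ℂ)) p :=
        (hu.continuousOn.continuousAt (isOpen_compl_singleton.mem_nhds hp)).div
          (contDiff_fishFactor hρ).continuous.continuousAt (Complex.ofReal_ne_zero.2 hm.ne')
      exact this.tendsto.mono_left nhdsWithin_le_nhds
    have h2 := (((hgK.comp (tendsto_fishSin hρ p)).inv₀ hK0).const_mul c).mul h1
    have h3 := (Complex.continuous_re.tendsto _).comp h2
    have e : (c * K⁻¹ * (u p / fishFactor ρ p)).re = d := by
      rw [hcdef, mul_assoc, mul_assoc, ← mul_assoc K, mul_inv_cancel₀ hK0, one_mul, mul_div_assoc',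
        ← Complex.normSq_eq_conj_mul_self, ← Complex.ofReal_div, Complex.ofReal_re,
        Complex.normSq_eq_norm_sq]
    rw [e] at h3
    refine h3.congr fun x => ?_
    simp only [Function.comp_apply]
    rw [← Complex.re_mul_ofReal, inv_div]
    congr 1
    rw [div_eq_mul_inv, div_eq_mul_inv, div_eq_mul_inv, mul_inv]
    ring
  obtain ⟨ε₄, hε₄, h4⟩ := exists_fishSin_lt_of_eventually_ne hρ
    ((hlim.eventually (lt_mem_nhds (half_lt_self hd0))).and
      (hlim.eventually (gt_mem_nhds (show d < 2 * d by linarith))))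
  -- The first bound makes the mean strictly positive, the second sends it to 0 as the shell
  -- shrinks; since it is constant, these are incompatible.
  have h5 : ∀ τ : ℝ, 0 < τ → 3 * τ / 2 < min ε₄ δ →
      0 < (c * J).re ∧ (c * J).re ≤ 2 * d / zonalSing N (3 * τ / 2) := by
    intro τ hτ hτ'
    rw [lt_min_iff] at hτ'
    have hδ1 : δ ≤ 1 := min_le_right _ _
    have hZ1 := zonalSing_pos N (half_pos hτ) (by linarith)
    have hZ2 := zonalSing_pos N (show 0 < 3 * τ / 2 by linarith) (by linarith)
    constructor
    · refine (show 0 < d / 2 / zonalSing N (τ / 2) by positivity).trans_le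
        (hJ τ hτ hτ'.2 _ _ fun x hx => ?_)
      have hx0 : 0 < fishSin ρ p x := by linarith [hx.1]
      have hZ := zonalSing_pos N hx0 (by linarith [hx.2])
      have h6 := (h4 x hx0 (hx.2.trans hτ'.1)).1
      rw [← div_lt_iff₀ hZ] at h6
      refine le_trans ?_ h6.le
      gcongr
      exact zonalSing_le hN (half_pos hτ) hx.1.le
    · have h7 : -(2 * d / zonalSing N (3 * τ / 2)) ≤ (-c * J).re :=
        hJ τ hτ hτ'.2 _ _ fun x hx => by
          have hx0 : 0 < fishSin ρ p x := by linarith [hx.1]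
          have hZ := zonalSing_pos N hx0 (by linarith [hx.2])
          have h6 := (h4 x hx0 (hx.2.trans hτ'.1)).2
          rw [← lt_div_iff₀ hZ] at h6
          rw [neg_mul, Complex.neg_re]
          refine neg_le_neg (h6.le.trans ?_)
          gcongr
          exact zonalSing_le hN hx0 hx.2.le
      rw [neg_mul, Complex.neg_re] at h7
      exact neg_le_neg_iff.1 h7
  have h7 : ∀ᶠ t : ℝ in 𝓝[>] 0, t < min ε₄ δ :=
    nhdsWithin_le_nhds (gt_mem_nhds (by positivity))
  have h8 : ∀ t : ℝ, 0 < t → t < min ε₄ δ → 0 < (c * J).re ∧ (c * J).re ≤ 2 * d / zonalSing N t := by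
    intro t h1 h2
    have := h5 (2 * t / 3) (by positivity) (by rw [show 3 * (2 * t / 3) / 2 = t by ring]; exact h2)
    rwa [show 3 * (2 * t / 3) / 2 = t by ring] at this
  obtain ⟨t₀, ht₀, ht₀'⟩ := (h7.and self_mem_nhdsWithin).exists
  have hpos := (h8 t₀ ht₀' ht₀).1
  have hle : (c * J).re ≤ 0 := by
    have h9 : Tendsto (fun t => 2 * d / zonalSing N t) (𝓝[>] 0) (𝓝 0) :=
      tendsto_const_nhds.div_atTop (tendsto_zonalSing hN)
    refine ge_of_tendsto h9 ?_
    filter_upwards [h7, self_mem_nhdsWithin] with t ht ht' using (h8 t ht' ht).2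
  linarith

lemma IsFishEyeGreen.eq_of_ne {N : ℕ} (hN : 2 ≤ N) {ρ : ℝ} (hρ : 0 < ρ) {a b lam : ℂ}
    (hab : a + b = N - 1) (hab' : a * b = N / 2 * (N / 2 - 1) - lam)
    (ha : ∀ m : ℕ, a ≠ -m) (hb : ∀ m : ℕ, b ≠ -m) {r' : EuclideanSpace ℝ (Fin N)}
    {G₁ G₂ : EuclideanSpace ℝ (Fin N) → ℂ} (h₁ : IsFishEyeGreen N ρ lam r' G₁)
    (h₂ : IsFishEyeGreen N ρ lam r' G₂) {r : EuclideanSpace ℝ (Fin N)} (hr : r ≠ r') :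
    G₁ r = G₂ r := by
  obtain ⟨C₁, hC₁⟩ := h₁.infinity
  obtain ⟨C₂, hC₂⟩ := h₂.infinity
  have hinf : Tendsto (fun r : EuclideanSpace ℝ (Fin N) => ((‖r‖ ^ (N - 2) : ℝ) : ℂ) *
      (G₁ r - G₂ r)) (Bornology.cobounded (EuclideanSpace ℝ (Fin N))) (𝓝 (C₁ - C₂)) := by
    simpa only [mul_sub] using hC₁.sub hC₂
  obtain ⟨C, ε, hε, hbd⟩ := exists_bound_fishFactor hN hρ hinf
  have hne : ∀ x, x ≠ r' → ∀ {G : EuclideanSpace ℝ (Fin N) → ℂ}, ContDiffOn ℝ 2 G {r'}ᶜ →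
      ContDiffAt ℝ 2 G x := fun x hx G hG => hG.contDiffAt (isOpen_compl_singleton.mem_nhds hx)
  refine sub_eq_zero.1 (eq_zero_of_isNegligible hN hρ hab hab' ha hb hr
    (u := fun r => G₁ r - G₂ r) (h₁.contDiffOn.sub h₂.contDiffOn) (fun x hx => ?_) ?_ hε hbd)
  · have h3 : Laplacian.laplacian (fun r => G₁ r - G₂ r) x =
        Laplacian.laplacian G₁ x - Laplacian.laplacian G₂ x :=
      (hne x hx h₁.contDiffOn).laplacian_sub (hne x hx h₂.contDiffOn)
    rw [h3]
    have e1 := h₁.equation x hx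
    have e2 := h₂.equation x hx
    unfold fishDen
    linear_combination e1 - e2
  · refine isNegligible_of_isLittleO_source hN hρ ?_
    have := h₁.source.isLittleO.sub h₂.source.isLittleO
    refine this.congr_left fun x => ?_
    simp

/-! ### The explicit Green's function -/

/-- The zonal solution that is regular at the image point. -/
def zonalHyp (N : ℕ) (ν : ℂ) (s : ℝ) : ℂ :=
  ordinaryHypergeometric ((N : ℂ) / 2 + ν) ((N : ℂ) / 2 - 1 - ν) (((N : ℝ) / 2 : ℝ) : ℂ)
    ((1 - s : ℝ) : ℂ)

lemma contDiffAt_zonalHyp {N : ℕ} (hN : 2 ≤ N) (ν : ℂ) {σ : ℝ} (hσ : σ ∈ Set.Ioc (0 : ℝ) 1) :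
    ContDiffAt ℝ 2 (zonalHyp N ν) σ := by
  have hc : (0 : ℝ) < (N : ℝ) / 2 := by
    have : (2 : ℝ) ≤ N := by exact_mod_cast hN
    linarith
  exact ContDiffAt.comp (g := fun t : ℝ => ordinaryHypergeometric ((N : ℂ) / 2 + ν)
    ((N : ℂ) / 2 - 1 - ν) (((N : ℝ) / 2 : ℝ) : ℂ) (t : ℂ)) σ
    (contDiffAt_hyp_ofReal hc _ _ (abs_lt.2 ⟨by linarith [hσ.2], by linarith [hσ.1]⟩))
    (contDiffAt_const.sub contDiffAt_id)

lemma zonalOp_zonalHyp {N : ℕ} (hN : 2 ≤ N) (ν : ℂ) {σ : ℝ} (hσ : σ ∈ Set.Ioc (0 : ℝ) 1) :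
    zonalOp N (ν * (ν + 1)) (zonalHyp N ν σ) (deriv (zonalHyp N ν) σ)
      (deriv (deriv (zonalHyp N ν)) σ) σ = 0 := by
  have h1 := zonalOp_comp_one_sub N (ν * (ν + 1)) (fun t : ℝ => ordinaryHypergeometric
    ((N : ℂ) / 2 + ν) ((N : ℂ) / 2 - 1 - ν) (((N : ℝ) / 2 : ℝ) : ℂ) (t : ℂ)) σ
  exact h1.trans (zonalOp_hyp hN (by ring) (by ring)
    (abs_lt.2 ⟨by linarith [hσ.2], by linarith [hσ.1]⟩))

/-- The constant and conformal factors of the Green's function. -/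
def greenFactor {N : ℕ} (ρ : ℝ) (r r' : EuclideanSpace ℝ (Fin N)) : ℝ :=
  -(ρ ^ (N - 2) * (fishFactor ρ r * fishFactor ρ r') /
    (4 * Real.pi ^ ((N : ℝ) / 2) * Real.Gamma ((N : ℝ) / 2)))

/-- The explicit Green's function away from the exceptional values. -/
def explicitGreen {N : ℕ} (ρ : ℝ) (ν : ℂ) (r' r : EuclideanSpace ℝ (Fin N)) : ℂ :=
  Complex.Gamma ((N : ℂ) / 2 + ν) * Complex.Gamma ((N : ℂ) / 2 - 1 - ν) *
    (greenFactor ρ r r' * zonalHyp N ν (fishSin ρ r' r))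

/-- The normalization check: at the source the conformal factors and the connection constant
reproduce the unit source singularity. -/
lemma greenFactor_self {N : ℕ} (hN : 2 ≤ N) {ρ : ℝ} (hρ : 0 < ρ) (p : EuclideanSpace ℝ (Fin N)) :
    greenFactor ρ p p * zonalSingConst N = -sourceRatio N ρ p := by
  have hA := fishDen_pos hρ p
  have e : (ρ ^ 2 / (fishDen ρ p * fishDen ρ p)) ^ ((N : ℝ) / 2 - 1) =
      ρ ^ (N - 2) * (fishFactor ρ p * fishFactor ρ p) := by
    rw [Real.div_rpow (by positivity) (by positivity), Real.mul_rpow hA.le hA.le,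
      ← Real.rpow_natCast ρ 2, ← Real.rpow_mul hρ.le, ← Real.rpow_natCast ρ (N - 2),
      Nat.cast_sub hN, fishFactor, show (1 : ℝ) - N / 2 = -(N / 2 - 1) by ring,
      Real.rpow_neg hA.le, div_eq_mul_inv, mul_inv]
    congr 2
    push_cast
    ring
  rw [sourceRatio, greenFactor, e]
  ring

/-- Infinity is an ordinary point of the sphere: s has a positive limit there because |x-p| and |x|
differ by at most |p|, which is negligible against √(r² + ρ²). -/
lemma tendsto_fishSin_cobounded {N : ℕ} {ρ : ℝ} (hρ : 0 < ρ) (p : EuclideanSpace ℝ (Fin N)) :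
    Tendsto (fun x : EuclideanSpace ℝ (Fin N) => ‖x‖ ^ 2 / fishDen ρ x)
      (Bornology.cobounded _) (𝓝 1) ∧
    Tendsto (fishSin ρ p) (Bornology.cobounded _) (𝓝 (ρ ^ 2 / fishDen ρ p)) := by
  have hP := fishDen_pos hρ p
  have hn : Tendsto (fun x : EuclideanSpace ℝ (Fin N) => ‖x‖) (Bornology.cobounded _) atTop :=
    tendsto_norm_cobounded_atTop
  have hA : Tendsto (fun x : EuclideanSpace ℝ (Fin N) => fishDen ρ x) (Bornology.cobounded _)
      atTop := tendsto_atTop_add_const_right _ _ ((tendsto_pow_atTop two_ne_zero).comp hn)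
  have h1 : Tendsto (fun x : EuclideanSpace ℝ (Fin N) => ‖x‖ ^ 2 / fishDen ρ x)
      (Bornology.cobounded _) (𝓝 1) := by
    have h2 : Tendsto (fun x : EuclideanSpace ℝ (Fin N) => 1 - ρ ^ 2 / fishDen ρ x)
        (Bornology.cobounded _) (𝓝 (1 - 0)) :=
      tendsto_const_nhds.sub (tendsto_const_nhds.div_atTop hA)
    rw [sub_zero] at h2
    refine h2.congr fun x => ?_
    have := fishDen_pos hρ x
    rw [eq_div_iff this.ne', sub_mul, div_mul_cancel₀ _ this.ne']
    unfold fishDen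
    ring
  refine ⟨h1, ?_⟩
  have hsA : Tendsto (fun x : EuclideanSpace ℝ (Fin N) => Real.sqrt (fishDen ρ x))
      (Bornology.cobounded _) atTop := Real.tendsto_sqrt_atTop.comp hA
  have h3 : Tendsto (fun x : EuclideanSpace ℝ (Fin N) => ‖x‖ / Real.sqrt (fishDen ρ x))
      (Bornology.cobounded _) (𝓝 1) := by
    have := h1.sqrt
    rw [Real.sqrt_one] at this
    refine this.congr fun x => ?_
    rw [Real.sqrt_div (by positivity), Real.sqrt_sq (norm_nonneg _)]
  have h4 : Tendsto (fun x : EuclideanSpace ℝ (Fin N) =>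
      (‖x - p‖ - ‖x‖) / Real.sqrt (fishDen ρ x)) (Bornology.cobounded _) (𝓝 0) := by
    refine squeeze_zero_norm (fun x => ?_) ((tendsto_const_nhds (x := ‖p‖)).div_atTop hsA)
    rw [norm_div, Real.norm_of_nonneg (Real.sqrt_nonneg _)]
    gcongr
    have := abs_norm_sub_norm_le (x - p) x
    rwa [sub_sub_cancel_left, norm_neg] at this
  have h5 := ((h4.add h3).pow 2).mul_const (ρ ^ 2 / fishDen ρ p)
  rw [zero_add, one_pow, one_mul] at h5
  refine h5.congr fun x => ?_
  have := fishDen_pos hρ x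
  rw [← add_div, sub_add_cancel, div_pow, Real.sq_sqrt this.le, fishSin]
  field_simp

lemma isFishEyeGreen_explicitGreen {N : ℕ} (hN : 2 ≤ N) {ρ : ℝ} (hρ : 0 < ρ) {ν : ℂ}
    (ha : ∀ m : ℕ, (N : ℂ) / 2 + ν ≠ -m) (hb : ∀ m : ℕ, (N : ℂ) / 2 - 1 - ν ≠ -m)
    (r' : EuclideanSpace ℝ (Fin N)) :
    IsFishEyeGreen N ρ (ν * (ν + 1)) r' (explicitGreen ρ ν r') := by
  have hs01 : ∀ x, x ≠ r' → fishSin ρ r' x ∈ Set.Ioc (0 : ℝ) 1 := fun x hx =>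
    ⟨fishSin_pos hρ hx, fishSin_le_one hρ r' x⟩
  have hsc : ContDiff ℝ 2 (fishSin ρ r') := contDiff_fishSin hρ r'
  set κ : ℂ := Complex.Gamma ((N : ℂ) / 2 + ν) * Complex.Gamma ((N : ℂ) / 2 - 1 - ν) *
    ((-(ρ ^ (N - 2) * fishFactor ρ r' /
      (4 * Real.pi ^ ((N : ℝ) / 2) * Real.Gamma ((N : ℝ) / 2))) : ℝ) : ℂ) with hκ
  have hG : explicitGreen ρ ν r' =
      fun x => (fishFactor ρ x : ℂ) * (κ * zonalHyp N ν (fishSin ρ r' x)) := by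
    funext x
    rw [explicitGreen, greenFactor, hκ]
    push_cast
    ring
  have hcd : ∀ σ ∈ Set.Ioc (0 : ℝ) 1, ContDiffAt ℝ 2 (fun σ => κ * zonalHyp N ν σ) σ :=
    fun σ hσ => contDiffAt_const.mul (contDiffAt_zonalHyp hN ν hσ)
  refine ⟨?_, ?_, ?_, ?_⟩
  · rw [hG]
    exact fun x hx => ((contDiff_fishFactor hρ).contDiffAt.mul
      ((hcd _ (hs01 x hx)).comp x hsc.contDiffAt)).contDiffWithinAt
  · intro x hx
    obtain ⟨g, L, hz⟩ := exists_isZonalAt_fishSin hρ r' x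
    have h1 := fishEye_operator_zonal hρ hz (hcd _ (hs01 x hx)) (ν * (ν + 1))
    have h2 : (deriv fun σ => κ * zonalHyp N ν σ) = fun σ => κ * deriv (zonalHyp N ν) σ :=
      funext fun σ => deriv_const_mul_field κ
    have h3 : zonalOp N (ν * (ν + 1)) (κ * zonalHyp N ν (fishSin ρ r' x))
        (κ * deriv (zonalHyp N ν) (fishSin ρ r' x))
        (κ * deriv (deriv (zonalHyp N ν)) (fishSin ρ r' x)) (fishSin ρ r' x) = 0 := by
      have h4 := zonalOp_zonalHyp hN ν (hs01 x hx)
      unfold zonalOp at h4 ⊢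
      linear_combination κ * h4
    rw [h2, deriv_const_mul_field κ, h3, mul_zero, mul_zero, ← hG] at h1
    rw [← h1]
    unfold fishDen
    rw [hG]
  · have hr := tendsto_source_ratio hN hρ r'
    have hr0 := sourceRatio_pos hN hρ r'
    have h1 : Tendsto (fun x => (fishFactor ρ x : ℂ) * (κ * (zonalHyp N ν (fishSin ρ r' x) /
        (zonalSing N (fishSin ρ r' x) : ℂ)))) (𝓝[≠] r') (𝓝 ((-sourceRatio N ρ r' : ℝ) : ℂ)) := by
      have h2 := (tendsto_hyp_zonalSing hN (a := (N : ℂ) / 2 + ν) (b := (N : ℂ) / 2 - 1 - ν)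
        (by ring) ha hb).comp (tendsto_fishSin hρ r')
      have h3 : Tendsto (fun x => (fishFactor ρ x : ℂ)) (𝓝[≠] r') (𝓝 (fishFactor ρ r' : ℂ)) :=
        ((contDiff_fishFactor hρ).continuous.tendsto r').mono_left nhdsWithin_le_nhds
      have h4 := h3.mul (h2.const_mul κ)
      have e : (fishFactor ρ r' : ℂ) * (κ * (zonalSingConst N /
          (Complex.Gamma ((N : ℂ) / 2 + ν) * Complex.Gamma ((N : ℂ) / 2 - 1 - ν)))) =
          ((-sourceRatio N ρ r' : ℝ) : ℂ) := by
        have g1 := Complex.Gamma_ne_zero ha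
        have g2 := Complex.Gamma_ne_zero hb
        rw [← greenFactor_self hN hρ, greenFactor, hκ]
        push_cast
        generalize Complex.Gamma ((N : ℂ) / 2 + ν) = x at *
        generalize Complex.Gamma ((N : ℂ) / 2 - 1 - ν) = y at *
        field_simp
      rw [e] at h4
      exact h4
    have hS : ∀ᶠ x in 𝓝[≠] r', sourceSingularity N ‖x - r'‖ ≠ 0 := by
      filter_upwards [hr.eventually_ne (neg_ne_zero.2 hr0.ne')] with x hx h0
      exact hx (by rw [h0, zero_div])
    refine (Asymptotics.isEquivalent_iff_tendsto_one
      (hS.mono fun x hx => Complex.ofReal_ne_zero.2 hx)).2 ?_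
    have h5 := h1.div ((Complex.continuous_ofReal.tendsto _).comp hr)
      (Complex.ofReal_ne_zero.2 (neg_ne_zero.2 hr0.ne'))
    rw [div_self (Complex.ofReal_ne_zero.2 (neg_ne_zero.2 hr0.ne'))] at h5
    refine h5.congr' ?_
    have hsmall : ∀ᶠ x in 𝓝[≠] r', fishSin ρ r' x ∈ Set.Ioo (0 : ℝ) 1 :=
      (tendsto_fishSin hρ r').eventually (Ioo_mem_nhdsGT one_pos)
    filter_upwards [hS, hsmall] with x hx hx'
    have hZ : (zonalSing N (fishSin ρ r' x) : ℂ) ≠ 0 :=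
      Complex.ofReal_ne_zero.2 (zonalSing_pos N hx'.1 hx'.2).ne'
    have hx : (sourceSingularity N ‖x - r'‖ : ℂ) ≠ 0 := Complex.ofReal_ne_zero.2 hx
    rw [hG]
    simp only [Pi.div_apply, Function.comp_apply, Complex.ofReal_div]
    field_simp
  · have hP := fishDen_pos hρ r'
    obtain ⟨h1, h2⟩ := tendsto_fishSin_cobounded hρ r'
    -- The value 1 occurs when r' = 0, whose antipode is infinity; the zonal solution is smooth
    -- there too.
    have hσ : ρ ^ 2 / fishDen ρ r' ∈ Set.Ioc (0 : ℝ) 1 := by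
      refine ⟨by positivity, (div_le_one hP).2 ?_⟩
      unfold fishDen
      nlinarith [sq_nonneg ‖r'‖]
    have h3 := ((hcd _ hσ).continuousAt.tendsto).comp h2
    have h4 := h1.rpow_const (p := (N : ℝ) / 2 - 1) (Or.inl one_ne_zero)
    refine ⟨_, (((Complex.continuous_ofReal.tendsto _).comp h4).mul h3).congr fun x => ?_⟩
    have hA := fishDen_pos hρ x
    simp only [Function.comp_apply]
    have h5 : (‖x‖ ^ 2 / fishDen ρ x) ^ ((N : ℝ) / 2 - 1) = ‖x‖ ^ (N - 2) * fishFactor ρ x := by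
      rw [Real.div_rpow (by positivity) hA.le, fishFactor,
        show (1 : ℝ) - N / 2 = -(N / 2 - 1) by ring, Real.rpow_neg hA.le,
        ← div_eq_mul_inv, ← Real.rpow_natCast ‖x‖ 2, ← Real.rpow_mul (norm_nonneg _),
        ← Real.rpow_natCast ‖x‖ (N - 2), Nat.cast_sub hN]
      congr 2
      push_cast
      ring
    rw [h5, hG]
    push_cast
    ring

/-! ### Analytic dependence on the degree -/

lemma norm_one_sub_lt {σ : ℝ} (hσ : σ ∈ Set.Ioo (0 : ℝ) 2) : ‖((1 - σ : ℝ) : ℂ)‖ < 1 := by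
  rw [Complex.norm_real, Real.norm_eq_abs]
  exact abs_lt.2 ⟨by linarith [hσ.2], by linarith [hσ.1]⟩

lemma differentiable_zonalHyp {N : ℕ} (hN : 2 ≤ N) {σ : ℝ} (hσ : σ ∈ Set.Ioo (0 : ℝ) 2) :
    Differentiable ℂ fun ν => zonalHyp N ν σ := by
  have hc : (0 : ℝ) < (N : ℝ) / 2 := by
    have : (2 : ℝ) ≤ N := by exact_mod_cast hN
    linarith
  exact differentiable_hyp_param hc (a := fun ν => (N : ℂ) / 2 + ν)
    (b := fun ν => (N : ℂ) / 2 - 1 - ν) (by fun_prop) (by fun_prop) (norm_one_sub_lt hσ)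

lemma continuousAt_zonalHyp {N : ℕ} (hN : 2 ≤ N) (ν : ℂ) {σ : ℝ} (hσ : σ ∈ Set.Ioo (0 : ℝ) 2) :
    ContinuousAt (fun q : ℝ × ℂ => zonalHyp N q.2 q.1) (σ, ν) := by
  have hc : (0 : ℝ) < (N : ℝ) / 2 := by
    have : (2 : ℝ) ≤ N := by exact_mod_cast hN
    linarith
  have hopen : IsOpen {p : ℂ × ℂ × ℂ | ‖p.2.2‖ < 1} :=
    isOpen_lt (by fun_prop) continuous_const
  have h1 := (continuousOn_hyp hc).continuousAt (hopen.mem_nhds (show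
    ((N : ℂ) / 2 + ν, (N : ℂ) / 2 - 1 - ν, ((1 - σ : ℝ) : ℂ)) ∈ {p : ℂ × ℂ × ℂ | ‖p.2.2‖ < 1} from
      norm_one_sub_lt hσ))
  have h2 : Continuous fun q : ℝ × ℂ =>
      ((N : ℂ) / 2 + q.2, (N : ℂ) / 2 - 1 - q.2, ((1 - q.1 : ℝ) : ℂ)) := by fun_prop
  exact ContinuousAt.comp (f := fun q : ℝ × ℂ =>
    ((N : ℂ) / 2 + q.2, (N : ℂ) / 2 - 1 - q.2, ((1 - q.1 : ℝ) : ℂ))) (x := (σ, ν)) h1 h2.continuousAt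

/-- Parameter derivatives of jointly continuous families of entire functions are continuous. -/
lemma continuousAt_deriv_param {X : Type*} [TopologicalSpace X] {F : X → ℂ → ℂ} {x₀ : X}
    (hd : ∀ᶠ x in 𝓝 x₀, Differentiable ℂ (F x))
    (hc : ∀ z, ContinuousAt (fun q : X × ℂ => F q.1 q.2) (x₀, z)) (z : ℂ) :
    ContinuousAt (fun x => deriv (F x) z) x₀ := by
  -- Joint continuity along all points of the line gives locally uniform convergence, which for
  -- holomorphic functions passes to derivatives.
  have h1 : TendstoLocallyUniformly F (F x₀) (𝓝 x₀) := by
    rw [tendstoLocallyUniformly_iff_forall_tendsto]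
    intro w
    have h2 : Tendsto (fun q : X × ℂ => F x₀ q.2) (𝓝 (x₀, w)) (𝓝 (F x₀ w)) := by
      have h3 : ContinuousAt (F x₀) w := (hd.self_of_nhds w).continuousAt
      exact h3.tendsto.comp (continuous_snd.tendsto (x₀, w))
    have h4 := h2.prodMk_nhds (hc w).tendsto
    rw [← nhds_prod_eq]
    exact h4.mono_right (nhds_le_uniformity _)
  have h5 := (tendstoLocallyUniformlyOn_univ.2 h1).deriv
    (hd.mono fun x hx => hx.differentiableOn) isOpen_univ
  exact h5.tendsto_at (Set.mem_univ z)

lemma continuousAt_deriv_zonalHyp {N : ℕ} (hN : 2 ≤ N) (ν : ℂ) {σ : ℝ}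
    (hσ : σ ∈ Set.Ioo (0 : ℝ) 2) :
    ContinuousAt (fun σ => deriv (fun ν => zonalHyp N ν σ) ν) σ :=
  continuousAt_deriv_param (F := fun σ ν => zonalHyp N ν σ)
    ((Ioo_mem_nhds hσ.1 hσ.2 : Set.Ioo (0 : ℝ) 2 ∈ 𝓝 σ) |> fun h =>
      Filter.mem_of_superset h fun _ ht => differentiable_zonalHyp hN ht)
    (fun w => continuousAt_zonalHyp hN w hσ) ν

/-! ### Cancelling the pole of the Gamma factor -/

lemma ne_neg_nat_of_re_pos {s : ℂ} (hs : 0 < s.re) (m : ℕ) : s ≠ -m := by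
  rintro rfl
  simp only [Complex.neg_re, Complex.natCast_re] at hs
  linarith [(Nat.cast_nonneg m : (0 : ℝ) ≤ m)]

/-- `ε Γ(-n - ε)` without its removable singularity. -/
lemma mul_Gamma_neg_nat_sub (n : ℕ) {ε : ℂ} (h0 : ε ≠ 0) (h1 : ‖ε‖ < 1) :
    ε * Complex.Gamma (-n - ε) = (-1) ^ (n + 1) * (Complex.Gamma (1 + ε) * Complex.Gamma (1 - ε)) /
      Complex.Gamma (n + 1 + ε) := by
  have hre := (abs_le.1 (Complex.abs_re_le_norm ε)).1
  have g1 : Complex.Gamma (n + 1 + ε) ≠ 0 := Complex.Gamma_ne_zero (ne_neg_nat_of_re_pos (by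
    simp only [Complex.add_re, Complex.natCast_re, Complex.one_re]
    have : (0 : ℝ) ≤ n := Nat.cast_nonneg n
    linarith))
  -- Reflection at ε and at -n-ε gives the same sine up to the sign (-1)^(n+1), so the sines drop
  -- out and no pole remains.
  have r1 := Complex.Gamma_mul_Gamma_one_sub ε
  have r2 := Complex.Gamma_mul_Gamma_one_sub (-n - ε)
  have e1 : (1 : ℂ) - (-n - ε) = n + 1 + ε := by ring
  have e2 : Complex.sin (Real.pi * (-n - ε)) = (-1) ^ (n + 1) * Complex.sin (Real.pi * ε) := by
    rw [show (Real.pi : ℂ) * (-n - ε) = -(Real.pi * ε + n * Real.pi) by ring, Complex.sin_neg,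
      Complex.sin_antiperiodic.add_nat_mul_eq, pow_succ]
    ring
  rw [e1, e2] at r2
  rw [eq_div_iff g1, mul_assoc, r2, add_comm 1 ε, Complex.Gamma_add_one ε h0, mul_assoc ε, r1]
  have hsq : ((-1 : ℂ) ^ (n + 1)) ^ 2 = 1 := by rw [← pow_mul, mul_comm, pow_mul]; simp
  have hs1 : ((-1 : ℂ) ^ (n + 1)) ≠ 0 := pow_ne_zero _ (by norm_num)
  have hinv : ((-1 : ℂ) ^ (n + 1))⁻¹ = (-1) ^ (n + 1) := by
    rw [inv_eq_iff_eq_inv, eq_comm]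
    exact inv_eq_of_mul_eq_one_left (by rw [← sq]; exact hsq)
  rw [div_eq_mul_inv, mul_inv, hinv, div_eq_mul_inv]
  ring

/-- The exceptional degree `n + N/2 - 1`. -/
def excDegree (N n : ℕ) : ℂ := n + N / 2 - 1

/-- The gamma factors of the Green's function with the pole at the exceptional degree removed. -/
def regGamma (N n : ℕ) (ν : ℂ) : ℂ :=
  Complex.Gamma ((N : ℂ) / 2 + ν) * ((-1) ^ (n + 1) * (Complex.Gamma (1 + (ν - excDegree N n)) *
    Complex.Gamma (1 - (ν - excDegree N n))) / Complex.Gamma (n + 1 + (ν - excDegree N n))) *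
    (ν + n + N / 2)

/-- `(ν - ν₀) (ν + ν₀ + 1)` times the Green's function, without the removable singularity. -/
def regGreen {N : ℕ} (n : ℕ) (ρ : ℝ) (r r' : EuclideanSpace ℝ (Fin N)) (ν : ℂ) : ℂ :=
  regGamma N n ν * (greenFactor ρ r r' * zonalHyp N ν (fishSin ρ r' r))

lemma re_pos_of_norm_lt_one {N n : ℕ} (hN : 2 ≤ N) {ν : ℂ} (hν : ‖ν - excDegree N n‖ < 1) :
    0 < ((N : ℂ) / 2 + ν).re ∧ 0 < (1 + (ν - excDegree N n)).re ∧
    0 < (1 - (ν - excDegree N n)).re ∧ 0 < (n + 1 + (ν - excDegree N n)).re := by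
  have h := abs_lt.1 ((Complex.abs_re_le_norm _).trans_lt hν)
  have hN' : (2 : ℝ) ≤ N := by exact_mod_cast hN
  have hn : (0 : ℝ) ≤ n := Nat.cast_nonneg n
  have e : (N : ℂ) / 2 + ν = (n + N - 1 : ℝ) + (ν - excDegree N n) := by
    rw [excDegree]; push_cast; ring
  rw [e]
  simp only [Complex.add_re, Complex.one_re, Complex.sub_re (1 : ℂ), Complex.natCast_re,
    Complex.ofReal_re]
  refine ⟨?_, ?_, ?_, ?_⟩ <;> linarith [h.1, h.2]

lemma ne_neg_nat_of_near_excDegree {N n : ℕ} (hN : 2 ≤ N) {ν : ℂ} (hν : ‖ν - excDegree N n‖ < 1)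
    (hν0 : ν ≠ excDegree N n) :
    (∀ m : ℕ, (N : ℂ) / 2 + ν ≠ -m) ∧ ∀ m : ℕ, (N : ℂ) / 2 - 1 - ν ≠ -m := by
  refine ⟨ne_neg_nat_of_re_pos (re_pos_of_norm_lt_one hN hν).1, fun m hm => ?_⟩
  -- A pole would make ν - ν₀ an integer of modulus less than 1, hence 0.
  have h1 : ν - excDegree N n = ((m - n : ℤ) : ℂ) := by
    rw [excDegree]
    push_cast
    linear_combination -hm
  rw [h1, Complex.norm_intCast] at hν
  have h2 : (m - n : ℤ) = 0 := by
    rw [← Int.abs_lt_one_iff]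
    exact_mod_cast hν
  rw [h2, Int.cast_zero, sub_eq_zero] at h1
  exact hν0 h1

lemma regGreen_eq {N n : ℕ} {ρ : ℝ} {ν : ℂ} (hν : ‖ν - excDegree N n‖ < 1)
    (hν0 : ν ≠ excDegree N n) (r r' : EuclideanSpace ℝ (Fin N)) :
    (ν - n - N / 2 + 1) * (ν + n + N / 2) * explicitGreen ρ ν r' r = regGreen n ρ r r' ν := by
  have h := mul_Gamma_neg_nat_sub n (sub_ne_zero.2 hν0) hν
  rw [regGreen, regGamma, ← h, explicitGreen,
    show (-(n : ℂ) - (ν - excDegree N n)) = N / 2 - 1 - ν by rw [excDegree]; ring,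
    show ν - n - N / 2 + 1 = ν - excDegree N n by rw [excDegree]; ring]
  ring

lemma hasDerivAt_Gamma_of_re_pos {s : ℂ} (hs : 0 < s.re) :
    HasDerivAt Complex.Gamma (Complex.Gamma s * Complex.digamma s) s := by
  have h := (Complex.differentiableAt_Gamma s (ne_neg_nat_of_re_pos hs)).hasDerivAt
  have h0 := Complex.Gamma_ne_zero (ne_neg_nat_of_re_pos hs)
  rwa [Complex.digamma_def, logDeriv_apply, mul_div_cancel₀ _ h0]

lemma differentiableAt_regGamma {N n : ℕ} (hN : 2 ≤ N) {ν : ℂ} (hν : ‖ν - excDegree N n‖ < 1) :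
    DifferentiableAt ℂ (regGamma N n) ν := by
  obtain ⟨h1, h2, h3, h4⟩ := re_pos_of_norm_lt_one hN hν
  have hd : ∀ (f : ℂ → ℂ), Differentiable ℂ f → 0 < (f ν).re →
      DifferentiableAt ℂ (fun ν => Complex.Gamma (f ν)) ν := fun f hf h =>
    (Complex.differentiableAt_Gamma _ (ne_neg_nat_of_re_pos h)).comp ν (hf ν)
  have d1 := hd (fun ν => (N : ℂ) / 2 + ν) (by fun_prop) h1
  have d2 := hd (fun ν => 1 + (ν - excDegree N n)) (by fun_prop) h2
  have d3 := hd (fun ν => 1 - (ν - excDegree N n)) (by fun_prop) h3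
  have d4 := hd (fun ν => n + 1 + (ν - excDegree N n)) (by fun_prop) h4
  exact (d1.mul (((d2.mul d3).const_mul _).div d4
    (Complex.Gamma_ne_zero (ne_neg_nat_of_re_pos h4)))).mul (by fun_prop)

/-- The value of `regGamma` at the exceptional degree, and its logarithmic derivative there. -/
lemma hasDerivAt_regGamma {N : ℕ} (hN : 2 ≤ N) (n : ℕ) :
    regGamma N n (excDegree N n) =
      (-1) ^ (n + 1) * ((n + N - 2).factorial : ℂ) / (n.factorial : ℂ) * (2 * n + N - 1) ∧
    HasDerivAt (regGamma N n) ((-1) ^ (n + 1) * ((n + N - 2).factorial : ℂ) / (n.factorial : ℂ) *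
      (2 * n + N - 1) * (Complex.digamma (n + N - 1) - Complex.digamma (n + 1) +
        1 / (2 * (n : ℂ) + N - 1))) (excDegree N n) := by
  obtain ⟨h1, h2, h3, h4⟩ := re_pos_of_norm_lt_one (n := n) hN
    (show ‖excDegree N n - excDegree N n‖ < 1 by simp)
  have e1 : (N : ℂ) / 2 + excDegree N n = n + N - 1 := by rw [excDegree]; ring
  have e5 : excDegree N n + n + N / 2 = 2 * n + N - 1 := by rw [excDegree]; ring
  have g1 : Complex.Gamma (n + N - 1) = ((n + N - 2).factorial : ℂ) := by
    rw [← Complex.Gamma_nat_eq_factorial]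
    congr 1
    rw [Nat.cast_sub (by omega)]
    push_cast
    ring
  have g4 := Complex.Gamma_nat_eq_factorial n
  rw [e1] at h1
  rw [sub_self, add_zero] at h2 h4
  have hne : (2 * (n : ℂ) + N - 1) ≠ 0 := by
    have : (2 * (n : ℂ) + N - 1) = ((2 * n + N - 1 : ℕ) : ℂ) := by
      rw [Nat.cast_sub (by omega)]; push_cast; ring
    rw [this]
    exact_mod_cast (by omega : 2 * n + N - 1 ≠ 0)
  have hf : (n.factorial : ℂ) ≠ 0 := by exact_mod_cast n.factorial_ne_zero
  constructor
  · rw [regGamma, e1, e5, sub_self, add_zero, add_zero, sub_zero, Complex.Gamma_one, g1, g4]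
    ring
  · set v := excDegree N n with hv
    have d1 : HasDerivAt (fun ν : ℂ => Complex.Gamma ((N : ℂ) / 2 + ν))
        (Complex.Gamma (n + N - 1) * Complex.digamma (n + N - 1)) v := by
      have h := hasDerivAt_Gamma_of_re_pos h1
      rw [← e1] at h ⊢
      exact HasDerivAt.comp_const_add _ _ h
    have hid : HasDerivAt (fun ν : ℂ => ν - v) 1 v := (hasDerivAt_id v).sub_const v
    have d2 : HasDerivAt (fun ν : ℂ => Complex.Gamma (1 + (ν - v)))
        (Complex.Gamma 1 * Complex.digamma 1 * 1) v := by
      refine HasDerivAt.comp v (h₂ := Complex.Gamma) (h := fun ν => 1 + (ν - v)) ?_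
        (hid.const_add 1)
      rw [sub_self, add_zero]
      exact hasDerivAt_Gamma_of_re_pos h2
    have d3 : HasDerivAt (fun ν : ℂ => Complex.Gamma (1 - (ν - v)))
        (Complex.Gamma 1 * Complex.digamma 1 * -1) v := by
      refine HasDerivAt.comp v (h₂ := Complex.Gamma) (h := fun ν => 1 - (ν - v)) ?_
        (hid.const_sub 1)
      rw [sub_self, sub_zero]
      exact hasDerivAt_Gamma_of_re_pos h2
    have d4 : HasDerivAt (fun ν : ℂ => Complex.Gamma (n + 1 + (ν - v)))
        (Complex.Gamma (n + 1) * Complex.digamma (n + 1) * 1) v := by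
      refine HasDerivAt.comp v (h₂ := Complex.Gamma) (h := fun ν => n + 1 + (ν - v)) ?_
        (hid.const_add _)
      rw [sub_self, add_zero]
      exact hasDerivAt_Gamma_of_re_pos h4
    have d5 : HasDerivAt (fun ν : ℂ => ν + n + N / 2) 1 v :=
      ((hasDerivAt_id v).add_const _).add_const _
    -- The contributions of Γ(1+ε) and Γ(1-ε) cancel at ε = 0; the last factor contributes
    -- 1/(2n+N-1).
    have h := (d1.mul (((d2.mul d3).const_mul ((-1) ^ (n + 1))).div d4 (by
      rw [sub_self, add_zero, g4]; exact hf))).mul d5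
    refine h.congr_deriv ?_
    simp only [Pi.mul_apply, Pi.div_apply]
    rw [sub_self, add_zero, add_zero, sub_zero, e1, e5, g1, g4, Complex.Gamma_one]
    generalize 2 * (n : ℂ) + N - 1 = D at *
    generalize Complex.digamma (n + N - 1) = A
    generalize Complex.digamma (n + 1) = B
    field_simp
    ring

/-- Agreement on a punctured neighbourhood is agreement near each of its points, so the derivatives
agree there too; this never uses the value of f at the singular parameter. -/
lemma tendsto_deriv_of_eventuallyEq {f h : ℂ → ℂ} {z₀ : ℂ} (hh : AnalyticAt ℂ h z₀)
    (hfh : f =ᶠ[𝓝[≠] z₀] h) :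
    (∀ᶠ z in 𝓝[≠] z₀, DifferentiableAt ℂ f z) ∧
      Tendsto (deriv f) (𝓝[≠] z₀) (𝓝 (deriv h z₀)) := by
  have h1 : ∀ᶠ z in 𝓝[≠] z₀, f =ᶠ[𝓝 z] h := by
    filter_upwards [eventually_eventually_nhdsWithin.2 hfh, self_mem_nhdsWithin] with z hz hz0
    rwa [isOpen_compl_singleton.nhdsWithin_eq hz0] at hz
  have h2 : ∀ᶠ z in 𝓝[≠] z₀, AnalyticAt ℂ h z := hh.eventually_analyticAt.filter_mono
    nhdsWithin_le_nhds
  constructor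
  · filter_upwards [h1, h2] with z hz hz'
    exact hz'.differentiableAt.congr_of_eventuallyEq hz
  · refine (hh.deriv.continuousAt.tendsto.mono_left nhdsWithin_le_nhds).congr' ?_
    filter_upwards [h1] with z hz using hz.deriv_eq.symm

/-! ### Translation into Legendre functions -/

lemma fishEyeArg_eq {N : ℕ} (ρ : ℝ) (r r' : EuclideanSpace ℝ (Fin N)) :
    fishEyeArg ρ r r' = -1 + 2 * fishSin ρ r' r := by
  unfold fishEyeArg fishSin fishDen
  ring

/-- The ratio of the Legendre function to the zonal solution. -/
def legendreRatio (N : ℕ) (s : ℝ) : ℝ :=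
  (s / (1 - s)) ^ ((-(N : ℝ) / 2 + 1) / 2) * s ^ ((N : ℝ) / 2 - 1) / Real.Gamma ((N : ℝ) / 2)

/-- Euler's transformation turns F(-ν, ν+1; N/2; 1-s) into s^(N/2-1) times `zonalHyp`. The power
does not depend on ν, so derivatives in ν translate directly. -/
lemma legendreP_eq {N : ℕ} (hN : 2 ≤ N) (ν : ℂ) {s : ℝ} (hs : s ∈ Set.Ioc (0 : ℝ) 1) :
    legendreP ν (-(N : ℝ) / 2 + 1) (-1 + 2 * s) = legendreRatio N s * zonalHyp N ν s := by
  have hc : (0 : ℝ) < (N : ℝ) / 2 := by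
    have : (2 : ℝ) ≤ N := by exact_mod_cast hN
    linarith
  have e1 : (1 : ℂ) - ((-(N : ℝ) / 2 + 1 : ℝ) : ℂ) = (((N : ℝ) / 2 : ℝ) : ℂ) := by
    push_cast; ring
  have e2 : (1 + (-1 + 2 * s)) / (1 - (-1 + 2 * s)) = s / (1 - s) := by
    rw [show 1 + (-1 + 2 * s) = 2 * s by ring, show 1 - (-1 + 2 * s) = 2 * (1 - s) by ring,
      mul_div_mul_left _ _ two_ne_zero]
  have e3 : (1 - (-1 + 2 * s)) / 2 = 1 - s := by ring
  have e4 : (1 : ℂ) - ((1 - s : ℝ) : ℂ) = (s : ℂ) := by push_cast; ring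
  have e5 : (((N : ℝ) / 2 : ℝ) : ℂ) - -ν - (ν + 1) = (((N : ℝ) / 2 - 1 : ℝ) : ℂ) := by
    push_cast; ring
  have e6 : (((N : ℝ) / 2 : ℝ) : ℂ) - -ν = (N : ℂ) / 2 + ν := by push_cast; ring
  have e7 : (((N : ℝ) / 2 : ℝ) : ℂ) - (ν + 1) = (N : ℂ) / 2 - 1 - ν := by push_cast; ring
  rw [legendreP, e1, e2, e3, hyp_euler hc _ _ (norm_one_sub_lt ⟨hs.1, by linarith [hs.2]⟩), e4, e5,
    e6, e7, ← Complex.ofReal_cpow hs.1.le, Complex.Gamma_ofReal, legendreRatio, zonalHyp]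
  push_cast
  ring

/-- Every quantity is a product of powers of s, 1-s, ρ and the two conformal denominators. At the
image point the left side degenerates unless N = 2, when the exponents of the vanishing factors are
0. -/
lemma legendre_prefactor {N : ℕ} (hN : 2 ≤ N) {ρ : ℝ} (hρ : 0 < ρ)
    {r r' : EuclideanSpace ℝ (Fin N)} (hr : r ≠ r') (h : N = 2 ∨ fishEyeImageFactor ρ r r' ≠ 0) :
    ρ ^ ((N : ℝ) / 2 - 1) / (‖r - r'‖ ^ ((N : ℝ) / 2 - 1) *
      fishEyeImageFactor ρ r r' ^ ((N : ℝ) / 4 - 1 / 2)) * legendreRatio N (fishSin ρ r' r) =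
    ρ ^ (N - 2) * (fishFactor ρ r * fishFactor ρ r') / Real.Gamma ((N : ℝ) / 2) := by
  have hA := fishDen_pos hρ r
  have hA' := fishDen_pos hρ r'
  have hs := fishSin_pos hρ hr
  rcases h with h | h
  · subst h
    norm_num [legendreRatio, fishFactor]
  · have hI : 0 < fishEyeImageFactor ρ r r' :=
      lt_of_le_of_ne (fishEyeImageFactor_nonneg _ _ _) h.symm
    have h1s := one_sub_fishSin hρ r' r
    have h1 : 0 < 1 - fishSin ρ r' r := by rw [h1s]; positivity
    have hn : 0 < ‖r - r'‖ := norm_pos_iff.2 (sub_ne_zero.2 hr)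
    set s := fishSin ρ r' r with hsdef
    set e : ℝ := (N : ℝ) / 4 - 1 / 2 with he
    have hE : (N : ℝ) / 2 - 1 = 2 * e := by rw [he]; ring
    have hE' : (-(N : ℝ) / 2 + 1) / 2 = -e := by rw [he]; ring
    have hE'' : (1 : ℝ) - N / 2 = -(2 * e) := by rw [he]; ring
    have hI' : fishEyeImageFactor ρ r r' = (1 - s) * (fishDen ρ r * fishDen ρ r') := by
      rw [h1s]; field_simp
    have hn' : ‖r - r'‖ ^ (2 * e) = s ^ e * (fishDen ρ r ^ e * fishDen ρ r' ^ e) / ρ ^ (2 * e) := by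
      have : ‖r - r'‖ ^ 2 = s * (fishDen ρ r * fishDen ρ r') / ρ ^ 2 := by
        rw [hsdef, fishSin]; field_simp
      rw [Real.rpow_mul hn.le, Real.rpow_two, this, Real.div_rpow (by positivity) (by positivity),
        Real.mul_rpow hs.le (by positivity), Real.mul_rpow hA.le hA'.le, Real.rpow_mul hρ.le,
        Real.rpow_two]
    have hρ' : ρ ^ (N - 2) = ρ ^ (2 * e) * ρ ^ (2 * e) := by
      rw [← Real.rpow_add hρ, ← Real.rpow_natCast, Nat.cast_sub hN, he]
      congr 1
      push_cast
      ring
    have h2 : ∀ x : ℝ, 0 < x → x ^ (2 * e) = x ^ e * x ^ e := fun x hx => by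
      rw [two_mul, Real.rpow_add hx]
    have hG : 0 < Real.Gamma ((N : ℝ) / 2) := Real.Gamma_pos_of_pos (by
      have : (2 : ℝ) ≤ N := by exact_mod_cast hN
      linarith)
    have hse := Real.rpow_pos_of_pos hs e
    have h1e := Real.rpow_pos_of_pos h1 e
    have hAe := Real.rpow_pos_of_pos hA e
    have hAe' := Real.rpow_pos_of_pos hA' e
    have hρe := Real.rpow_pos_of_pos hρ (2 * e)
    rw [legendreRatio, fishFactor, fishFactor, hE', hE'', hE, hn', hI', hρ',
      Real.rpow_neg (by positivity) (x := s / (1 - s)), Real.rpow_neg hA.le, Real.rpow_neg hA'.le,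
      Real.div_rpow hs.le h1.le, Real.mul_rpow h1.le (by positivity), Real.mul_rpow hA.le hA'.le,
      h2 s hs, h2 _ hA, h2 _ hA']
    field_simp

/-! ### The generalized Green's function -/

/-- Near an exceptional value the Green's function exists and is unique. -/
lemma fishEyeGreen_near {N n : ℕ} (hN : 2 ≤ N) {ρ : ℝ} (hρ : 0 < ρ) {ν : ℂ}
    (hν : ‖ν - excDegree N n‖ < 1) (hν0 : ν ≠ excDegree N n) (r' : EuclideanSpace ℝ (Fin N)) :
    (IsFishEyeGreen N ρ (ν * (ν + 1)) r' (fun r => fishEyeGreen N ρ (ν * (ν + 1)) r r') ∧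
      ∀ G, IsFishEyeGreen N ρ (ν * (ν + 1)) r' G → ∀ r, r ≠ r' →
        G r = fishEyeGreen N ρ (ν * (ν + 1)) r r') ∧
    ∀ r, r ≠ r' → fishEyeGreen N ρ (ν * (ν + 1)) r r' = explicitGreen ρ ν r' r := by
  obtain ⟨ha, hb⟩ := ne_neg_nat_of_near_excDegree hN hν hν0
  have hex := isFishEyeGreen_explicitGreen hN hρ ha hb r'
  have hE : ∃ G, IsFishEyeGreen N ρ (ν * (ν + 1)) r' G := ⟨_, hex⟩
  have hF : (fun r => fishEyeGreen N ρ (ν * (ν + 1)) r r') = hE.choose := by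
    funext r
    rw [fishEyeGreen, dif_pos hE]
  have hspec : IsFishEyeGreen N ρ (ν * (ν + 1)) r'
      (fun r => fishEyeGreen N ρ (ν * (ν + 1)) r r') := hF ▸ hE.choose_spec
  have huniq : ∀ G, IsFishEyeGreen N ρ (ν * (ν + 1)) r' G → ∀ r, r ≠ r' →
      G r = fishEyeGreen N ρ (ν * (ν + 1)) r r' := fun G hG r hr =>
    hG.eq_of_ne hN hρ (a := (N : ℂ) / 2 + ν) (b := (N : ℂ) / 2 - 1 - ν) (by ring) (by ring) ha hb
      hspec hr
  exact ⟨⟨hspec, huniq⟩, fun r hr => (huniq _ hex r hr).symm⟩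

/-- The branch of `ν` as a function of `λ = ν (ν + 1)`. -/
def degreeOf (l : ℂ) : ℂ := -(1 / 2) + (l + 1 / 4) ^ ((2 : ℕ) : ℂ)⁻¹

lemma degreeOf_mul (l : ℂ) : degreeOf l * (degreeOf l + 1) = l := by
  have h := Complex.cpow_nat_inv_pow (l + 1 / 4) two_ne_zero
  unfold degreeOf
  linear_combination h

/-- As λ + 1/4 = (ν + 1/2)², positivity of ν₀ + 1/2 means that the principal square root returns ν₀
and is analytic at λ₀. -/
lemma exc_add_half {N : ℕ} (hN : 2 ≤ N) (n : ℕ) :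
    ∃ w : ℝ, 0 < w ∧ excDegree N n = -(1 / 2) + (w : ℂ) := by
  have hN' : (2 : ℝ) ≤ N := by exact_mod_cast hN
  have hn : (0 : ℝ) ≤ n := Nat.cast_nonneg n
  refine ⟨n + N / 2 - 1 / 2, by linarith, ?_⟩
  rw [excDegree]
  push_cast
  ring

lemma degreeOf_excDegree {N : ℕ} (hN : 2 ≤ N) (n : ℕ) :
    degreeOf (excDegree N n * (excDegree N n + 1)) = excDegree N n := by
  obtain ⟨w, hw, h⟩ := exc_add_half hN n
  rw [degreeOf, h, show (-(1 / 2) + (w : ℂ)) * (-(1 / 2) + w + 1) + 1 / 4 = (w : ℂ) ^ 2 by ring,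
    Complex.pow_cpow_nat_inv two_ne_zero]
  · rw [Complex.arg_ofReal_of_nonneg hw.le]
    have := Real.pi_pos
    norm_num
    positivity
  · rw [Complex.arg_ofReal_of_nonneg hw.le]
    positivity

lemma analyticAt_degreeOf {N : ℕ} (hN : 2 ≤ N) (n : ℕ) :
    AnalyticAt ℂ degreeOf (excDegree N n * (excDegree N n + 1)) := by
  obtain ⟨w, hw, h⟩ := exc_add_half hN n
  refine analyticAt_const.add ((analyticAt_id.add analyticAt_const).cpow analyticAt_const ?_)
  rw [h]
  have : id ((-(1 / 2) + (w : ℂ)) * (-(1 / 2) + w + 1)) + 1 / 4 = ((w ^ 2 : ℝ) : ℂ) := by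
    simp only [id]
    push_cast
    ring
  change id ((-(1 / 2) + (w : ℂ)) * (-(1 / 2) + w + 1)) + 1 / 4 ∈ Complex.slitPlane
  rw [this, Complex.ofReal_mem_slitPlane]
  positivity

lemma two_mul_add_sub_one_ne_zero {N : ℕ} (hN : 2 ≤ N) (n : ℕ) : 2 * (n : ℂ) + N - 1 ≠ 0 := by
  have : (2 * (n : ℂ) + N - 1) = ((2 * n + N - 1 : ℕ) : ℂ) := by
    rw [Nat.cast_sub (by omega)]; push_cast; ring
  rw [this]
  exact_mod_cast (by omega : 2 * n + N - 1 ≠ 0)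

/-- Obtained by differentiating ν(ν+1) = λ, which gives dν/dλ = 1/(2ν+1). -/
lemma deriv_degreeOf {N : ℕ} (hN : 2 ≤ N) (n : ℕ) :
    deriv degreeOf (excDegree N n * (excDegree N n + 1)) = 1 / (2 * (n : ℂ) + N - 1) := by
  have h1 := (analyticAt_degreeOf hN n).differentiableAt.hasDerivAt
  have h2 := h1.mul (h1.add_const 1)
  have h3 : (degreeOf * fun x => degreeOf x + 1) = id := funext degreeOf_mul
  rw [h3, degreeOf_excDegree hN] at h2
  have h4 := h2.unique (hasDerivAt_id _)
  rw [eq_div_iff (two_mul_add_sub_one_ne_zero hN n)]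
  generalize deriv degreeOf (excDegree N n * (excDegree N n + 1)) = d at *
  rw [excDegree] at h4
  linear_combination h4

lemma analyticAt_regGreen {N : ℕ} (hN : 2 ≤ N) (n : ℕ) {ρ : ℝ} (hρ : 0 < ρ)
    {r r' : EuclideanSpace ℝ (Fin N)} (hr : r ≠ r') :
    AnalyticAt ℂ (regGreen n ρ r r') (excDegree N n) := by
  have hs : fishSin ρ r' r ∈ Set.Ioo (0 : ℝ) 2 :=
    ⟨fishSin_pos hρ hr, by linarith [fishSin_le_one hρ r' r]⟩
  refine DifferentiableOn.analyticAt (s := Metric.ball (excDegree N n) 1) (fun ν hν => ?_)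
    (Metric.ball_mem_nhds _ one_pos)
  rw [mem_ball_iff_norm] at hν
  exact ((differentiableAt_regGamma hN hν).mul
    ((differentiable_zonalHyp hN hs ν).const_mul _)).differentiableWithinAt

lemma deriv_regGreen {N : ℕ} (hN : 2 ≤ N) (n : ℕ) {ρ : ℝ} (hρ : 0 < ρ)
    {r r' : EuclideanSpace ℝ (Fin N)} (hr : r ≠ r') :
    1 / (2 * (n : ℂ) + N - 1) * deriv (regGreen n ρ r r') (excDegree N n) =
      (-1) ^ (n + 1) * ((n + N - 2).factorial : ℂ) / (n.factorial : ℂ) * (greenFactor ρ r r' *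
        ((Complex.digamma (n + N - 1) - Complex.digamma (n + 1) + 1 / (2 * (n : ℂ) + N - 1)) *
          zonalHyp N (excDegree N n) (fishSin ρ r' r) +
          deriv (fun ν => zonalHyp N ν (fishSin ρ r' r)) (excDegree N n))) := by
  have hs : fishSin ρ r' r ∈ Set.Ioo (0 : ℝ) 2 :=
    ⟨fishSin_pos hρ hr, by linarith [fishSin_le_one hρ r' r]⟩
  obtain ⟨h1, h2⟩ := hasDerivAt_regGamma hN n
  have h3 := (differentiable_zonalHyp hN hs (excDegree N n)).hasDerivAt.const_mul
    (greenFactor ρ r r' : ℂ)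
  have h4 : deriv (regGreen n ρ r r') (excDegree N n) = _ := (h2.mul h3).deriv
  rw [h4, h1]
  have hne := two_mul_add_sub_one_ne_zero hN n
  generalize 2 * (n : ℂ) + N - 1 = D at *
  generalize Complex.digamma (n + N - 1) = A
  generalize Complex.digamma (n + 1) = B
  have hf : (n.factorial : ℂ) ≠ 0 := by exact_mod_cast n.factorial_ne_zero
  field_simp

lemma regGreen_eventuallyEq {N : ℕ} (hN : 2 ≤ N) (n : ℕ) {ρ : ℝ} (hρ : 0 < ρ)
    {r r' : EuclideanSpace ℝ (Fin N)} (hr : r ≠ r') :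
    (fun z : ℂ => (z - n - N / 2 + 1) * (z + n + N / 2) * fishEyeGreen N ρ (z * (z + 1)) r r')
      =ᶠ[𝓝[≠] (excDegree N n)] regGreen n ρ r r' := by
  filter_upwards [self_mem_nhdsWithin,
    nhdsWithin_le_nhds (Metric.ball_mem_nhds (excDegree N n) one_pos)] with z hz hz1
  rw [mem_ball_iff_norm] at hz1
  rw [(fishEyeGreen_near hN hρ hz1 hz r').2 r hr, regGreen_eq hz1 hz]

lemma eventually_degreeOf {N : ℕ} (hN : 2 ≤ N) (n : ℕ) :
    ∀ᶠ l in 𝓝[≠] (excDegree N n * (excDegree N n + 1)),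
      ‖degreeOf l - excDegree N n‖ < 1 ∧ degreeOf l ≠ excDegree N n := by
  have h1 := (analyticAt_degreeOf hN n).continuousAt.eventually
    (Metric.ball_mem_nhds (degreeOf (excDegree N n * (excDegree N n + 1))) one_pos)
  rw [degreeOf_excDegree hN] at h1
  filter_upwards [self_mem_nhdsWithin, nhdsWithin_le_nhds h1] with l hl hl1
  rw [dist_eq_norm] at hl1
  refine ⟨hl1, fun h => hl ?_⟩
  rw [← degreeOf_mul l, h]
  rfl

lemma regGreen_comp_eventuallyEq {N : ℕ} (hN : 2 ≤ N) (n : ℕ) {ρ : ℝ} (hρ : 0 < ρ)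
    {r r' : EuclideanSpace ℝ (Fin N)} (hr : r ≠ r') :
    (fun l : ℂ => (l - excDegree N n * (excDegree N n + 1)) * fishEyeGreen N ρ l r r')
      =ᶠ[𝓝[≠] (excDegree N n * (excDegree N n + 1))] regGreen n ρ r r' ∘ degreeOf := by
  filter_upwards [eventually_degreeOf hN n] with l hl
  have h1 := (fishEyeGreen_near hN hρ hl.1 hl.2 r').2 r hr
  rw [degreeOf_mul] at h1
  rw [Function.comp_apply, ← regGreen_eq hl.1 hl.2, h1]
  congr 1
  have h2 := degreeOf_mul l
  rw [excDegree]
  linear_combination -h2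

/-- The form with `zonalHyp` is used instead of the Legendre form, so the image point is included.
-/
lemma continuousOn_deriv_regGreen {N : ℕ} (hN : 2 ≤ N) (n : ℕ) {ρ : ℝ} (hρ : 0 < ρ)
    (r' : EuclideanSpace ℝ (Fin N)) :
    ContinuousOn (fun r => 1 / (2 * (n : ℂ) + N - 1) *
      deriv (regGreen n ρ r r') (excDegree N n)) {r'}ᶜ := by
  intro r hr
  have hs : fishSin ρ r' r ∈ Set.Ioo (0 : ℝ) 2 :=
    ⟨fishSin_pos hρ hr, by linarith [fishSin_le_one hρ r' r]⟩
  have hsc : ContinuousAt (fishSin ρ r') r := (contDiff_fishSin hρ r').continuous.continuousAt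
  have h1 : ContinuousAt (fun r => zonalHyp N (excDegree N n) (fishSin ρ r' r)) r := by
    have h2 : ContinuousAt (fun r => (fishSin ρ r' r, excDegree N n)) r :=
      hsc.prodMk continuousAt_const
    exact ContinuousAt.comp (g := fun q : ℝ × ℂ => zonalHyp N q.2 q.1)
      (f := fun r => (fishSin ρ r' r, excDegree N n)) (x := r) (continuousAt_zonalHyp hN _ hs) h2
  have h3 : ContinuousAt (fun r => deriv (fun ν => zonalHyp N ν (fishSin ρ r' r))
      (excDegree N n)) r :=
    ContinuousAt.comp (g := fun σ => deriv (fun ν => zonalHyp N ν σ) (excDegree N n))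
      (f := fishSin ρ r') (x := r) (continuousAt_deriv_zonalHyp hN _ hs) hsc
  have h4 : ContinuousAt (fun r => (greenFactor ρ r r' : ℂ)) r := by
    have : ContinuousAt (fun r : EuclideanSpace ℝ (Fin N) => (fishFactor ρ r : ℂ)) r :=
      (contDiff_fishFactor hρ).continuous.continuousAt
    simp only [greenFactor, Complex.ofReal_neg, Complex.ofReal_div, Complex.ofReal_mul]
    exact ((continuousAt_const.mul (this.mul continuousAt_const)).div_const _).neg
  have h5 := (h4.mul ((h1.const_mul (Complex.digamma (n + N - 1) - Complex.digamma (n + 1) +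
    1 / (2 * (n : ℂ) + N - 1))).add h3)).const_mul
    ((-1) ^ (n + 1) * ((n + N - 2).factorial : ℂ) / (n.factorial : ℂ))
  exact h5.continuousWithinAt.congr (fun y hy => deriv_regGreen hN n hρ hy)
    (deriv_regGreen hN n hρ hr)

end

theorem mainTheorem2 (N : ℕ) (hN : 2 ≤ N) (ρ : ℝ) (hρ : 0 < ρ) (n : ℕ) (ν₀ : ℂ)
    (hν₀ : ν₀ = n + N / 2 - 1 ∨ ν₀ = -n - N / 2) (r' : EuclideanSpace ℝ (Fin N)) :
    -- no Green's function exists at the exceptional value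
    (¬ ∃ G, IsFishEyeGreen N ρ (ν₀ * (ν₀ + 1)) r' G) ∧
    -- near it, the Green's function exists and is unique
    (∀ᶠ lam in 𝓝[≠] (ν₀ * (ν₀ + 1)),
      IsFishEyeGreen N ρ lam r' (fun r => fishEyeGreen N ρ lam r r') ∧
      ∀ G, IsFishEyeGreen N ρ lam r' G → ∀ r, r ≠ r' → G r = fishEyeGreen N ρ lam r r') ∧
    -- the generalized Green's function is continuous away from the source
    ContinuousOn (fun r => fishEyeGeneralizedGreen N ρ ν₀ r r') {r'}ᶜ ∧
    ∀ r : EuclideanSpace ℝ (Fin N), r ≠ r' →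
      -- the limit defining the generalized Green's function exists, in both of its forms
      (∀ᶠ lam in 𝓝[≠] (ν₀ * (ν₀ + 1)),
        DifferentiableAt ℂ (fun l : ℂ => (l - ν₀ * (ν₀ + 1)) * fishEyeGreen N ρ l r r') lam) ∧
      Tendsto (fun lam : ℂ =>
          deriv (fun l : ℂ => (l - ν₀ * (ν₀ + 1)) * fishEyeGreen N ρ l r r') lam)
        (𝓝[≠] (ν₀ * (ν₀ + 1))) (𝓝 (fishEyeGeneralizedGreen N ρ ν₀ r r')) ∧
      (∀ᶠ ν in 𝓝[≠] ((n : ℂ) + N / 2 - 1),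
        DifferentiableAt ℂ (fun z : ℂ =>
          (z - n - N / 2 + 1) * (z + n + N / 2) * fishEyeGreen N ρ (z * (z + 1)) r r') ν) ∧
      Tendsto (fun ν : ℂ => 1 / (2 * (n : ℂ) + N - 1) *
          deriv (fun z : ℂ =>
            (z - n - N / 2 + 1) * (z + n + N / 2) * fishEyeGreen N ρ (z * (z + 1)) r r') ν)
        (𝓝[≠] ((n : ℂ) + N / 2 - 1)) (𝓝 (fishEyeGeneralizedGreen N ρ ν₀ r r')) ∧
      -- the closed form
      DifferentiableAt ℂ (fun ν : ℂ => legendreP ν (-(N : ℝ) / 2 + 1) (fishEyeArg ρ r r'))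
        (n + N / 2 - 1) ∧
      ((N = 2 ∨ fishEyeImageFactor ρ r r' ≠ 0) →
        fishEyeGeneralizedGreen N ρ ν₀ r r' =
          (-1) ^ n * ((n + N - 2).factorial : ℂ) /
              (4 * ((Real.pi ^ ((N : ℝ) / 2) : ℝ) : ℂ) * (n.factorial : ℂ)) *
            ((ρ ^ ((N : ℝ) / 2 - 1) /
              (‖r - r'‖ ^ ((N : ℝ) / 2 - 1) *
                fishEyeImageFactor ρ r r' ^ ((N : ℝ) / 4 - 1 / 2)) : ℝ) : ℂ) *
            ((Complex.digamma (n + N - 1) - Complex.digamma (n + 1) +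
                1 / (2 * (n : ℂ) + N - 1)) *
                legendreP (n + N / 2 - 1) (-(N : ℝ) / 2 + 1) (fishEyeArg ρ r r') +
              deriv (fun ν : ℂ => legendreP ν (-(N : ℝ) / 2 + 1) (fishEyeArg ρ r r'))
                (n + N / 2 - 1))) := by
  -- The two admissible degrees are exchanged by ν ↦ -1-ν and give the same λ₀, so one analysis in λ
  -- covers both.
  have hlam : ν₀ * (ν₀ + 1) = excDegree N n * (excDegree N n + 1) := by
    rcases hν₀ with h | h <;> rw [h, excDegree] <;> ring
  have hlam' : excDegree N n * (excDegree N n + 1) = (n + N / 2) * (n + N / 2 - 1) := by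
    rw [excDegree]; ring
  have hexc : (n : ℂ) + N / 2 - 1 = excDegree N n := rfl
  have hfirst : ∀ r : EuclideanSpace ℝ (Fin N), r ≠ r' →
      (∀ᶠ lam in 𝓝[≠] (excDegree N n * (excDegree N n + 1)), DifferentiableAt ℂ (fun l : ℂ =>
        (l - excDegree N n * (excDegree N n + 1)) * fishEyeGreen N ρ l r r') lam) ∧
      Tendsto (fun lam : ℂ => deriv (fun l : ℂ =>
          (l - excDegree N n * (excDegree N n + 1)) * fishEyeGreen N ρ l r r') lam)
        (𝓝[≠] (excDegree N n * (excDegree N n + 1)))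
        (𝓝 (1 / (2 * (n : ℂ) + N - 1) * deriv (regGreen n ρ r r') (excDegree N n))) := by
    intro r hr
    have han := analyticAt_regGreen hN n hρ hr
    have hφ := analyticAt_degreeOf hN n
    have hφv := degreeOf_excDegree hN n
    have hcomp : AnalyticAt ℂ (regGreen n ρ r r' ∘ degreeOf)
        (excDegree N n * (excDegree N n + 1)) :=
      AnalyticAt.comp (by rw [hφv]; exact han) hφ
    have h := tendsto_deriv_of_eventuallyEq hcomp (regGreen_comp_eventuallyEq hN n hρ hr)
    rw [deriv_comp _ (by rw [hφv]; exact han.differentiableAt) hφ.differentiableAt, hφv,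
      deriv_degreeOf hN, mul_comm (deriv (regGreen n ρ r r') (excDegree N n))] at h
    exact h
  have hgen : ∀ r : EuclideanSpace ℝ (Fin N), r ≠ r' → fishEyeGeneralizedGreen N ρ ν₀ r r' =
      1 / (2 * (n : ℂ) + N - 1) * deriv (regGreen n ρ r r') (excDegree N n) := by
    intro r hr
    rw [fishEyeGeneralizedGreen, hlam]
    exact (hfirst r hr).2.limUnder_eq
  rw [hlam]
  refine ⟨not_exists_isFishEyeGreen hN hρ n hlam' r', ?_, ?_, fun r hr => ?_⟩
  · filter_upwards [eventually_degreeOf hN n] with l hl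
    have h := (fishEyeGreen_near hN hρ hl.1 hl.2 r').1
    rwa [degreeOf_mul] at h
  · exact (continuousOn_deriv_regGreen hN n hρ r').congr fun r hr => hgen r hr
  · have hs : fishSin ρ r' r ∈ Set.Ioc (0 : ℝ) 1 := ⟨fishSin_pos hρ hr, fishSin_le_one hρ r' r⟩
    have hs2 : fishSin ρ r' r ∈ Set.Ioo (0 : ℝ) 2 := ⟨hs.1, by linarith [hs.2]⟩
    have hleg : (fun ν : ℂ => legendreP ν (-(N : ℝ) / 2 + 1) (fishEyeArg ρ r r')) =
        fun ν => (legendreRatio N (fishSin ρ r' r) : ℂ) * zonalHyp N ν (fishSin ρ r' r) := by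
      funext ν
      rw [fishEyeArg_eq, legendreP_eq hN ν hs]
    have hd := differentiable_zonalHyp hN hs2
    obtain ⟨h1, h2⟩ := tendsto_deriv_of_eventuallyEq (analyticAt_regGreen hN n hρ hr)
      (regGreen_eventuallyEq hN n hρ hr)
    rw [hgen r hr, hexc]
    refine ⟨(hfirst r hr).1, (hfirst r hr).2, h1, h2.const_mul _, ?_, fun himg => ?_⟩
    · rw [hleg]
      exact (hd _).const_mul _
    · have hp := congrArg (fun t : ℝ => (t : ℂ)) (legendre_prefactor hN hρ hr himg)
      have hP := congrFun hleg (excDegree N n)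
      beta_reduce at hp hP
      rw [deriv_regGreen hN n hρ hr, hleg, hP, deriv_const_mul _ (hd _), greenFactor]
      rw [Complex.ofReal_mul] at hp
      -- The minus sign of the Green's function turns (-1)^(n+1) into (-1)^n.
      have e : ((-(ρ ^ (N - 2) * (fishFactor ρ r * fishFactor ρ r') /
          (4 * Real.pi ^ ((N : ℝ) / 2) * Real.Gamma ((N : ℝ) / 2))) : ℝ) : ℂ) =
          -(1 / (4 * ((Real.pi ^ ((N : ℝ) / 2) : ℝ) : ℂ))) * ((ρ ^ (N - 2) * (fishFactor ρ r *
            fishFactor ρ r') / Real.Gamma ((N : ℝ) / 2) : ℝ) : ℂ) := by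
        rw [show ρ ^ (N - 2) * (fishFactor ρ r * fishFactor ρ r') /
          (4 * Real.pi ^ ((N : ℝ) / 2) * Real.Gamma ((N : ℝ) / 2)) =
          1 / (4 * Real.pi ^ ((N : ℝ) / 2)) * (ρ ^ (N - 2) * (fishFactor ρ r *
            fishFactor ρ r') / Real.Gamma ((N : ℝ) / 2)) by rw [div_mul_div_comm, one_mul]]
        push_cast
        ring
      rw [e, ← hp]
      generalize ((ρ ^ ((N : ℝ) / 2 - 1) / (‖r - r'‖ ^ ((N : ℝ) / 2 - 1) *
        fishEyeImageFactor ρ r r' ^ ((N : ℝ) / 4 - 1 / 2)) : ℝ) : ℂ) = Q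
      generalize ((Real.pi ^ ((N : ℝ) / 2) : ℝ) : ℂ) = p
      generalize (legendreRatio N (fishSin ρ r' r) : ℂ) = T
      generalize 1 / (2 * (n : ℂ) + N - 1) = D
      rw [pow_succ]
      have e2 : ∀ a b c : ℂ, a / (4 * b * c) = a / c * (1 / (4 * b)) := fun a b c => by
        rw [div_mul_div_comm, mul_one, mul_comm c]
      rw [e2]
      ring
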